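/- For a finite simple undirected graph $G=(V,E)$ with $n=|V|\ge 1$ vertices and $m=|E|$ edges, and for $S\subseteq V$, let $t(S)$ be the number of triangles of $G$ all of whose three vertices lie in $S$, and let $t=t(V)$. The triangle-densest subgraph problem asks, given $G$, for a nonempty set $S^*\subseteq V$ such that $$\frac{t(S^*)}{|S^*|}=\max_{\emptyset\ne S\subseteq V}\frac{t(S)}{|S|}.$$ **Theorem 1.** There is a (deterministic) algorithm which solves the triangle-densest subgraph problem exactly on every such graph $G$ and runs in time $$O\big(m^{3/2}+nt+\min(n,t)^3+1\big),$$ with an absolute implied constant. Here the input is the number $n$, the number $m$ and the list of the $m$ edges (each edge once, as a pair of vertices from $\{0,\dots,n-1\}$, in arbitrary order), the output is the list of the elements of $S^*$, and time is the number of elementary operations of a random access machine with unit-cost arithmetic ($+$, truncated $-$, $\times$, integer division), comparisons and memory accesses on words of $O(\log (n+2))$ bits, all memory cells outside the input being initially $0$. -/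

import Mathlib

namespace TDS

/-! ### Triangles and triangle density -/

section Density

variable {V : Type*}

/-- The number `t(S)` of triangles of `G` all of whose vertices lie in `S`. -/
noncomputable def triangles (G : SimpleGraph V) (S : Finset V) : ℕ :=
  {T : Finset V | G.IsNClique 3 T ∧ T ⊆ S}.ncard

/-- The triangle density `τ(S) = t(S) / |S|` (meaningful for nonempty `S`). -/
noncomputable def density (G : SimpleGraph V) (S : Finset V) : ℚ :=
  (triangles G S : ℚ) / (S.card : ℚ)

/-- `S` solves the triangle-densest subgraph problem on `G`: it is a nonempty vertex set
whose triangle density is the largest among all nonempty vertex sets. -/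
def IsTriangleDensest (G : SimpleGraph V) (S : Finset V) : Prop :=
  S.Nonempty ∧ ∀ T : Finset V, T.Nonempty → density G T ≤ density G S

end Density

/-! ### The machine model

A random access machine with unit cost per operation and bounded words, programmed by
structured (`while`) programs. A program uses finitely many variables and finitely many
arrays (all names are constants of the program text); every variable and every array cell
holds a natural number. The parameter `W` is the word bound: an operation that involves a
number `≥ W` (operand, result, or array index) is not executable and the run gets stuck. -/

/-- The memory of the machine. -/
structure State where
  /-- the contents of the variables -/
  var : ℕ → ℕ
  /-- `arr a i` is the contents of cell `i` of array `a` -/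
  arr : ℕ → ℕ → ℕ

/-- The arithmetic and comparison operations on words. -/
inductive Op where
  | add
  | sub
  | mul
  | div
  | lt
  | eq

/-- Subtraction is truncated at `0`, division is rounded down (with `x / 0 = 0`), and the
comparisons return `1` for true and `0` for false. -/
def Op.apply : Op → ℕ → ℕ → ℕ
  | .add, x, y => x + y
  | .sub, x, y => x - y
  | .mul, x, y => x * y
  | .div, x, y => x / y
  | .lt, x, y => if x < y then 1 else 0
  | .eq, x, y => if x = y then 1 else 0

/-- Expressions: constants, variables, array accesses and operations. -/
inductive Expr where
  | const (c : ℕ)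
  | var (x : ℕ)
  | get (a : ℕ) (i : Expr)
  | bin (o : Op) (e₁ e₂ : Expr)

/-- The value of an expression. -/
def Expr.eval (s : State) : Expr → ℕ
  | .const c => c
  | .var x => s.var x
  | .get a i => s.arr a (i.eval s)
  | .bin o e₁ e₂ => o.apply (e₁.eval s) (e₂.eval s)

/-- All numbers that occur in the evaluation of an expression are smaller than `W`. -/
def Expr.Fits (W : ℕ) (s : State) : Expr → Prop
  | .const c => c < W
  | .var x => s.var x < W
  | .get a i => i.Fits W s ∧ s.arr a (i.eval s) < W
  | .bin o e₁ e₂ => e₁.Fits W s ∧ e₂.Fits W s ∧ o.apply (e₁.eval s) (e₂.eval s) < W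

/-- The time for evaluating an expression: one unit for each constant, variable access,
array access and operation. -/
def Expr.cost : Expr → ℕ
  | .const _ => 1
  | .var _ => 1
  | .get _ i => i.cost + 1
  | .bin _ e₁ e₂ => e₁.cost + e₂.cost + 1

/-- Programs: a condition counts as true if its value is not `0`. -/
inductive Prog where
  | skip
  /-- `var x := e` -/
  | assign (x : ℕ) (e : Expr)
  /-- `arr a [i] := e` -/
  | store (a : ℕ) (i e : Expr)
  | seq (p q : Prog)
  | ite (b : Expr) (p q : Prog)
  /-- `while b do p` -/
  | loop (b : Expr) (p : Prog)

/-- Write `v` to the variable `x`. -/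
def State.setVar (s : State) (x v : ℕ) : State :=
  { s with var := Function.update s.var x v }

/-- Write `v` to cell `i` of array `a`. -/
def State.setArr (s : State) (a i v : ℕ) : State :=
  { s with arr := Function.update s.arr a (Function.update (s.arr a) i v) }

/-- `Runs W p s k s'`: with word bound `W`, the program `p` started in memory `s` halts after
exactly `k` time units in memory `s'`. -/
inductive Runs (W : ℕ) : Prog → State → ℕ → State → Prop
  | skip (s : State) : Runs W .skip s 1 s
  | assign (s : State) (x : ℕ) (e : Expr) (he : e.Fits W s) :
      Runs W (.assign x e) s (e.cost + 1) (s.setVar x (e.eval s))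
  | store (s : State) (a : ℕ) (i e : Expr) (hi : i.Fits W s) (he : e.Fits W s) :
      Runs W (.store a i e) s (i.cost + e.cost + 1) (s.setArr a (i.eval s) (e.eval s))
  | seq (p q : Prog) (s s₁ s₂ : State) (k₁ k₂ : ℕ)
      (h₁ : Runs W p s k₁ s₁) (h₂ : Runs W q s₁ k₂ s₂) :
      Runs W (.seq p q) s (k₁ + k₂) s₂
  | ite_true (b : Expr) (p q : Prog) (s s' : State) (k : ℕ)
      (hb : b.Fits W s) (hv : b.eval s ≠ 0) (h : Runs W p s k s') :
      Runs W (.ite b p q) s (b.cost + 1 + k) s'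
  | ite_false (b : Expr) (p q : Prog) (s s' : State) (k : ℕ)
      (hb : b.Fits W s) (hv : b.eval s = 0) (h : Runs W q s k s') :
      Runs W (.ite b p q) s (b.cost + 1 + k) s'
  | loop_true (b : Expr) (p : Prog) (s s₁ s₂ : State) (k₁ k₂ : ℕ)
      (hb : b.Fits W s) (hv : b.eval s ≠ 0)
      (h₁ : Runs W p s k₁ s₁) (h₂ : Runs W (.loop b p) s₁ k₂ s₂) :
      Runs W (.loop b p) s (b.cost + 1 + k₁ + k₂) s₂
  | loop_false (b : Expr) (p : Prog) (s : State)
      (hb : b.Fits W s) (hv : b.eval s = 0) :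
      Runs W (.loop b p) s (b.cost + 1) s

/-! ### Input and output -/

/-- The pairs `(u 0, v 0), …, (u (m-1), v (m-1))` list every edge of `G` exactly once (in
arbitrary order, and with arbitrary order of the two endpoints); so `m` is the number of
edges. -/
def IsEdgeList {n m : ℕ} (G : SimpleGraph (Fin n)) (u v : Fin m → Fin n) : Prop :=
  Function.Injective (fun i => s(u i, v i)) ∧ Set.range (fun i => s(u i, v i)) = G.edgeSet

/-- The initial memory: variable `0` holds the number `n` of vertices, variable `1` the
number `m` of edges, arrays `0` and `1` hold in cell `i < m` the two endpoints of the `i`-th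
edge, and everything else is `0`. -/
def inputState {n m : ℕ} (u v : Fin m → Fin n) : State where
  var x := if x = 0 then n else if x = 1 then m else 0
  arr a i :=
    if h : i < m then
      if a = 0 then (u ⟨i, h⟩ : ℕ) else if a = 1 then (v ⟨i, h⟩ : ℕ) else 0
    else 0

/-- The memory `s` contains the vertex set `S` as output: variable `0` holds `|S|`, and the
first `|S|` cells of array `0` hold the elements of `S`, each once, in some order. -/
def Outputs {n : ℕ} (s : State) (S : Finset (Fin n)) : Prop :=
  s.var 0 = S.card ∧ (Finset.range S.card).image (s.arr 0) = S.image Fin.val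

end TDS

namespace TDS

open Finset

/-! ### A weakest precondition calculus with running times -/

/-! Let every triangle distribute a mass `K = 3n²` among its three vertices, and let the load of a
vertex be the mass it receives. With `c = ⌊K · (best recorded density)⌋`, a local search shifts mass
inside triangles towards vertices of load below `c`. It is a push-relabel method with reversed
roles: a deficient vertex of height `h` pulls from vertices of height `h - 1` in its triangles, and
is raised when its scan list is exhausted. By `TriSys.Inv`, heights drop by at most one from a
vertex to a carrier of mass in the same triangle, and vertices of positive height have load at most
`c`.

When no vertex below height `N` is deficient (`N` is the number of vertices in triangles), some
level `g ≤ N` is empty. No positive mass of a triangle that meets the part above `g` lies below `g`.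
Hence deleting the upper part from a set `S` costs at most `c / K` triangles per vertex
(`Inv.count_le_peel`). If `S` is densest and the recorded set is not, this loss is too small to
lower the density (`Densest.peel`). So a densest set survives among the living vertices unless one
is already recorded. If nothing is deleted, all living vertices have load at least `c`, so every
living set `S` misses at least `c / K` triangles per missing vertex (`Inv.count_le_of_full`). The
living set is not denser than the record, and `K > n²` makes the rounding of `c` harmless, so the
record is optimal (`Densest.of_full`).

Each round but the last deletes a vertex, so there are at most `N + 1` rounds. Recorded densities
only increase, hence so does `c`; the preflow, the heights and the scan pointers are kept between
rounds, so scanning costs `O(N(t + N))` in total. The potential "largest deficient height plus twice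
the remaining relabelings" (`TriSys.Pending`) bounds the passes over the vertices by `O(N²)` in
total, each with overhead `O(N)`. Recounting triangles and searching for gaps costs `O(t + N²)` per
round. As `N ≤ min(n, 3t)`, this gives `O(nt + min(n,t)³ + 1)`.

Triangles are listed in time `O(m^{3/2} + 1)`: edges point towards the larger degree, so out-degrees
are at most `√(2m)` (`out_degree_le`), and each triangle is exactly one pair of edges with a common
tail whose heads are joined in the right direction (`IsOrientation.card_forks`).

Running times are handled by weakest preconditions in which loops carry a time credit (`wp_loop`);
`wp_sound` transfers them to the machine and settles word sizes once and for all. -/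

/-- The number of leaves of an expression. -/
def Expr.leaves : Expr → ℕ
  | .const _ => 1
  | .var _ => 1
  | .get _ i => i.leaves
  | .bin _ e₁ e₂ => e₁.leaves + e₂.leaves

/-- All constants of the expression are at most `3`. -/
def Expr.smallConsts : Expr → Bool
  | .const c => c ≤ 3
  | .var _ => true
  | .get _ i => i.smallConsts
  | .bin _ e₁ e₂ => e₁.smallConsts && e₂.smallConsts

/-- The expression is small enough to be evaluated on words of twelve times the length. -/
def Expr.small (e : Expr) : Bool := e.smallConsts && decide (e.leaves ≤ 12)

/-- All expressions of the program are small. -/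
def Prog.small : Prog → Bool
  | .skip => true
  | .assign _ e => e.small
  | .store _ i e => i.small && e.small
  | .seq p q => p.small && q.small
  | .ite b p q => b.small && p.small && q.small
  | .loop b p => b.small && p.small

/-- Every variable and every cell holds a number `≤ B`. -/
def State.BddBy (B : ℕ) (s : State) : Prop :=
  (∀ x, s.var x ≤ B) ∧ ∀ a i, s.arr a i ≤ B

theorem Expr.leaves_pos (e : Expr) : 1 ≤ e.leaves := by
  induction e <;> simp_all [Expr.leaves]; omega

/-- Exponents add: a product multiplies the two bounds, and a sum is dominated by their product
because both are at least 2. So the number of leaves serves as an exponent for the value of an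
expression. -/
theorem Op.apply_le {B x y a b : ℕ} (hB : 2 ≤ B) (ha : 1 ≤ a) (hb : 1 ≤ b)
    (hx : x ≤ B ^ a) (hy : y ≤ B ^ b) (o : Op) : o.apply x y ≤ B ^ (a + b) := by
  have h2a : 2 ≤ B ^ a := hB.trans (Nat.le_self_pow (by omega) B)
  have h2b : 2 ≤ B ^ b := hB.trans (Nat.le_self_pow (by omega) B)
  have hab : B ^ a + B ^ b ≤ B ^ (a + b) := by rw [pow_add]; nlinarith
  cases o
  · exact (add_le_add hx hy).trans hab
  · exact ((Nat.sub_le x y).trans hx).trans ((Nat.le_add_right _ _).trans hab)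
  · rw [pow_add]; exact Nat.mul_le_mul hx hy
  · exact ((Nat.div_le_self x y).trans hx).trans ((Nat.le_add_right _ _).trans hab)
  · simp only [Op.apply]; split_ifs <;> omega
  · simp only [Op.apply]; split_ifs <;> omega

/-- For an array access the bound comes from the stored contents and not from the index; no range
check for indices is ever needed. -/
theorem Expr.fits_aux {B W : ℕ} {s : State} (hB : 3 ≤ B) (hs : s.BddBy B) (e : Expr)
    (hc : e.smallConsts = true) (hW : B ^ e.leaves < W) :
    e.Fits W s ∧ e.eval s ≤ B ^ e.leaves := by
  induction e with
  | const c =>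
    simp only [Expr.smallConsts, decide_eq_true_eq] at hc
    simp only [Expr.leaves, pow_one] at hW
    simp only [Expr.Fits, Expr.eval, Expr.leaves, pow_one]
    omega
  | var x =>
    have := hs.1 x
    simp only [Expr.leaves, pow_one] at hW
    simp only [Expr.Fits, Expr.eval, Expr.leaves, pow_one]
    omega
  | get a i ih =>
    have h := hs.2 a (i.eval s)
    have h' : B ≤ B ^ i.leaves := Nat.le_self_pow (by have := i.leaves_pos; omega) B
    simp only [Expr.leaves] at hW
    simp only [Expr.Fits, Expr.eval, Expr.leaves]
    exact ⟨⟨(ih hc hW).1, by omega⟩, h.trans h'⟩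
  | bin o e₁ e₂ ih₁ ih₂ =>
    simp only [Expr.smallConsts, Bool.and_eq_true] at hc
    simp only [Expr.leaves] at hW
    have l₁ := e₁.leaves_pos
    have l₂ := e₂.leaves_pos
    have w₁ : B ^ e₁.leaves < W := (Nat.pow_le_pow_right (by omega) (by omega)).trans_lt hW
    have w₂ : B ^ e₂.leaves < W := (Nat.pow_le_pow_right (by omega) (by omega)).trans_lt hW
    have h := Op.apply_le (by omega) l₁ l₂ (ih₁ hc.1 w₁).2 (ih₂ hc.2 w₂).2 o
    exact ⟨⟨(ih₁ hc.1 w₁).1, (ih₂ hc.2 w₂).1, h.trans_lt hW⟩, h⟩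

theorem Expr.fits_of_small {B W : ℕ} {s : State} (hB : 3 ≤ B) (hW : B ^ 12 < W)
    (hs : s.BddBy B) {e : Expr} (he : e.small = true) : e.Fits W s := by
  simp only [Expr.small, Bool.and_eq_true, decide_eq_true_eq] at he
  exact (e.fits_aux hB hs he.1 ((Nat.pow_le_pow_right (by omega) he.2).trans_lt hW)).1

theorem State.BddBy.setVar {B : ℕ} {s : State} (hs : s.BddBy B) {x v : ℕ} (hv : v ≤ B) :
    (s.setVar x v).BddBy B := by
  refine ⟨fun y => ?_, hs.2⟩
  simp only [State.setVar, Function.update_apply]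
  split_ifs
  · exact hv
  · exact hs.1 y

theorem State.BddBy.setArr {B : ℕ} {s : State} (hs : s.BddBy B) {a i v : ℕ} (hv : v ≤ B) :
    (s.setArr a i v).BddBy B := by
  refine ⟨hs.1, fun b j => ?_⟩
  simp only [State.setArr, Function.update_apply]
  split_ifs
  · simp only [Function.update_apply]
    split_ifs
    · exact hv
    · exact hs.2 _ _
  · exact hs.2 _ _

/-- The weakest precondition of a loop that stops after fewer than the given number of
iterations. -/
def wpLoop (b : Expr) (body : (ℕ → State → Prop) → State → Prop) :
    ℕ → (ℕ → State → Prop) → State → Prop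
  | 0, _, _ => False
  | f + 1, Q, s => (b.eval s = 0 → Q (b.cost + 1) s) ∧
      (b.eval s ≠ 0 → body (fun k s₁ =>
        wpLoop b body f (fun k₂ s₂ => Q (b.cost + 1 + k + k₂) s₂) s₁) s)

/-- Started in `s`, the program writes only numbers `≤ B`, and halts after `k` time units in a
memory `s'` such that `Q k s'`. -/
def wp (B : ℕ) : Prog → (ℕ → State → Prop) → State → Prop
  | .skip, Q, s => Q 1 s
  | .assign x e, Q, s => e.eval s ≤ B ∧ Q (e.cost + 1) (s.setVar x (e.eval s))
  | .store a i e, Q, s =>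
      e.eval s ≤ B ∧ Q (i.cost + e.cost + 1) (s.setArr a (i.eval s) (e.eval s))
  | .seq p q, Q, s => wp B p (fun k₁ s₁ => wp B q (fun k₂ s₂ => Q (k₁ + k₂) s₂) s₁) s
  | .ite b p q, Q, s =>
      (b.eval s ≠ 0 → wp B p (fun k s' => Q (b.cost + 1 + k) s') s) ∧
      (b.eval s = 0 → wp B q (fun k s' => Q (b.cost + 1 + k) s') s)
  | .loop b p, Q, s => ∃ f, wpLoop b (wp B p) f Q s

/-- As `wp` keeps all written numbers at most `B`, memory stays bounded by `B`, and then every small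
expression fits into words below `W`. Intermediate results need not be examined in the program
proofs. -/
theorem wp_sound {B W : ℕ} (hB : 3 ≤ B) (hW : B ^ 12 < W) (p : Prog) (hp : p.small = true)
    {Q : ℕ → State → Prop} {s : State} (hs : s.BddBy B) (h : wp B p Q s) :
    ∃ k s', Runs W p s k s' ∧ s'.BddBy B ∧ Q k s' := by
  induction p generalizing Q s with
  | skip => exact ⟨_, _, .skip s, hs, h⟩
  | assign x e => exact ⟨_, _, .assign s x e (e.fits_of_small hB hW hs hp), hs.setVar h.1, h.2⟩
  | store a i e =>
    simp only [Prog.small, Bool.and_eq_true] at hp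
    exact ⟨_, _, .store s a i e (i.fits_of_small hB hW hs hp.1) (e.fits_of_small hB hW hs hp.2),
      hs.setArr h.1, h.2⟩
  | seq p q ihp ihq =>
    simp only [Prog.small, Bool.and_eq_true] at hp
    obtain ⟨k₁, s₁, r₁, b₁, h₁⟩ := ihp hp.1 hs h
    obtain ⟨k₂, s₂, r₂, b₂, h₂⟩ := ihq hp.2 b₁ h₁
    exact ⟨_, _, .seq _ _ _ _ _ _ _ r₁ r₂, b₂, h₂⟩
  | ite b p q ihp ihq =>
    simp only [Prog.small, Bool.and_eq_true] at hp
    have hb := b.fits_of_small hB hW hs hp.1.1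
    by_cases hv : b.eval s = 0
    · obtain ⟨k₁, s₁, r₁, b₁, h₁⟩ := ihq hp.2 hs (h.2 hv)
      exact ⟨_, _, .ite_false _ _ _ _ _ _ hb hv r₁, b₁, h₁⟩
    · obtain ⟨k₁, s₁, r₁, b₁, h₁⟩ := ihp hp.1.2 hs (h.1 hv)
      exact ⟨_, _, .ite_true _ _ _ _ _ _ hb hv r₁, b₁, h₁⟩
  | loop b p ihp =>
    simp only [Prog.small, Bool.and_eq_true] at hp
    obtain ⟨f, h⟩ := h
    induction f generalizing Q s with
    | zero => exact h.elim
    | succ f ihf =>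
      have hb := b.fits_of_small hB hW hs hp.1
      by_cases hv : b.eval s = 0
      · exact ⟨_, _, .loop_false _ _ _ hb hv, hs, h.1 hv⟩
      · obtain ⟨k₁, s₁, r₁, b₁, h₁⟩ := ihp hp.2 hs (h.2 hv)
        obtain ⟨k₂, s₂, r₂, b₂, h₂⟩ := ihf b₁ h₁
        exact ⟨_, _, .loop_true _ _ _ _ _ _ _ hb hv r₁ r₂, b₂, h₂⟩

theorem wp_mono {B : ℕ} {p : Prog} {Q Q' : ℕ → State → Prop} {s : State} (h : wp B p Q s)
    (hQ : ∀ k s', Q k s' → Q' k s') : wp B p Q' s := by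
  induction p generalizing Q Q' s with
  | skip => exact hQ _ _ h
  | assign x e => exact ⟨h.1, hQ _ _ h.2⟩
  | store a i e => exact ⟨h.1, hQ _ _ h.2⟩
  | seq p q ihp ihq => exact ihp h fun k s' h' => ihq h' fun _ _ => hQ _ _
  | ite b p q ihp ihq =>
    exact ⟨fun hv => ihp (h.1 hv) fun _ _ => hQ _ _, fun hv => ihq (h.2 hv) fun _ _ => hQ _ _⟩
  | loop b p ihp =>
    obtain ⟨f, h⟩ := h
    refine ⟨f, ?_⟩
    induction f generalizing Q Q' s with
    | zero => exact h
    | succ f ihf =>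
      exact ⟨fun hv => hQ _ _ (h.1 hv), fun hv => ihp (h.2 hv) fun k s' h' =>
        ihf (fun _ _ => hQ _ _) h'⟩

/-- The variables that the program may write. -/
def Prog.varsWritten : Prog → List ℕ
  | .skip => []
  | .assign x _ => [x]
  | .store _ _ _ => []
  | .seq p q => p.varsWritten ++ q.varsWritten
  | .ite _ p q => p.varsWritten ++ q.varsWritten
  | .loop _ p => p.varsWritten

/-- The arrays that the program may write. -/
def Prog.arrsWritten : Prog → List ℕ
  | .skip => []
  | .assign _ _ => []
  | .store a _ _ => [a]
  | .seq p q => p.arrsWritten ++ q.arrsWritten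
  | .ite _ p q => p.arrsWritten ++ q.arrsWritten
  | .loop _ p => p.arrsWritten

/-- `s` and `s'` agree outside what `p` may write. -/
def Frame (p : Prog) (s s' : State) : Prop :=
  (∀ x, x ∉ p.varsWritten → s'.var x = s.var x) ∧
    ∀ a, a ∉ p.arrsWritten → s'.arr a = s.arr a

theorem Frame.refl (p : Prog) (s : State) : Frame p s s := ⟨fun _ _ => rfl, fun _ _ => rfl⟩

theorem Frame.trans {p : Prog} {s s₁ s₂ : State} (h : Frame p s s₁) (h' : Frame p s₁ s₂) :
    Frame p s s₂ :=
  ⟨fun x hx => (h'.1 x hx).trans (h.1 x hx), fun x hx => (h'.2 x hx).trans (h.2 x hx)⟩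

theorem Frame.mono {p q : Prog} {s s' : State} (h : Frame p s s')
    (hv : p.varsWritten ⊆ q.varsWritten) (ha : p.arrsWritten ⊆ q.arrsWritten) : Frame q s s' :=
  ⟨fun x hx => h.1 x fun h' => hx (hv h'), fun x hx => h.2 x fun h' => hx (ha h')⟩

/-- Loop invariants can thus omit everything the body does not write; the sets of written names are
syntactic, so that membership is settled by `decide`. -/
theorem wp_frame {B : ℕ} {p : Prog} {Q : ℕ → State → Prop} {s : State} (h : wp B p Q s) :
    wp B p (fun k s' => Q k s' ∧ Frame p s s') s := by
  induction p generalizing Q s with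
  | skip => exact ⟨h, .refl _ _⟩
  | assign x e =>
    refine ⟨h.1, h.2, fun y hy => ?_, fun _ _ => rfl⟩
    simp only [Prog.varsWritten, List.mem_singleton] at hy
    simp [State.setVar, hy]
  | store a i e =>
    refine ⟨h.1, h.2, fun _ _ => rfl, fun y hy => ?_⟩
    simp only [Prog.arrsWritten, List.mem_singleton] at hy
    simp [State.setArr, hy]
  | seq p q ihp ihq =>
    refine wp_mono (p := p) (ihp h) fun k₁ s₁ h₁ =>
      wp_mono (ihq h₁.1) fun k₂ s₂ h₂ => ⟨h₂.1, ?_⟩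
    exact (h₁.2.mono (by simp [Prog.varsWritten]) (by simp [Prog.arrsWritten])).trans
      (h₂.2.mono (by simp [Prog.varsWritten]) (by simp [Prog.arrsWritten]))
  | ite b p q ihp ihq =>
    refine ⟨fun hv => wp_mono (ihp (h.1 hv)) fun k s' h' => ⟨h'.1, ?_⟩,
      fun hv => wp_mono (ihq (h.2 hv)) fun k s' h' => ⟨h'.1, ?_⟩⟩
    · exact h'.2.mono (by simp [Prog.varsWritten]) (by simp [Prog.arrsWritten])
    · exact h'.2.mono (by simp [Prog.varsWritten]) (by simp [Prog.arrsWritten])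
  | loop b p ihp =>
    obtain ⟨f, h⟩ := h
    refine ⟨f, ?_⟩
    -- The frame refers to the state before the whole loop, so the induction on the fuel starts from
    -- an arbitrary intermediate state.
    have key : ∀ f (Q : ℕ → State → Prop) s₀, Frame p s s₀ → wpLoop b (wp B p) f Q s₀ →
        wpLoop b (wp B p) f (fun k s' => Q k s' ∧ Frame (.loop b p) s s') s₀ := by
      intro f
      induction f with
      | zero => intro Q s₀ _ h; exact h
      | succ f ihf =>
        intro Q s₀ h₀ h
        refine ⟨fun hv => ⟨h.1 hv, h₀⟩, fun hv => wp_mono (ihp (h.2 hv)) fun k s' h' => ?_⟩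
        exact ihf _ _ (h₀.trans h'.2) h'.1
    exact key f Q s (.refl _ _) h

/-- Executing `p` first. -/
theorem wp_seq {B : ℕ} {p q : Prog} {Q Q' : ℕ → State → Prop} {s : State} (h : wp B p Q s)
    (h' : ∀ k s', Q k s' → Frame p s s' → wp B q (fun k₂ s₂ => Q' (k + k₂) s₂) s') :
    wp B (.seq p q) Q' s :=
  wp_mono (p := p) (wp_frame h) fun k s' hk => h' k s' hk.1 hk.2

/-- The rule for loops; `φ` is the time that is still available for the iterations. -/
theorem wp_loop {B : ℕ} {b : Expr} {p : Prog} {I : State → ℕ → Prop} {s₀ : State} {φ₀ : ℕ}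
    (init : I s₀ φ₀)
    (step : ∀ s φ, Frame p s₀ s → I s φ → b.eval s ≠ 0 →
      wp B p (fun k s' => ∃ φ', I s' φ' ∧ φ' + (k + b.cost + 1) ≤ φ) s) :
    wp B (.loop b p) (fun k s' => ∃ φ', I s' φ' ∧ b.eval s' = 0 ∧ k + φ' ≤ φ₀ + b.cost + 1) s₀ := by
  -- Every iteration costs at least one unit of credit, so any fuel exceeding the credit suffices
  -- for termination.
  have key : ∀ f s φ (Q : ℕ → State → Prop), φ < f → Frame p s₀ s → I s φ →
      (∀ k s' φ', I s' φ' → b.eval s' = 0 → k + φ' ≤ φ + b.cost + 1 → Q k s') →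
      wpLoop b (wp B p) f Q s := by
    intro f
    induction f with
    | zero => intro s φ Q h; omega
    | succ f ih =>
      intro s φ Q hf hfr hI hQ
      refine ⟨fun hv => hQ _ _ φ hI hv (by omega), fun hv => ?_⟩
      refine wp_mono (wp_frame (step s φ hfr hI hv)) ?_
      rintro k s' ⟨⟨φ', hI', hk⟩, hfr'⟩
      refine ih s' φ' _ (by omega) (hfr.trans hfr') hI' fun k₂ s₂ φ₂ h₁ h₂ h₃ => ?_
      exact hQ _ _ φ₂ h₁ h₂ (by omega)
  exact ⟨φ₀ + 1, key _ _ _ _ (Nat.lt_succ_self _) (.refl _ _) init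
    fun k s' φ' h₁ h₂ h₃ => ⟨φ', h₁, h₂, h₃⟩⟩

/-! ### Counting loops and memory access -/

theorem ite_one_zero_eq_zero {p : Prop} [Decidable p] : (if p then 1 else 0) = 0 ↔ ¬p := by
  split_ifs with h <;> simp [h]

attribute [simp] wp Expr.eval Op.apply Expr.cost ite_one_zero_eq_zero

@[simp] theorem State.setVar_var (s : State) (x v y : ℕ) :
    (s.setVar x v).var y = if y = x then v else s.var y := by
  simp [State.setVar, Function.update_apply]

@[simp] theorem State.setVar_arr (s : State) (x v : ℕ) : (s.setVar x v).arr = s.arr := rfl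

@[simp] theorem State.setArr_var (s : State) (a i v : ℕ) : (s.setArr a i v).var = s.var := rfl

@[simp] theorem State.setArr_arr (s : State) (a i v b : ℕ) :
    (s.setArr a i v).arr b = if b = a then Function.update (s.arr a) i v else s.arr b := by
  by_cases h : b = a
  · subst h; simp [State.setArr]
  · simp [State.setArr, h]

theorem Frame.of_setVar {p : Prog} {s : State} {x v : ℕ} (hx : x ∈ p.varsWritten) :
    Frame p s (s.setVar x v) := by
  refine ⟨fun y hy => ?_, fun _ _ => rfl⟩
  have : y ≠ x := by rintro rfl; exact hy hx
  simp [this]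

/-- `for i < var b do p` -/
def forLoop (i b : ℕ) (p : Prog) : Prog :=
  .seq (.assign i (.const 0)) (.loop (.bin .lt (.var i) (.var b))
    (.seq p (.assign i (.bin .add (.var i) (.const 1)))))

/-- The rule for counting loops; `φ` is the time that is still available for the bodies. -/
theorem wp_forLoop_credit {B i b : ℕ} {p : Prog} {J : ℕ → State → ℕ → Prop} {s₀ : State} {φ₀ : ℕ}
    (hi : i ∉ p.varsWritten) (hb : b ∉ p.varsWritten) (hib : b ≠ i) (hB : s₀.var b ≤ B)
    (init : J 0 (s₀.setVar i 0) φ₀)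
    (step : ∀ j s φ, j < s₀.var b → Frame (forLoop i b p) s₀ s → s.var i = j → J j s φ →
      wp B p (fun k s' => ∃ φ', J (j + 1) (s'.setVar i (j + 1)) φ' ∧ φ' + k ≤ φ) s) :
    wp B (forLoop i b p)
      (fun k s' => ∃ φ', J (s₀.var b) s' φ' ∧ k + φ' ≤ φ₀ + 8 * s₀.var b + 6) s₀ := by
  set N := s₀.var b with hN
  have hmem : ∀ x, x ∉ p.varsWritten → x ≠ i → x ∉ (forLoop i b p).varsWritten := by
    intro x h₁ h₂; simp [forLoop, Prog.varsWritten, h₁, h₂]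
  refine ⟨Nat.zero_le _, ?_⟩
  -- Apart from the body, an iteration costs 8: 4 for the test and 4 for the increment. The
  -- initialization (2) and the last test (4) account for the summand 6.
  let I : State → ℕ → Prop := fun s φ => Frame (forLoop i b p) s₀ s ∧
    s.var i ≤ N ∧ ∃ ψ, J (s.var i) s ψ ∧ φ = ψ + 8 * (N - s.var i)
  have h := @wp_loop B (.bin .lt (.var i) (.var b))
    (.seq p (.assign i (.bin .add (.var i) (.const 1)))) I (s₀.setVar i 0) (φ₀ + 8 * N) ?_ ?_
  · refine wp_mono h ?_
    rintro k s' ⟨φ', ⟨hfr, hle, ψ, hJ, hψ⟩, hv, hk⟩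
    have hsb : s'.var b = N := hfr.1 b (hmem b hb hib)
    have : s'.var i = N := by
      simp only [Expr.eval, Op.apply, hsb] at hv
      split_ifs at hv with hlt
      omega
    refine ⟨ψ, this ▸ hJ, ?_⟩
    simp only [Expr.cost] at hk ⊢
    omega
  · refine ⟨⟨fun x hx => ?_, fun _ _ => rfl⟩, by simp, φ₀, by simpa using init, by simp⟩
    have : x ≠ i := by rintro rfl; exact hx (by simp [forLoop, Prog.varsWritten])
    simp [this]
  · rintro s φ - ⟨hfr, hle, ψ, hJ, rfl⟩ hv
    have hsb : s.var b = N := hfr.1 b (hmem b hb hib)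
    have hlt : s.var i < N := by
      simp only [Expr.eval, Op.apply, hsb] at hv
      by_contra h'
      simp [h'] at hv
    refine wp_mono (p := p) (wp_frame (step _ s ψ hlt hfr rfl hJ)) ?_
    rintro k s' ⟨⟨φ', hJ', hk⟩, hfr'⟩
    have hi' : s'.var i = s.var i := hfr'.1 i hi
    refine ⟨by simp only [Expr.eval, Op.apply, hi']; omega, _, ⟨?_, ?_, φ', ?_, rfl⟩, ?_⟩
    · refine (hfr.trans (hfr'.mono ?_ ?_)).trans ⟨fun x hx => ?_, fun _ _ => rfl⟩
      · intro x hx; simp [forLoop, Prog.varsWritten, hx]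
      · intro x hx; simp [forLoop, Prog.arrsWritten, hx]
      · have : x ≠ i := by rintro rfl; exact hx (by simp [forLoop, Prog.varsWritten])
        simp [this]
    · simp only [Expr.eval, Op.apply, hi', State.setVar_var, if_true]; omega
    · simpa [Expr.eval, Op.apply, hi'] using hJ'
    · simp only [Expr.eval, Op.apply, hi', State.setVar_var, if_true, Expr.cost]; omega

/-- The rule for counting loops whose body takes time at most `C`. -/
theorem wp_forLoop {B i b : ℕ} {p : Prog} (J : ℕ → State → Prop) (C : ℕ) {s₀ : State}
    (hi : i ∉ p.varsWritten) (hb : b ∉ p.varsWritten) (hib : b ≠ i) (hB : s₀.var b ≤ B)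
    (init : J 0 (s₀.setVar i 0))
    (step : ∀ j s, j < s₀.var b → Frame (forLoop i b p) s₀ s → s.var i = j → J j s →
      wp B p (fun k s' => J (j + 1) (s'.setVar i (j + 1)) ∧ k ≤ C) s) :
    wp B (forLoop i b p)
      (fun k s' => J (s₀.var b) s' ∧ k ≤ (C + 8) * s₀.var b + 6) s₀ := by
  refine wp_mono (wp_forLoop_credit (J := fun j s φ => J j s ∧ φ = C * (s₀.var b - j))
    (φ₀ := C * s₀.var b) hi hb hib hB ⟨init, by simp⟩ ?_) ?_
  · rintro j s φ hj hfr hs ⟨hJ, rfl⟩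
    refine wp_mono (step j s hj hfr hs hJ) ?_
    rintro k s' ⟨hJ', hk⟩
    refine ⟨_, ⟨hJ', rfl⟩, ?_⟩
    obtain ⟨d, hd⟩ : ∃ d, s₀.var b - j = d + 1 := ⟨s₀.var b - j - 1, by omega⟩
    rw [hd, show s₀.var b - (j + 1) = d by omega, Nat.mul_succ]; omega
  · rintro k s' ⟨φ', ⟨hJ, rfl⟩, hk⟩
    refine ⟨hJ, ?_⟩
    rw [Nat.add_mul]
    omega

/-! ### Preflows on a list of triangles -/

/-- A list of `t` triangles: the vertices of the `j`-th triangle are `vert (3 j)`,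
`vert (3 j + 1)`, `vert (3 j + 2)`. The numbers `e < 3 t` are called slots; the slots of the
vertex `v` are `inc (v * (3 t) + i)`, `i < cnt v`. -/
structure TriSys where
  t : ℕ
  vert : ℕ → ℕ
  inc : ℕ → ℕ
  cnt : ℕ → ℕ

namespace TriSys

/-- The vertices that lie in a triangle. -/
def act (T : TriSys) : Finset ℕ := (range (3 * T.t)).image T.vert

/-- The number of triangles inside `S`. -/
def count (T : TriSys) (S : Finset ℕ) : ℕ :=
  #{j ∈ range T.t | T.vert (3 * j) ∈ S ∧ T.vert (3 * j + 1) ∈ S ∧ T.vert (3 * j + 2) ∈ S}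

/-- The slot at the vertex `v` that corresponds to the `j`-th item of the scan list of `v`. -/
def own (T : TriSys) (v j : ℕ) : ℕ := T.inc (v * (3 * T.t) + j / 3)

/-- The slot from which the `j`-th item of the scan list of `v` can pull. -/
def item (T : TriSys) (v j : ℕ) : ℕ := 3 * (T.own v j / 3) + (j - 3 * (j / 3))

/-- `inc` lists for each vertex exactly its slots. Since each slot occurs, `sum_cnt` excludes
repetitions; it also makes the total length of the scan lists `9t`. -/
structure WF (T : TriSys) : Prop where
  inc_lt : ∀ v i, i < T.cnt v → T.inc (v * (3 * T.t) + i) < 3 * T.t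
  vert_inc : ∀ v i, i < T.cnt v → T.vert (T.inc (v * (3 * T.t) + i)) = v
  inc_surj : ∀ e < 3 * T.t, ∃ i < T.cnt (T.vert e), T.inc (T.vert e * (3 * T.t) + i) = e
  sum_cnt : ∑ v ∈ T.act, T.cnt v = 3 * T.t

/-- The invariant of the preflow algorithm with capacity `c`: the slot `e` carries mass `F e`,
each triangle distributes mass `K` among its slots, `LOAD v` is the mass at `v`, `H` is the
height and `PTR` the current position in the scan list. -/
structure Inv (T : TriSys) (K N c : ℕ) (H PTR F LOAD : ℕ → ℕ) : Prop where
  height_le : ∀ v, H v ≤ N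
  ptr_le : ∀ v, PTR v ≤ 3 * T.cnt v
  mass : ∀ j < T.t, F (3 * j) + F (3 * j + 1) + F (3 * j + 2) = K
  load : ∀ v, LOAD v = ∑ e ∈ range (3 * T.t), if T.vert e = v then F e else 0
  valid : ∀ e < 3 * T.t, ∀ e' < 3 * T.t, e / 3 = e' / 3 → 0 < F e' →
    H (T.vert e) ≤ H (T.vert e') + 1
  scanned : ∀ v, ∀ j < PTR v, 0 < F (T.item v j) → H v ≤ H (T.vert (T.item v j))
  sat : ∀ v, 0 < H v → LOAD v ≤ c

variable {T : TriSys} {K N c : ℕ} {H PTR F LOAD : ℕ → ℕ}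

theorem vert_mem_act {e : ℕ} (he : e < 3 * T.t) : T.vert e ∈ T.act :=
  mem_image_of_mem _ (mem_range.2 he)

theorem WF.own_lt (hT : T.WF) {v j : ℕ} (hj : j < 3 * T.cnt v) : T.own v j < 3 * T.t :=
  hT.inc_lt v (j / 3) (by omega)

theorem WF.vert_own (hT : T.WF) {v j : ℕ} (hj : j < 3 * T.cnt v) : T.vert (T.own v j) = v :=
  hT.vert_inc v (j / 3) (by omega)

theorem item_div (T : TriSys) (v j : ℕ) : T.item v j / 3 = T.own v j / 3 := by
  simp only [item]; omega

theorem WF.item_lt (hT : T.WF) {v j : ℕ} (hj : j < 3 * T.cnt v) : T.item v j < 3 * T.t := by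
  have := hT.own_lt hj
  simp only [item]; omega

theorem sum_ite_update (n : ℕ) (P : ℕ → Prop) [DecidablePred P] (F : ℕ → ℕ) {e : ℕ} (x : ℕ)
    (he : e < n) :
    (∑ i ∈ range n, if P i then Function.update F e x i else 0) + (if P e then F e else 0) =
      (∑ i ∈ range n, if P i then F i else 0) + if P e then x else 0 := by
  have he' := mem_range.2 he
  rw [← add_sum_erase _ _ he', ← add_sum_erase (range n) (fun i => if P i then F i else 0) he']
  have : ∑ i ∈ (range n).erase e, (if P i then Function.update F e x i else 0) =
      ∑ i ∈ (range n).erase e, if P i then F i else 0 :=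
    sum_congr rfl fun i hi => by rw [Function.update_of_ne (ne_of_mem_erase hi)]
  simp only [this, Function.update_self]
  omega

theorem sum_add_of_eq_off {s : Finset ℕ} {g g' : ℕ → ℕ} {v d : ℕ} (hv : v ∈ s)
    (h : ∀ u ∈ s, u ≠ v → g' u = g u) (hd : g' v + d = g v) :
    ∑ u ∈ s, g' u + d = ∑ u ∈ s, g u := by
  rw [← add_sum_erase _ _ hv, ← add_sum_erase s g hv]
  have : ∑ i ∈ s.erase v, g' i = ∑ i ∈ s.erase v, g i :=
    sum_congr rfl fun i hi => h i (mem_of_mem_erase hi) (ne_of_mem_erase hi)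
  omega

/-- Pulling mass along an admissible item. -/
theorem Inv.pull (hT : T.WF) (h : T.Inv K N c H PTR F LOAD) {e₀ e δ : ℕ} (he₀ : e₀ < 3 * T.t)
    (he : e < 3 * T.t) (hee : e / 3 = e₀ / 3) (hH : H (T.vert e) + 1 = H (T.vert e₀))
    (hδ : δ ≤ F e) (hδc : LOAD (T.vert e₀) + δ ≤ c) :
    T.Inv K N c H PTR (Function.update (Function.update F e (F e - δ)) e₀ (F e₀ + δ))
      (Function.update (Function.update LOAD (T.vert e) (LOAD (T.vert e) - δ)) (T.vert e₀)
        (LOAD (T.vert e₀) + δ)) := by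
  have hvw : T.vert e ≠ T.vert e₀ := fun h' => by rw [h'] at hH; omega
  have hne : e ≠ e₀ := fun h' => hvw (by rw [h'])
  -- Only `e₀` can newly acquire positive mass, and in that case `e` had positive mass before.
  have hpos : ∀ e', 0 < Function.update (Function.update F e (F e - δ)) e₀ (F e₀ + δ) e' →
      0 < F e' ∨ (e' = e₀ ∧ 0 < F e) := by
    intro e' h'
    simp only [Function.update_apply] at h'
    split_ifs at h' with h₁ h₂
    · subst h₁
      by_cases hz : 0 < F e'
      · exact .inl hz
      · exact .inr ⟨rfl, by omega⟩
    · subst h₂; exact .inl (by omega)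
    · exact .inl h'
  refine ⟨h.height_le, h.ptr_le, ?_, ?_, ?_, ?_, ?_⟩
  · intro j hj
    have := h.mass j hj
    by_cases hje : e / 3 = j
    · obtain ⟨q, hq⟩ : ∃ q, e = 3 * j + q := ⟨e - 3 * j, by omega⟩
      obtain ⟨q₀, hq₀⟩ : ∃ q, e₀ = 3 * j + q := ⟨e₀ - 3 * j, by omega⟩
      have hq3 : q < 3 := by omega
      have hq₀3 : q₀ < 3 := by omega
      subst hq hq₀
      interval_cases q <;> interval_cases q₀ <;>
        simp at hne hδ ⊢ <;> omega
    · rw [Function.update_of_ne (by omega), Function.update_of_ne (by omega),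
        Function.update_of_ne (by omega), Function.update_of_ne (by omega),
        Function.update_of_ne (by omega), Function.update_of_ne (by omega), this]
  · intro u
    have h₁ := sum_ite_update (3 * T.t) (fun i => T.vert i = u) F (F e - δ) he
    have h₂ := sum_ite_update (3 * T.t) (fun i => T.vert i = u)
      (Function.update F e (F e - δ)) (F e₀ + δ) he₀
    rw [Function.update_of_ne hne.symm] at h₂
    have hu := h.load u
    have hle : F e ≤ LOAD (T.vert e) := by
      rw [h.load]
      refine le_trans ?_ (single_le_sum (f := fun i => if T.vert i = T.vert e then F i else 0)
        (fun _ _ => Nat.zero_le _) (mem_range.2 he))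
      simp
    rw [Function.update_apply, Function.update_apply]
    by_cases hu₁ : u = T.vert e₀
    · subst hu₁
      simp only [if_true, if_neg hvw] at h₁ h₂ ⊢
      omega
    · by_cases hu₂ : u = T.vert e
      · subst hu₂
        simp only [if_true, if_neg hvw.symm, if_neg hvw] at h₁ h₂ ⊢
        omega
      · simp only [if_neg hu₁, if_neg hu₂, if_neg (Ne.symm hu₁), if_neg (Ne.symm hu₂)] at h₁ h₂ ⊢
        omega
  · intro e₁ he₁ e₂ he₂ h₁₂ hF
    rcases hpos _ hF with h' | ⟨rfl, h'⟩
    · exact h.valid e₁ he₁ e₂ he₂ h₁₂ h'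
    -- The old mass at `e` already bounded the heights in this triangle by `H (T.vert e) + 1`, which
    -- is the height of `T.vert e₀`.
    · have := h.valid e₁ he₁ e he (by omega) h'
      omega
  · intro u j hj hF
    rcases hpos _ hF with h' | ⟨h₀, h'⟩
    · exact h.scanned u j hj h'
    · have hj' : j < 3 * T.cnt u := hj.trans_le (h.ptr_le u)
      -- A passed item stays inadmissible: `u` lies in the triangle of `e`, so its height is at most
      -- `H (T.vert e) + 1 = H (T.vert e₀)`.
      have := h.valid (T.own u j) (hT.own_lt hj') e he (by rw [← T.item_div, h₀, hee]) h'
      rw [hT.vert_own hj'] at this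
      rw [h₀]
      omega
  · intro u hu
    simp only [Function.update_apply]
    have := h.sat u hu
    split_ifs with h₁ h₂
    · exact hδc
    · subst h₂; omega
    · exact this

/-- Moving past an item that is not admissible. -/
theorem Inv.advance (h : T.Inv K N c H PTR F LOAD) {v : ℕ} (hv : PTR v < 3 * T.cnt v)
    (hF : 0 < F (T.item v (PTR v)) → H v ≤ H (T.vert (T.item v (PTR v)))) :
    T.Inv K N c H (Function.update PTR v (PTR v + 1)) F LOAD := by
  refine ⟨h.height_le, fun u => ?_, h.mass, h.load, h.valid, fun u j hj => ?_, h.sat⟩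
  · simp only [Function.update_apply]
    split_ifs with hu
    · subst hu; omega
    · exact h.ptr_le u
  · simp only [Function.update_apply] at hj
    split_ifs at hj with hu
    · subst hu
      rcases Nat.lt_succ_iff_lt_or_eq.1 hj with h' | rfl
      · exact h.scanned u j h'
      · exact hF
    · exact h.scanned u j hj

/-- Raising an active vertex whose scan list is exhausted. -/
theorem Inv.relabel (hT : T.WF) (h : T.Inv K N c H PTR F LOAD) {v : ℕ}
    (hv : PTR v = 3 * T.cnt v) (hc : LOAD v < c) (hN : H v < N) :
    T.Inv K N c (Function.update H v (H v + 1)) (Function.update PTR v 0) F LOAD := by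
  have hle : ∀ u, H u ≤ Function.update H v (H v + 1) u := by
    intro u
    simp only [Function.update_apply]
    split_ifs with hu
    · subst hu; omega
    · exact le_rfl
  refine ⟨fun u => ?_, fun u => ?_, h.mass, h.load, fun e he e' he' hee hF => ?_,
    fun u j hj hF => ?_, fun u hu => ?_⟩
  · simp only [Function.update_apply]
    split_ifs
    · omega
    · exact h.height_le u
  · simp only [Function.update_apply]
    split_ifs
    · omega
    · exact h.ptr_le u
  · have h₁ := h.valid e he e' he' hee hF
    have h₂ := hle (T.vert e')
    by_cases hev : T.vert e = v
    · rw [hev, Function.update_self]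
      obtain ⟨i, hi, hie⟩ := hT.inc_surj e he
      rw [hev] at hi hie
      -- The scan list of `v` offers `e'` to the slot `e` at position `3i + e' mod 3`. The list is
      -- exhausted, so this item has been rejected and `v` is not above `T.vert e'`.
      have hown : T.own v (3 * i + e' % 3) = e := by
        rw [own, ← hie]; congr 2; omega
      have hitem : T.item v (3 * i + e' % 3) = e' := by
        rw [item, hown]; omega
      have := h.scanned v (3 * i + e' % 3) (by omega) (by rwa [hitem])
      rw [hitem] at this
      omega
    · rw [Function.update_of_ne hev]; omega
  · simp only [Function.update_apply PTR] at hj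
    split_ifs at hj with hu
    · omega
    · rw [Function.update_of_ne hu]
      exact (h.scanned u j hj hF).trans (hle _)
  · simp only [Function.update_apply] at hu
    split_ifs at hu with h'
    · subst h'; exact hc.le
    · exact h.sat u hu

theorem Inv.mono (h : T.Inv K N c H PTR F LOAD) {c' : ℕ} (hc : c ≤ c') :
    T.Inv K N c' H PTR F LOAD :=
  ⟨h.height_le, h.ptr_le, h.mass, h.load, h.valid, h.scanned, fun v hv => (h.sat v hv).trans hc⟩

/-- By `valid`, the step down from a vertex to a carrier of mass in the same triangle is at most one
level, so it cannot jump across the empty level `g`. -/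
theorem Inv.mem_act_of_height (h : T.Inv K N c H PTR F LOAD) {e e' g : ℕ}
    (he : e < 3 * T.t) (he' : e' < 3 * T.t) (hee : e / 3 = e' / 3) (hF : 0 < F e')
    (hg : ∀ v ∈ T.act, H v ≠ g) (hge : g ≤ H (T.vert e)) : g ≤ H (T.vert e') := by
  have h₁ := h.valid e he e' he' hee hF
  have h₂ := hg _ (vert_mem_act he)
  have h₃ := hg _ (vert_mem_act he')
  omega

/-- Removing all vertices above an empty level. -/
theorem Inv.peel (hT : T.WF) (h : T.Inv K N c H PTR F LOAD) {H' : ℕ → ℕ} {g : ℕ}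
    (hg : ∀ v ∈ T.act, H v ≠ g) (hlt : ∀ v, H v < g → H' v = H v)
    (hge : ∀ v ∈ T.act, g ≤ H v → H' v = N) (hoff : ∀ v ∉ T.act, H' v = H v) :
    T.Inv K N c H' PTR F LOAD := by
  have hle : ∀ v, H v ≤ H' v ∧ H' v ≤ N := by
    intro v
    have := h.height_le v
    by_cases hv : v ∈ T.act
    · rcases lt_or_ge (H v) g with h' | h'
      · rw [hlt v h']; omega
      · rw [hge v hv h']; omega
    · rw [hoff v hv]; omega
  refine ⟨fun v => (hle v).2, h.ptr_le, h.mass, h.load, fun e he e' he' hee hF => ?_,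
    fun v j hj hF => ?_, fun v hv => ?_⟩
  · have h₁ := h.valid e he e' he' hee hF
    rcases lt_or_ge (H (T.vert e)) g with h' | h'
    · rw [hlt _ h']; have := hle (T.vert e'); omega
    · have := h.mem_act_of_height he he' hee hF hg h'
      rw [hge _ (vert_mem_act he) h', hge _ (vert_mem_act he') this]
      omega
  · have h₁ := h.scanned v j hj hF
    have hj' : j < 3 * T.cnt v := hj.trans_le (h.ptr_le v)
    by_cases hv : v ∈ T.act
    · rcases lt_or_ge (H v) g with h' | h'
      · rw [hlt v h']; exact h₁.trans (hle _).1
      · rw [hge v hv h', hge _ (vert_mem_act (hT.item_lt hj')) (h'.trans h₁)]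
    · rw [hoff v hv]; exact h₁.trans (hle _).1
  · rcases Nat.eq_zero_or_pos (H v) with h₀ | h₀
    · by_cases hva : v ∈ T.act
      · rcases lt_or_ge (H v) g with h' | h'
        · rw [hlt v h'] at hv; omega
        -- Here `H v = 0` and `g ≤ H v`, so `v` would lie on the empty level `g = 0`.
        · have := hg v hva
          omega
      · rw [hoff v hva] at hv; omega
    · exact h.sat v h₀

/-! ### Masses and loads -/

theorem Inv.sum_load (h : T.Inv K N c H PTR F LOAD) (X : Finset ℕ) :
    ∑ v ∈ X, LOAD v = ∑ e ∈ range (3 * T.t), if T.vert e ∈ X then F e else 0 := by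
  simp only [h.load]
  rw [sum_comm]
  refine sum_congr rfl fun e _ => ?_
  rw [sum_ite_eq]

theorem sum_range_three_mul (f : ℕ → ℕ) (n : ℕ) :
    ∑ e ∈ range (3 * n), f e = ∑ j ∈ range n, (f (3 * j) + f (3 * j + 1) + f (3 * j + 2)) := by
  induction n with
  | zero => simp
  | succ n ih =>
    rw [show 3 * (n + 1) = 3 * n + 1 + 1 + 1 by ring, sum_range_succ, sum_range_succ,
      sum_range_succ, sum_range_succ, ih]
    ring

/-- If all the mass of the triangles in `J` lies in `X`, it is at most the load of `X`. -/
theorem Inv.mass_le_load (h : T.Inv K N c H PTR F LOAD) {J X : Finset ℕ} (hJ : J ⊆ range T.t)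
    (hX : ∀ j ∈ J, ∀ e, e / 3 = j → 0 < F e → T.vert e ∈ X) :
    K * #J ≤ ∑ v ∈ X, LOAD v := by
  rw [h.sum_load, sum_range_three_mul, mul_comm, ← smul_eq_mul, ← sum_const]
  refine le_trans ?_ (sum_le_sum_of_subset hJ)
  refine sum_le_sum fun j hj => ?_
  rw [← h.mass j (mem_range.1 (hJ hj))]
  have key : ∀ e, e / 3 = j → F e ≤ if T.vert e ∈ X then F e else 0 := by
    intro e he
    split_ifs with hX'
    · exact le_rfl
    · by_contra h'
      exact hX' (hX j hj e he (by omega))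
  have h₀ := key (3 * j) (by omega)
  have h₁ := key (3 * j + 1) (by omega)
  have h₂ := key (3 * j + 2) (by omega)
  omega

/-- If all the mass in `X` comes from the triangles in `J`, it is at most their mass. -/
theorem Inv.load_le_mass (h : T.Inv K N c H PTR F LOAD) {J X : Finset ℕ} (hJ : J ⊆ range T.t)
    (hX : ∀ e < 3 * T.t, T.vert e ∈ X → 0 < F e → e / 3 ∈ J) :
    ∑ v ∈ X, LOAD v ≤ K * #J := by
  rw [h.sum_load, sum_range_three_mul, mul_comm, ← smul_eq_mul, ← sum_const, ← sum_subset hJ]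
  · refine sum_le_sum fun j hj => ?_
    rw [← h.mass j (mem_range.1 (hJ hj))]
    refine add_le_add (add_le_add ?_ ?_) ?_ <;> split_ifs <;> omega
  · intro j hj hj'
    have hj'' := mem_range.1 hj
    have key : ∀ e, e / 3 = j → (if T.vert e ∈ X then F e else 0) = 0 := by
      intro e he
      split_ifs with h'
      · by_contra h''
        exact hj' (he ▸ hX e (by omega) h' (by omega))
      · rfl
    simp only [key (3 * j) (by omega), key (3 * j + 1) (by omega), key (3 * j + 2) (by omega),
      add_zero]

theorem Inv.load_le (h : T.Inv K N c H PTR F LOAD) (v : ℕ) : LOAD v ≤ K * T.t := by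
  have := h.load_le_mass (J := range T.t) (X := {v}) subset_rfl
    fun e he _ _ => mem_range.2 (by omega)
  simpa using this

theorem Inv.flow_add_le (h : T.Inv K N c H PTR F LOAD) {e e' : ℕ} (he : e < 3 * T.t)
    (he' : e' < 3 * T.t) (hee : e / 3 = e' / 3) (hne : e ≠ e') : F e + F e' ≤ K := by
  have hm := h.mass (e / 3) (by omega)
  have h₁ : e = 3 * (e / 3) ∨ e = 3 * (e / 3) + 1 ∨ e = 3 * (e / 3) + 2 := by omega
  have h₂ : e' = 3 * (e / 3) ∨ e' = 3 * (e / 3) + 1 ∨ e' = 3 * (e / 3) + 2 := by omega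
  generalize e / 3 = j at *
  rcases h₁ with rfl | rfl | rfl <;> rcases h₂ with rfl | rfl | rfl <;> omega

/-! ### Triangle counts on the two sides of an empty level -/

theorem count_le (S : Finset ℕ) : T.count S ≤ T.t :=
  (card_filter_le _ _).trans (by simp)

theorem count_inter_act (S : Finset ℕ) : T.count (S ∩ T.act) = T.count S := by
  refine congrArg card (filter_congr fun j hj => ?_)
  have hj := mem_range.1 hj
  have h₀ : T.vert (3 * j) ∈ T.act := vert_mem_act (by omega)
  have h₁ : T.vert (3 * j + 1) ∈ T.act := vert_mem_act (by omega)
  have h₂ : T.vert (3 * j + 2) ∈ T.act := vert_mem_act (by omega)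
  simp [h₀, h₁, h₂]

/-- The triangles inside `S` that are not inside `S'`. -/
theorem card_sdiff_count {S S' : Finset ℕ} (hS : S' ⊆ S) :
    #{j ∈ range T.t | (T.vert (3 * j) ∈ S ∧ T.vert (3 * j + 1) ∈ S ∧ T.vert (3 * j + 2) ∈ S) ∧
      ¬(T.vert (3 * j) ∈ S' ∧ T.vert (3 * j + 1) ∈ S' ∧ T.vert (3 * j + 2) ∈ S')} + T.count S' =
    T.count S := by
  rw [count, count, ← card_union_of_disjoint]
  · congr 1
    ext j
    simp only [mem_union, mem_filter]
    have h₀ := @hS (T.vert (3 * j))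
    have h₁ := @hS (T.vert (3 * j + 1))
    have h₂ := @hS (T.vert (3 * j + 2))
    tauto
  · refine disjoint_left.2 fun j h₁ h₂ => ?_
    simp only [mem_filter] at h₁ h₂
    exact h₁.2.2 h₂.2

/-- Removing the part of `S` above an empty level costs few triangles. -/
theorem Inv.count_le_peel (h : T.Inv K N c H PTR F LOAD) {g : ℕ}
    (hg : ∀ v ∈ T.act, H v ≠ g) {S : Finset ℕ} (hS : S ⊆ T.act) :
    K * T.count S ≤ K * T.count {v ∈ S | H v < g} + c * (#S - #{v ∈ S | H v < g}) := by
  set S' := {v ∈ S | H v < g} with hS'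
  have hsub : S' ⊆ S := filter_subset _ _
  rw [← card_sdiff_count hsub, ← card_sdiff_of_subset hsub]
  set J := {j ∈ range T.t | (T.vert (3 * j) ∈ S ∧ T.vert (3 * j + 1) ∈ S ∧
    T.vert (3 * j + 2) ∈ S) ∧ ¬(T.vert (3 * j) ∈ S' ∧ T.vert (3 * j + 1) ∈ S' ∧
    T.vert (3 * j + 2) ∈ S')} with hJ
  -- A lost triangle has a vertex above the gap; hence all its mass lies above the gap, on vertices
  -- of `S \ S'`.
  have h₁ : K * #J ≤ ∑ v ∈ S \ S', LOAD v := by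
    refine h.mass_le_load (filter_subset _ _) fun j hj e he hF => ?_
    simp only [hJ, mem_filter, mem_range] at hj
    obtain ⟨hjt, ⟨s₀, s₁, s₂⟩, hn⟩ := hj
    have heS : ∀ e', e' / 3 = j → T.vert e' ∈ S := by
      intro e' he'
      have : e' = 3 * j ∨ e' = 3 * j + 1 ∨ e' = 3 * j + 2 := by omega
      rcases this with rfl | rfl | rfl <;> assumption
    obtain ⟨e', he', hge⟩ : ∃ e', e' / 3 = j ∧ g ≤ H (T.vert e') := by
      by_contra! hcon
      refine hn ⟨?_, ?_, ?_⟩ <;> refine mem_filter.2 ⟨heS _ (by omega), hcon _ (by omega)⟩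
    have := h.mem_act_of_height (by omega) (by omega) (by omega) hF hg hge
    simp only [hS', mem_sdiff, mem_filter, not_and, not_lt]
    exact ⟨heS _ he, fun _ => this⟩
  -- A removed vertex is strictly above level `g`, so its height is positive and `sat` limits its
  -- load.
  have h₂ : ∑ v ∈ S \ S', LOAD v ≤ c * #(S \ S') := by
    rw [mul_comm, ← smul_eq_mul, ← sum_const]
    refine sum_le_sum fun v hv => h.sat v ?_
    simp only [hS', mem_sdiff, mem_filter, not_and, not_lt] at hv
    have := hv.2 hv.1
    have := hg v (hS hv.1)
    omega
  rw [mul_add]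
  omega

/-- If all vertices below an empty level have load at least `c`, then smaller sets of these
vertices contain few triangles. -/
theorem Inv.count_le_of_full (h : T.Inv K N c H PTR F LOAD) {g : ℕ}
    (hg : ∀ v ∈ T.act, H v ≠ g) (hfull : ∀ v ∈ T.act, H v < g → c ≤ LOAD v)
    {S : Finset ℕ} (hS : S ⊆ {v ∈ T.act | H v < g}) :
    c * (#{v ∈ T.act | H v < g} - #S) + K * T.count S ≤ K * T.count {v ∈ T.act | H v < g} := by
  set V := {v ∈ T.act | H v < g} with hV
  rw [← card_sdiff_count hS, ← card_sdiff_of_subset hS, mul_add]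
  refine Nat.add_le_add_right ?_ _
  refine le_trans (b := ∑ v ∈ V \ S, LOAD v) ?_ (h.load_le_mass (filter_subset _ _) ?_)
  · rw [mul_comm, ← smul_eq_mul, ← sum_const]
    refine sum_le_sum fun v hv => ?_
    simp only [hV, mem_sdiff, mem_filter] at hv
    exact hfull v hv.1.1 hv.1.2
  · intro e he heX hF
    rw [mem_sdiff] at heX
    -- The slot `e` carries mass below the gap, so no vertex of its triangle is above it. The
    -- triangle lies inside `V`, but because of `e` not inside `S`.
    have hmem : ∀ e', e' / 3 = e / 3 → T.vert e' ∈ V := by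
      intro e' he'
      refine mem_filter.2 ⟨vert_mem_act (by omega), ?_⟩
      by_contra! hge
      have := h.mem_act_of_height (by omega) he he' hF hg hge
      have := (mem_filter.1 heX.1).2
      omega
    refine mem_filter.2 ⟨mem_range.2 (by omega), ⟨hmem _ (by omega), hmem _ (by omega),
      hmem _ (by omega)⟩, fun hcon => heX.2 ?_⟩
    have : e = 3 * (e / 3) ∨ e = 3 * (e / 3) + 1 ∨ e = 3 * (e / 3) + 2 := by omega
    rcases this with h' | h' | h' <;> rw [h']
    · exact hcon.1
    · exact hcon.2.1
    · exact hcon.2.2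

end TriSys

/-! ### The program -/

notation "rN" => (0 : ℕ)
notation "rM" => (1 : ℕ)
notation "rI" => (2 : ℕ)
notation "rJ" => (3 : ℕ)
notation "rU" => (4 : ℕ)
notation "rV" => (5 : ℕ)
notation "rW" => (6 : ℕ)
notation "rX" => (7 : ℕ)
notation "rT" => (8 : ℕ)
notation "rL" => (9 : ℕ)
notation "rAct" => (10 : ℕ)
notation "rMass" => (11 : ℕ)
notation "rCap" => (12 : ℕ)
notation "rBestT" => (13 : ℕ)
notation "rBestN" => (14 : ℕ)
notation "rPrev" => (15 : ℕ)
notation "rCur" => (16 : ℕ)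
notation "rCount" => (17 : ℕ)
notation "rMore" => (18 : ℕ)
notation "rGap" => (19 : ℕ)
notation "rOwn" => (20 : ℕ)
notation "rItem" => (21 : ℕ)
notation "rD" => (22 : ℕ)
notation "aSrc" => (0 : ℕ)
notation "aTgt" => (1 : ℕ)
notation "aDeg" => (2 : ℕ)
notation "aAdj" => (3 : ℕ)
notation "aOut" => (4 : ℕ)
notation "aOutDeg" => (5 : ℕ)
notation "aVert" => (6 : ℕ)
notation "aCnt" => (7 : ℕ)
notation "aInc" => (8 : ℕ)
notation "aAct" => (9 : ℕ)
notation "aFlow" => (10 : ℕ)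
notation "aLoad" => (11 : ℕ)
notation "aHeight" => (12 : ℕ)
notation "aPtr" => (13 : ℕ)

infixl:65 " +ₑ " => Expr.bin Op.add
infixl:65 " -ₑ " => Expr.bin Op.sub
infixl:70 " *ₑ " => Expr.bin Op.mul
infixl:70 " /ₑ " => Expr.bin Op.div
infix:50 " <ₑ " => Expr.bin Op.lt
infix:50 " =ₑ " => Expr.bin Op.eq
infixr:90 " @ₑ " => Expr.get
prefix:max "&ₑ" => Expr.var
prefix:max "#ₑ" => Expr.const
infix:45 " ≔ " => Prog.assign
infixr:40 " ;; " => Prog.seq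

/-- Pull as much mass as possible from `rW` to `rV` along the current item. -/
def pullMass : Prog :=
  rD ≔ &ₑrCap -ₑ aLoad @ₑ &ₑrV ;;
  Prog.ite (aFlow @ₑ &ₑrItem <ₑ &ₑrD) (rD ≔ aFlow @ₑ &ₑrItem) Prog.skip ;;
  Prog.store aFlow (&ₑrItem) (aFlow @ₑ &ₑrItem -ₑ &ₑrD) ;;
  Prog.store aFlow (&ₑrOwn) (aFlow @ₑ &ₑrOwn +ₑ &ₑrD) ;;
  Prog.store aLoad (&ₑrW) (aLoad @ₑ &ₑrW -ₑ &ₑrD) ;;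
  Prog.store aLoad (&ₑrV) (aLoad @ₑ &ₑrV +ₑ &ₑrD)

/-- Process the current item in the scan list of `rV`. -/
def scanItem : Prog :=
  rX ≔ aPtr @ₑ &ₑrV ;;
  rOwn ≔ aInc @ₑ (&ₑrV *ₑ &ₑrL +ₑ &ₑrX /ₑ #ₑ3) ;;
  rItem ≔ #ₑ3 *ₑ (&ₑrOwn /ₑ #ₑ3) +ₑ (&ₑrX -ₑ #ₑ3 *ₑ (&ₑrX /ₑ #ₑ3)) ;;
  rW ≔ aVert @ₑ &ₑrItem ;;
  Prog.ite (aHeight @ₑ &ₑrW +ₑ #ₑ1 =ₑ aHeight @ₑ &ₑrV) pullMass Prog.skip ;;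
  Prog.ite (aLoad @ₑ &ₑrV <ₑ &ₑrCap) (Prog.store aPtr (&ₑrV) (&ₑrX +ₑ #ₑ1)) Prog.skip

/-- Process the scan list of `rV` while `rV` is active. -/
def scan : Prog :=
  Prog.loop ((aLoad @ₑ &ₑrV <ₑ &ₑrCap) *ₑ (aPtr @ₑ &ₑrV <ₑ #ₑ3 *ₑ (aCnt @ₑ &ₑrV))) scanItem

/-- The memory contains the list of triangles. -/
structure Holds (T : TriSys) (s : State) : Prop where
  vert : s.arr aVert = T.vert
  inc : s.arr aInc = T.inc
  cnt : s.arr aCnt = T.cnt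
  len : s.var rL = 3 * T.t

/-- Bounds for the numbers that occur. -/
structure WordBounds (T : TriSys) (B K N : ℕ) : Prop where
  one_le : 1 ≤ B
  mass : K * T.t ≤ B
  slots : 9 * T.t ≤ B
  vert : ∀ e < 3 * T.t, T.vert e ≤ B
  height : N ≤ B

theorem TriSys.WF.cnt_le {T : TriSys} (hT : T.WF) {v : ℕ} (hv : v ∈ T.act) :
    T.cnt v ≤ 3 * T.t := by
  rw [← hT.sum_cnt]
  exact single_le_sum (f := T.cnt) (fun _ _ => Nat.zero_le _) hv

/-- The amount `δ` is the minimum of the missing load and the available mass. The disjunction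
ensures progress: either `v` reaches the capacity or the item becomes empty and may be passed. -/
theorem wp_pullMass {B v w e e₀ : ℕ} {s : State} (hv : s.var rV = v) (hw : s.var rW = w)
    (he : s.var rItem = e) (he₀ : s.var rOwn = e₀) (hne : e ≠ e₀) (hvw : w ≠ v)
    (hlt : s.arr aLoad v < s.var rCap) (hc : s.var rCap ≤ B)
    (hF : s.arr aFlow e + s.arr aFlow e₀ ≤ B) (hl : s.arr aLoad w ≤ B) :
    wp B pullMass (fun k s' => k ≤ 50 ∧ ∃ δ, δ ≤ s.arr aFlow e ∧
      s.arr aLoad v + δ ≤ s.var rCap ∧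
      (s.arr aLoad v + δ = s.var rCap ∨ δ = s.arr aFlow e) ∧
      s'.arr aFlow = Function.update (Function.update (s.arr aFlow) e (s.arr aFlow e - δ)) e₀
        (s.arr aFlow e₀ + δ) ∧
      s'.arr aLoad = Function.update (Function.update (s.arr aLoad) w (s.arr aLoad w - δ)) v
        (s.arr aLoad v + δ)) s := by
  by_cases h : s.arr aFlow e < s.var rCap - s.arr aLoad v
  · simp [pullMass, hv, hw, he, he₀, h, Function.update_of_ne hne.symm,
      Function.update_of_ne hvw.symm]
    exact ⟨by omega, by omega, by omega, by omega, by omega, _, le_rfl, by omega, .inr rfl,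
      by simp, rfl⟩
  · simp [pullMass, hv, hw, he, he₀, h, Function.update_of_ne hne.symm,
      Function.update_of_ne hvw.symm]
    exact ⟨by omega, by omega, by omega, by omega, by omega, _, not_lt.1 h, by omega,
      .inl (by omega), rfl, rfl⟩

/-- Mass is only taken from a vertex exactly one level below `rV`, so only such a vertex can become
deficient. The bound on the number of passes rests on this clause. -/
theorem wp_scanItem {T : TriSys} {B K N : ℕ} (hT : T.WF) (hB : WordBounds T B K N) {s : State}
    (hs : Holds T s) (hv : s.var rV ∈ T.act)
    (hI : T.Inv K N (s.var rCap) (s.arr aHeight) (s.arr aPtr) (s.arr aFlow) (s.arr aLoad))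
    (hl : s.arr aLoad (s.var rV) < s.var rCap)
    (hp : s.arr aPtr (s.var rV) < 3 * T.cnt (s.var rV)) (hc : s.var rCap ≤ B):
    wp B scanItem (fun k s' =>
      T.Inv K N (s.var rCap) (s.arr aHeight) (s'.arr aPtr) (s'.arr aFlow) (s'.arr aLoad) ∧
      s'.arr aLoad (s.var rV) ≤ s.var rCap ∧
      (∀ u ≠ s.var rV, s'.arr aPtr u = s.arr aPtr u) ∧
      (∀ u, s'.arr aLoad u < s.var rCap → s.arr aLoad u < s.var rCap ∨
        s.arr aHeight u + 1 = s.arr aHeight (s.var rV)) ∧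
      ((s'.arr aPtr (s.var rV) = s.arr aPtr (s.var rV) + 1) ∨
        s'.arr aPtr (s.var rV) = s.arr aPtr (s.var rV) ∧
          s'.arr aLoad (s.var rV) = s.var rCap) ∧ k ≤ 100) s := by
  obtain ⟨v, hvdef⟩ : ∃ v, s.var rV = v := ⟨_, rfl⟩
  obtain ⟨j, hj⟩ : ∃ j, s.arr aPtr v = j := ⟨_, rfl⟩
  rw [hvdef] at hv hl hp ⊢
  rw [hj] at hp ⊢
  have hown := hT.own_lt hp
  have hitem := hT.item_lt hp
  have hvo := hT.vert_own hp
  have hdiv := T.item_div v j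
  have hcnt := hT.cnt_le hv
  obtain ⟨e₀, he₀⟩ : ∃ e, T.own v j = e := ⟨_, rfl⟩
  obtain ⟨e, he⟩ : ∃ e, T.item v j = e := ⟨_, rfl⟩
  have he₀' : T.inc (v * (3 * T.t) + j / 3) = e₀ := he₀
  have he' : 3 * (e₀ / 3) + (j - 3 * (j / 3)) = e := by rw [← he, ← he₀]; rfl
  rw [he₀] at hown hvo
  rw [he] at hitem
  rw [he, he₀] at hdiv
  have hbs := hB.slots
  have hbv := hB.vert e hitem
  have hbo := hB.one_le
  have hKt : K * 1 ≤ K * T.t := Nat.mul_le_mul_left K (by omega)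
  have hbm := hB.mass
  simp [scanItem, hvdef, hj, he₀', he', hs.vert, hs.inc, hs.len]
  refine ⟨by omega, by omega, by omega, by omega, fun hadm => ?_, fun hadm => ?_⟩
  · have hvw : T.vert e ≠ v := by intro h'; rw [h'] at hadm; omega
    have hne : e ≠ e₀ := by rintro rfl; exact hvw hvo
    refine wp_mono (wp_frame (wp_pullMass (v := v) (w := T.vert e) (e := e) (e₀ := e₀)
      ?_ ?_ ?_ ?_ ?_ ?_ ?_ ?_ ?_ ?_)) ?_
    · simp [hvdef]
    · simp
    · simp
    · simp
    · exact hne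
    · exact hvw
    · simpa using hl
    · simpa using hc
    · have := hI.flow_add_le hitem hown hdiv hne
      simp only [State.setVar_arr]; omega
    · have := hI.load_le (T.vert e)
      simp only [State.setVar_arr]; omega
    rintro k s' ⟨⟨hk, δ, hδ, hδc, hor, hF, hL⟩, hfr⟩
    have h₅ : s'.var rV = v := (hfr.1 _ (by decide)).trans (by simp [hvdef])
    have h₇ : s'.var rX = j := (hfr.1 _ (by decide)).trans (by simp)
    have h₁₂ : s'.var rCap = s.var rCap := (hfr.1 _ (by decide)).trans (by simp)
    have h₁₃ : s'.arr aPtr = s.arr aPtr := (hfr.2 _ (by decide)).trans (by simp)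
    simp only [State.setVar_arr, State.setVar_var] at hδ hδc hor hF hL
    simp only [Nat.reduceEqDiff, if_false] at hδc hor
    have hI' := hI.pull hT hown hitem hdiv (by rw [hvo, hadm]) hδ (by rw [hvo]; exact hδc)
    rw [hvo] at hI'
    rw [← hF, ← hL] at hI'
    have hFe : s'.arr aFlow e = s.arr aFlow e - δ := by
      rw [hF, Function.update_of_ne hne, Function.update_self]
    have hLv : s'.arr aLoad v = s.arr aLoad v + δ := by rw [hL, Function.update_self]
    have hnew : ∀ u, s'.arr aLoad u < s.var rCap → s.arr aLoad u < s.var rCap ∨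
        s.arr aHeight u + 1 = s.arr aHeight v := by
      intro u hu
      by_cases h₁ : u = T.vert e
      · right; rw [h₁, hadm]
      · left
        by_cases h₂ : u = v
        · rw [h₂]; exact hl
        · rwa [hL, Function.update_of_ne h₂, Function.update_of_ne h₁] at hu
    simp only [h₅, h₇, h₁₂, h₁₃, ite_one_zero_eq_zero, not_lt]
    refine ⟨fun hlt => ⟨by omega, ?_, by omega, fun u hu => Function.update_of_ne hu _ _, hnew,
      .inl (Function.update_self _ _ _), by omega⟩, fun hge => ⟨hI', by omega,
      by simp, hnew, .inr ⟨hj, by omega⟩, by omega⟩⟩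
    -- The vertex is still deficient, so the pull was limited by the item, which is now empty and no
    -- longer admissible.
    have := hI'.advance (v := v) (by rw [hj]; exact hp) (by rw [hj, he]; omega)
    rwa [hj] at this
  · refine ⟨fun _ => ⟨by omega, ?_, hl.le, fun u hu => Function.update_of_ne hu _ _,
      fun _ => .inl⟩, by omega⟩
    have := hI.advance (v := v) (by rw [hj]; exact hp) (by
      rw [hj, he]
      intro hF
      have := hI.valid e₀ hown e hitem hdiv.symm hF
      rw [hvo] at this
      omega)
    rwa [hj] at this

/-- The scan of `rV` pays for its time by moving the scan pointer. -/
theorem wp_scan {T : TriSys} {B K N : ℕ} (hT : T.WF) (hB : WordBounds T B K N) {s₀ : State}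
    (hs : Holds T s₀) (hv : s₀.var rV ∈ T.act)
    (hI : T.Inv K N (s₀.var rCap) (s₀.arr aHeight) (s₀.arr aPtr) (s₀.arr aFlow) (s₀.arr aLoad))
    (hl : s₀.arr aLoad (s₀.var rV) < s₀.var rCap) (hc : s₀.var rCap ≤ B) :
    wp B scan (fun k s' =>
      T.Inv K N (s₀.var rCap) (s₀.arr aHeight) (s'.arr aPtr) (s'.arr aFlow) (s'.arr aLoad) ∧
      (∀ u ≠ s₀.var rV, s'.arr aPtr u = s₀.arr aPtr u) ∧
      (∀ u, s'.arr aLoad u < s₀.var rCap → s₀.arr aLoad u < s₀.var rCap ∨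
        s₀.arr aHeight u + 1 = s₀.arr aHeight (s₀.var rV)) ∧
      s₀.arr aPtr (s₀.var rV) ≤ s'.arr aPtr (s₀.var rV) ∧
      (s'.arr aLoad (s₀.var rV) < s₀.var rCap →
        s'.arr aPtr (s₀.var rV) = 3 * T.cnt (s₀.var rV)) ∧
      k + 150 * s₀.arr aPtr (s₀.var rV) ≤ 150 * s'.arr aPtr (s₀.var rV) + 300) s₀ := by
  have hscan : ∀ s, Frame scanItem s₀ s → s.var rV = s₀.var rV ∧ s.var rCap = s₀.var rCap ∧
      s.arr aHeight = s₀.arr aHeight ∧ Holds T s := by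
    intro s hfr
    exact ⟨hfr.1 _ (by decide), hfr.1 _ (by decide), hfr.2 _ (by decide),
      (hfr.2 _ (by decide)).trans hs.vert, (hfr.2 _ (by decide)).trans hs.inc,
      (hfr.2 _ (by decide)).trans hs.cnt, (hfr.1 _ (by decide)).trans hs.len⟩
  obtain ⟨v, hvdef⟩ : ∃ v, s₀.var rV = v := ⟨_, rfl⟩
  obtain ⟨c, hcdef⟩ : ∃ c, s₀.var rCap = c := ⟨_, rfl⟩
  obtain ⟨H, hH⟩ : ∃ H, s₀.arr aHeight = H := ⟨_, rfl⟩
  simp only [hvdef, hcdef, hH] at hv hI hl hc hscan ⊢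
  -- Each item either advances the pointer or saturates `v`. The latter ends the scan, so one extra
  -- portion of 150 pays for it.
  refine wp_mono (wp_frame (wp_loop (I := fun s φ =>
    T.Inv K N c H (s.arr aPtr) (s.arr aFlow) (s.arr aLoad) ∧
    s.arr aLoad v ≤ c ∧
    (∀ u ≠ v, s.arr aPtr u = s₀.arr aPtr u) ∧ s₀.arr aPtr v ≤ s.arr aPtr v ∧
    (∀ u, s.arr aLoad u < c → s₀.arr aLoad u < c ∨ H u + 1 = H v) ∧
    φ = 150 * (3 * T.cnt v - s.arr aPtr v) + if s.arr aLoad v < c then 150 else 0)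
    (φ₀ := 150 * (3 * T.cnt v - s₀.arr aPtr v) + 150)
    ⟨hI, hl.le, fun _ _ => rfl, le_rfl, fun _ => .inl, by rw [if_pos hl]⟩ ?_)) ?_
  · rintro s φ hfr ⟨h₁, h₂, h₃, hmono, h₄, rfl⟩ hcond
    obtain ⟨f₁, f₂, f₃, f₄⟩ := hscan s hfr
    have hcond' : s.arr aLoad v < c ∧ s.arr aPtr v < 3 * T.cnt v := by
      simpa [f₁, f₂, f₄.cnt, not_or, and_comm] using hcond
    rw [if_pos hcond'.1]
    have := wp_scanItem (K := K) (N := N) hT hB f₄ (by rwa [f₁]) (by rwa [f₂, f₃])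
      (by rw [f₁, f₂]; exact hcond'.1) (by rw [f₁]; exact hcond'.2) (by rwa [f₂])
    refine wp_mono this ?_
    simp only [f₁, f₂, f₃]
    rintro k s' ⟨g₁, g₂, g₃, g₄, g₅, hk⟩
    refine ⟨_, ⟨g₁, g₂, fun u hu => (g₃ u hu).trans (h₃ u hu), by omega, fun u hu => ?_, rfl⟩, ?_⟩
    · rcases g₄ u hu with h | h
      · exact h₄ u h
      · exact .inr h
    · simp only [Expr.cost]
      rcases g₅ with h | ⟨h, h'⟩
      · rw [h]; split_ifs <;> omega
      · rw [h, h', if_neg (lt_irrefl _)]; omega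
  · rintro k s' ⟨⟨φ', ⟨h₁, h₂, h₃, hmono, h₄, rfl⟩, hcond, hk⟩, hfr⟩
    obtain ⟨f₁, f₂, f₃, f₄⟩ := hscan s' hfr
    have hp := h₁.ptr_le v
    have hp₀ := hI.ptr_le v
    refine ⟨h₁, h₃, h₄, hmono, fun hlt => ?_, ?_⟩
    · by_contra hne
      simp [f₁, f₂, f₄.cnt, hlt] at hcond
      omega
    · simp only [Expr.cost] at hk
      omega

/-- Discharge the vertex in cell `rI` of the list of vertices. -/
def visit : Prog :=
  rV ≔ aAct @ₑ &ₑrI ;;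
  Prog.ite ((aHeight @ₑ &ₑrV <ₑ &ₑrAct) *ₑ (aLoad @ₑ &ₑrV <ₑ &ₑrCap))
    (rMore ≔ #ₑ1 ;; scan ;;
      Prog.ite (aLoad @ₑ &ₑrV <ₑ &ₑrCap)
        (Prog.store aPtr (&ₑrV) (#ₑ0) ;;
          Prog.store aHeight (&ₑrV) (aHeight @ₑ &ₑrV +ₑ #ₑ1)) Prog.skip)
    Prog.skip

/-- Discharge all vertices once. -/
def pass : Prog := rMore ≔ #ₑ0 ;; forLoop rI rAct visit

/-- Discharge until no vertex is active. -/
def passes : Prog := rMore ≔ #ₑ1 ;; Prog.loop (&ₑrMore) pass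

/-! ### Potentials for scanning, relabelings and passes -/

namespace TriSys

/-- The number of remaining moves of the scan pointers. -/
def work (T : TriSys) (N : ℕ) (H PTR : ℕ → ℕ) : ℕ :=
  ∑ v ∈ T.act, ((N - H v) * (3 * T.cnt v + 1) - PTR v)

/-- The number of remaining relabelings. -/
def slack (T : TriSys) (N : ℕ) (H : ℕ → ℕ) : ℕ := ∑ v ∈ T.act, (N - H v)

/-- The bound that shows that the number of passes is small. -/
def Pending (T : TriSys) (N c : ℕ) (H LOAD : ℕ → ℕ) (X : ℕ) (D : Finset ℕ) : Prop :=
  ∀ u ∈ T.act, H u < N → LOAD u < c → H u + 1 + 2 * T.slack N H + (if u ∈ D then 1 else 0) ≤ X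

theorem slack_anti {T : TriSys} {N : ℕ} {H H' : ℕ → ℕ} (h : ∀ u, H u ≤ H' u) :
    T.slack N H' ≤ T.slack N H :=
  sum_le_sum fun u _ => Nat.sub_le_sub_left (h u) N

theorem work_advance {T : TriSys} {N : ℕ} {H PTR PTR' : ℕ → ℕ} {v : ℕ} (hv : v ∈ T.act)
    (hN : H v < N) (hle : PTR v ≤ PTR' v) (hcnt : PTR' v ≤ 3 * T.cnt v)
    (hoff : ∀ u ≠ v, PTR' u = PTR u) :
    T.work N H PTR' + (PTR' v - PTR v) = T.work N H PTR := by
  refine sum_add_of_eq_off hv (fun u _ hu => by rw [hoff u hu]) ?_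
  obtain ⟨m, hm⟩ : ∃ m, N - H v = m + 1 := ⟨N - H v - 1, by omega⟩
  rw [hm, Nat.add_mul]
  omega

/-- One unit of height is worth `3 * cnt v + 1`: it pays for resetting the pointer from `3 * cnt v`
to 0 and leaves one unit. -/
theorem work_relabel {T : TriSys} {N : ℕ} {H PTR : ℕ → ℕ} {v : ℕ} (hv : v ∈ T.act)
    (hN : H v < N) (hcnt : PTR v = 3 * T.cnt v) :
    T.work N (Function.update H v (H v + 1)) (Function.update PTR v 0) + 1 = T.work N H PTR := by
  refine sum_add_of_eq_off hv (fun u _ hu => by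
    rw [Function.update_of_ne hu, Function.update_of_ne hu]) ?_
  obtain ⟨m, hm⟩ : ∃ m, N - H v = m + 1 := ⟨N - H v - 1, by omega⟩
  rw [Function.update_self, Function.update_self, hm, show N - (H v + 1) = m by omega,
    Nat.add_mul]
  omega

theorem slack_relabel {T : TriSys} {N : ℕ} {H : ℕ → ℕ} {v : ℕ} (hv : v ∈ T.act)
    (hN : H v < N) : T.slack N (Function.update H v (H v + 1)) + 1 = T.slack N H := by
  refine sum_add_of_eq_off hv (fun u _ hu => by rw [Function.update_of_ne hu]) ?_
  rw [Function.update_self]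
  omega

end TriSys

/-- Relabeling `v` raises its height by one and lowers twice the slack by two; a vertex that loses
mass to `v` lies one level below `v`. Both times the bound `X` holds with one unit to spare, which
is the bonus for visited vertices in `Pending`. If `v` gets saturated, it needs no bound. -/
theorem wp_visit {T : TriSys} {B K N v X : ℕ} {D : Finset ℕ} (hT : T.WF)
    (hB : WordBounds T B K N) {s : State} (hs : Holds T s) (hN : s.var rAct = N)
    (hv : s.arr aAct (s.var rI) = v) (hva : v ∈ T.act)
    (hI : T.Inv K N (s.var rCap) (s.arr aHeight) (s.arr aPtr) (s.arr aFlow) (s.arr aLoad))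
    (hc : s.var rCap ≤ B) (hX : T.Pending N (s.var rCap) (s.arr aHeight) (s.arr aLoad) X D) :
    wp B visit (fun k s' =>
      T.Inv K N (s.var rCap) (s'.arr aHeight) (s'.arr aPtr) (s'.arr aFlow) (s'.arr aLoad) ∧
      T.Pending N (s.var rCap) (s'.arr aHeight) (s'.arr aLoad) X (insert v D) ∧
      (∀ u, s.arr aHeight u ≤ s'.arr aHeight u) ∧
      (s'.var rMore = 0 → s.var rMore = 0 ∧ s'.arr aHeight = s.arr aHeight ∧
        s'.arr aLoad = s.arr aLoad ∧ ¬(s.arr aHeight v < N ∧ s.arr aLoad v < s.var rCap)) ∧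
      (s'.var rMore ≠ 0 → s.var rMore ≠ 0 ∨ 2 * T.slack N (s'.arr aHeight) + 1 ≤ X) ∧
      k + 150 * T.work N (s'.arr aHeight) (s'.arr aPtr) ≤
        150 * T.work N (s.arr aHeight) (s.arr aPtr) + 400) s := by
  have hbo := hB.one_le
  have hbh := hB.height
  have hvB : v ≤ B := by
    obtain ⟨e, he, rfl⟩ := mem_image.1 hva
    exact hB.vert e (mem_range.1 he)
  obtain ⟨c, hcdef⟩ : ∃ c, s.var rCap = c := ⟨_, rfl⟩
  simp only [hcdef] at hI hc hX ⊢
  simp [visit, hv, hN, hcdef, -and_imp]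
  refine ⟨hvB, fun hl hh => ⟨hbo, ?_⟩, fun hact => ?_⟩
  · have hXv := hX v hva hh hl
    refine wp_mono (wp_frame (wp_scan (K := K) (N := N) hT hB ⟨?_, ?_, ?_, ?_⟩ ?_ ?_ ?_ ?_)) ?_
    · exact hs.vert
    · exact hs.inc
    · exact hs.cnt
    · simpa using hs.len
    · simpa using hva
    · simpa [hcdef] using hI
    · simpa [hcdef] using hl
    · simpa [hcdef] using hc
    simp only [State.setVar_arr, State.setVar_var, Nat.reduceEqDiff,
      if_true, if_false, hcdef]
    rintro k s₁ ⟨⟨hI₁, hp, hnew, hle, hend, hk⟩, hfr⟩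
    have h₅ : s₁.var rV = v := (hfr.1 _ (by decide)).trans (by simp)
    have h₁₂ : s₁.var rCap = c := (hfr.1 _ (by decide)).trans (by simp [hcdef])
    have h₁₈ : s₁.var rMore = 1 := (hfr.1 _ (by decide)).trans (by simp)
    have hH : s₁.arr aHeight = s.arr aHeight := (hfr.2 _ (by decide)).trans (by simp)
    have hwork := TriSys.work_advance (N := N) hva hh hle (hI₁.ptr_le v) hp
    have hpend : ∀ u ∈ T.act, s.arr aHeight u < N → s₁.arr aLoad u < c →
        s.arr aHeight u + 1 + 2 * T.slack N (s.arr aHeight) +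
          (if u ∈ insert v D ∧ u ≠ v then 1 else 0) ≤ X := by
      intro u hu h₁ h₂
      rcases hnew u h₂ with h | h
      · refine le_trans (Nat.add_le_add_left ?_ _) (hX u hu h₁ h)
        split_ifs with g₁ g₂ <;> simp_all
      · split_ifs at * <;> omega
    simp only [h₅, h₁₂, h₁₈, hH, ite_one_zero_eq_zero, not_lt]
    refine ⟨fun hlt => ⟨by omega, hI₁.relabel hT (hend (not_le.1 hlt)) (not_le.1 hlt) hh, ?_,
      fun u => ?_, by simp, ?_, ?_⟩,
      fun hge => ⟨hI₁, ?_, fun _ => le_rfl, by simp, ?_, ?_⟩⟩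
    · have hsl := TriSys.slack_relabel hva hh
      intro u hu h₁ h₂
      by_cases huv : u = v
      · subst huv
        simp only [Function.update_self, mem_insert_self, if_true]
        omega
      · rw [Function.update_of_ne huv] at h₁ ⊢
        have := hpend u hu h₁ h₂
        simp only [huv, mem_insert, false_or, ne_eq, not_false_eq_true, and_true] at this ⊢
        omega
    · simp only [Function.update_apply]
      split_ifs with h
      · rw [h]; omega
      · exact le_rfl
    · have hsl := TriSys.slack_relabel hva hh
      intro _
      right
      omega
    · have := TriSys.work_relabel (N := N) hva hh (hend (not_le.1 hlt))
      omega
    · intro u hu h₁ h₂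
      have huv : u ≠ v := by rintro rfl; omega
      have := hpend u hu h₁ h₂
      simpa [huv] using this
    · intro _
      right
      split_ifs at hXv <;> omega
    · omega
  · refine ⟨hI, fun u hu h₁ h₂ => ?_, fun h => ⟨h, fun h' => ?_⟩, fun h => .inl h, by omega⟩
    · have := hX u hu h₁ h₂
      have huv : u ≠ v := by rintro rfl; exact absurd h₁ (not_lt.2 (hact h₂))
      simpa [huv] using this
    · by_contra h''
      exact absurd h' (not_lt.2 (hact (not_le.1 h'')))
/-- The memory also contains a list of the vertices that lie in triangles. -/
structure Ready (T : TriSys) (N : ℕ) (s : State) : Prop extends Holds T s where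
  len_act : s.var rAct = N
  card_act : #T.act = N
  image_act : (range N).image (s.arr aAct) = T.act

theorem Ready.of_frame {T : TriSys} {N : ℕ} {s s' : State} (h : Ready T N s) {p : Prog}
    (hp : Frame p s s') (h₁ : aVert ∉ p.arrsWritten ∧ aInc ∉ p.arrsWritten ∧
      aCnt ∉ p.arrsWritten ∧ aAct ∉ p.arrsWritten ∧ rL ∉ p.varsWritten ∧
      rAct ∉ p.varsWritten) : Ready T N s' := by
  obtain ⟨h₁, h₂, h₃, h₄, h₅, h₆⟩ := h₁
  refine ⟨⟨?_, ?_, ?_, ?_⟩, ?_, h.card_act, ?_⟩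
  · rw [hp.2 _ h₁, h.vert]
  · rw [hp.2 _ h₂, h.inc]
  · rw [hp.2 _ h₃, h.cnt]
  · rw [hp.1 _ h₅, h.len]
  · rw [hp.1 _ h₆, h.len_act]
  · rw [hp.2 _ h₄, h.image_act]

theorem Ready.mem_act {T : TriSys} {N : ℕ} {s : State} (h : Ready T N s) {i : ℕ} (hi : i < N) :
    s.arr aAct i ∈ T.act := by
  rw [← h.image_act]
  exact mem_image_of_mem _ (mem_range.2 hi)

/-- After the pass every vertex has been visited and enjoys the bonus in `Pending`, so the bound
drops to `X - 1`. If nothing was active, neither heights nor loads have changed and the bound stays.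
-/
theorem wp_pass {T : TriSys} {B K N X : ℕ} (hT : T.WF) (hB : WordBounds T B K N) {s₀ : State}
    (hs : Ready T N s₀)
    (hI : T.Inv K N (s₀.var rCap) (s₀.arr aHeight) (s₀.arr aPtr) (s₀.arr aFlow) (s₀.arr aLoad))
    (hc : s₀.var rCap ≤ B)
    (hX : T.Pending N (s₀.var rCap) (s₀.arr aHeight) (s₀.arr aLoad) X ∅) :
    wp B pass (fun k s' =>
      T.Inv K N (s₀.var rCap) (s'.arr aHeight) (s'.arr aPtr) (s'.arr aFlow) (s'.arr aLoad) ∧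
      (∀ u, s₀.arr aHeight u ≤ s'.arr aHeight u) ∧
      (s'.var rMore = 0 → T.Pending N (s₀.var rCap) (s'.arr aHeight) (s'.arr aLoad) X ∅ ∧
        ∀ u ∈ T.act, s'.arr aHeight u < N → s₀.var rCap ≤ s'.arr aLoad u) ∧
      (s'.var rMore ≠ 0 → 2 * T.slack N (s'.arr aHeight) + 1 ≤ X ∧
        T.Pending N (s₀.var rCap) (s'.arr aHeight) (s'.arr aLoad) (X - 1) ∅) ∧
      k + 150 * T.work N (s'.arr aHeight) (s'.arr aPtr) ≤
        150 * T.work N (s₀.arr aHeight) (s₀.arr aPtr) + 408 * N + 8) s₀ := by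
  obtain ⟨c, hcdef⟩ : ∃ c, s₀.var rCap = c := ⟨_, rfl⟩
  rw [hcdef] at hI hc hX ⊢
  obtain ⟨act, hact⟩ : ∃ a, s₀.arr aAct = a := ⟨_, rfl⟩
  have him : (range N).image act = T.act := hact ▸ hs.image_act
  refine ⟨Nat.zero_le _, ?_⟩
  refine wp_mono (wp_forLoop_credit
    (J := fun j s φ =>
      T.Inv K N c (s.arr aHeight) (s.arr aPtr) (s.arr aFlow) (s.arr aLoad) ∧
      T.Pending N c (s.arr aHeight) (s.arr aLoad) X ((range j).image act) ∧
      (∀ u, s₀.arr aHeight u ≤ s.arr aHeight u) ∧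
      (s.var rMore = 0 → s.arr aHeight = s₀.arr aHeight ∧ s.arr aLoad = s₀.arr aLoad ∧
        ∀ u ∈ (range j).image act, s.arr aHeight u < N → c ≤ s.arr aLoad u) ∧
      (s.var rMore ≠ 0 → 2 * T.slack N (s.arr aHeight) + 1 ≤ X) ∧
      φ = 150 * T.work N (s.arr aHeight) (s.arr aPtr) + 400 * (N - j))
    (φ₀ := 150 * T.work N (s₀.arr aHeight) (s₀.arr aPtr) + 400 * N)
    (by decide) (by decide) (by decide) ?_ ?_ ?_) ?_
  · simpa [hs.len_act] using hB.height
  · simpa [hI] using hX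
  · rintro j s φ hj hfr hsj ⟨h₁, h₂, h₃, h₄, h₅, rfl⟩
    simp only [State.setVar_var, hs.len_act] at hj
    simp only [Nat.reduceEqDiff, if_false] at hj
    have hfr₀ : Frame pass s₀ s := (Frame.of_setVar (by decide)).trans
      (hfr.mono (by decide) (by decide))
    have hr : Ready T N s := hs.of_frame hfr₀ (by decide)
    have hcs : s.var rCap = c := (hfr₀.1 _ (by decide)).trans hcdef
    have has : s.arr aAct = act := (hfr₀.2 _ (by decide)).trans hact
    refine wp_mono (wp_visit (K := K) (N := N) (v := act j) hT hB hr.toHolds hr.len_act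
      (by rw [hsj, has]) (by rw [← has]; exact hr.mem_act hj) (by rwa [hcs]) (by rwa [hcs])
      (by rw [hcs]; exact h₂)) ?_
    rw [hcs]
    rintro k s' ⟨g₁, g₂, g₃, g₄, g₅, hk⟩
    refine ⟨_, ⟨g₁, ?_, fun u => (h₃ u).trans (g₃ u), fun h => ?_, fun h => ?_, rfl⟩, ?_⟩
    · rw [range_add_one, image_insert]; exact g₂
    · obtain ⟨i₁, i₂, i₃, i₄⟩ := g₄ (by simpa using h)
      obtain ⟨i₅, i₆, i₇⟩ := h₄ i₁
      refine ⟨by simpa [i₂] using i₅, by simpa [i₃] using i₆, ?_⟩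
      rw [range_add_one, image_insert]
      simp only [State.setVar_arr, i₂, i₃, mem_insert, forall_eq_or_imp]
      exact ⟨fun h' => not_lt.1 fun h'' => i₄ ⟨h', h''⟩, i₇⟩
    · have hsl := TriSys.slack_anti (T := T) (N := N) g₃
      rcases g₅ (by simpa using h) with h' | h'
      · have := h₅ h'
        simp only [State.setVar_arr]
        omega
      · exact h'
    · simp only [State.setVar_arr]
      omega
  · rintro k s' ⟨φ', ⟨h₁, h₂, h₃, h₄, h₅, rfl⟩, hk⟩
    simp only [State.setVar_var, hs.len_act] at h₂ h₄ hk
    simp only [Nat.reduceEqDiff, if_false, him] at h₂ h₄ hk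
    refine ⟨h₁, h₃, fun h => ?_, fun h => ⟨h₅ h, fun u hu i₁ i₂ => ?_⟩, ?_⟩
    · obtain ⟨i₁, i₂, i₃⟩ := h₄ h
      exact ⟨by rw [i₁, i₂]; exact hX, i₃⟩
    · have := h₂ u hu i₁ i₂
      simp only [hu, if_true, notMem_empty, if_false] at this ⊢
      omega
    · simp only [Expr.cost]
      omega

/-- The bound can start at `N + 2 * slack` since living vertices have `H u + 1 ≤ N`, and it never
falls below twice the current slack. So the number of passes is at most `N`, plus twice the decrease
of the slack, plus a constant; the remaining slack is saved for later rounds. -/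
theorem wp_passes {T : TriSys} {B K N : ℕ} (hT : T.WF) (hB : WordBounds T B K N) {s₀ : State}
    (hs : Ready T N s₀)
    (hI : T.Inv K N (s₀.var rCap) (s₀.arr aHeight) (s₀.arr aPtr) (s₀.arr aFlow) (s₀.arr aLoad))
    (hc : s₀.var rCap ≤ B) :
    wp B passes (fun k s' =>
      T.Inv K N (s₀.var rCap) (s'.arr aHeight) (s'.arr aPtr) (s'.arr aFlow) (s'.arr aLoad) ∧
      (∀ u, s₀.arr aHeight u ≤ s'.arr aHeight u) ∧
      (∀ u ∈ T.act, s'.arr aHeight u < N → s₀.var rCap ≤ s'.arr aLoad u) ∧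
      k + (150 * T.work N (s'.arr aHeight) (s'.arr aPtr) +
          500 * (N + 1) * (2 * T.slack N (s'.arr aHeight))) ≤
        150 * T.work N (s₀.arr aHeight) (s₀.arr aPtr) +
          500 * (N + 1) * (2 * T.slack N (s₀.arr aHeight)) + 500 * (N + 1) * (N + 2)) s₀ := by
  have hbo := hB.one_le
  obtain ⟨c, hcdef⟩ : ∃ c, s₀.var rCap = c := ⟨_, rfl⟩
  rw [hcdef] at hI hc ⊢
  set X₀ := N + 2 * T.slack N (s₀.arr aHeight) with hX₀
  refine ⟨hbo, ?_⟩
  refine wp_mono (wp_loop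
    -- The last summand pays for the final pass, which finds nothing active and does not lower `X`.
    (I := fun s φ => ∃ X,
      T.Inv K N c (s.arr aHeight) (s.arr aPtr) (s.arr aFlow) (s.arr aLoad) ∧
      T.Pending N c (s.arr aHeight) (s.arr aLoad) X ∅ ∧ 2 * T.slack N (s.arr aHeight) ≤ X ∧
      (∀ u, s₀.arr aHeight u ≤ s.arr aHeight u) ∧
      (s.var rMore = 0 → ∀ u ∈ T.act, s.arr aHeight u < N → c ≤ s.arr aLoad u) ∧
      φ = 150 * T.work N (s.arr aHeight) (s.arr aPtr) + 500 * (N + 1) * X +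
        if s.var rMore = 0 then 0 else 500 * (N + 1))
    (φ₀ := 150 * T.work N (s₀.arr aHeight) (s₀.arr aPtr) + 500 * (N + 1) * X₀ + 500 * (N + 1))
    ⟨X₀, hI, ?_, by simp only [State.setVar_arr]; omega, fun _ => le_rfl, by simp, by simp⟩ ?_) ?_
  · intro u hu h₁ h₂
    simp only [notMem_empty, if_false, State.setVar_arr] at h₁ ⊢
    omega
  · rintro s φ hfr ⟨X, h₁, h₂, h₃, h₄, h₅, rfl⟩ hmore
    simp only [Expr.eval] at hmore
    have hfr₀ : Frame passes s₀ s := (Frame.of_setVar (by decide)).trans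
      (hfr.mono (by decide) (by decide))
    have hr : Ready T N s := hs.of_frame hfr₀ (by decide)
    have hcs : s.var rCap = c := (hfr₀.1 _ (by decide)).trans hcdef
    refine wp_mono (wp_pass (K := K) (N := N) (X := X) hT hB hr (by rwa [hcs]) (by rwa [hcs])
      (by rw [hcs]; exact h₂)) ?_
    rw [hcs, if_neg hmore]
    rintro k s' ⟨g₁, g₂, g₃, g₄, hk⟩
    have hsl := TriSys.slack_anti (T := T) (N := N) g₂
    by_cases hm : s'.var rMore = 0
    · refine ⟨_, ⟨X, g₁, (g₃ hm).1, by omega, fun u => (h₄ u).trans (g₂ u),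
        fun _ => (g₃ hm).2, rfl⟩, ?_⟩
      rw [if_pos hm]
      simp only [Expr.cost]
      omega
    · obtain ⟨i₁, i₂⟩ := g₄ hm
      refine ⟨_, ⟨X - 1, g₁, i₂, by omega, fun u => (h₄ u).trans (g₂ u),
        fun h => absurd h hm, rfl⟩, ?_⟩
      obtain ⟨Y, rfl⟩ : ∃ Y, X = Y + 1 := ⟨X - 1, by omega⟩
      rw [if_neg hm, Nat.add_sub_cancel, mul_add_one (500 * (N + 1)) Y]
      simp only [Expr.cost]
      omega
  · rintro k s' ⟨φ', ⟨X, h₁, h₂, h₃, h₄, h₅, rfl⟩, hcond, hk⟩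
    simp only [Expr.eval] at hcond
    refine ⟨h₁, h₄, h₅ hcond, ?_⟩
    have := Nat.mul_le_mul_left (500 * (N + 1)) h₃
    have e : 500 * (N + 1) * X₀ + 500 * (N + 1) * 2 =
      500 * (N + 1) * (2 * T.slack N (s₀.arr aHeight)) + 500 * (N + 1) * (N + 2) := by
      rw [hX₀]; ring
    simp only [Expr.cost, hcond, if_true] at hk ⊢
    omega

/-! ### One round: recording the best set, emptying, and peeling -/

/-- Count the triangles whose vertices are alive. -/
def recount : Prog :=
  rCount ≔ #ₑ0 ;;
  forLoop rI rT
    (rU ≔ #ₑ3 *ₑ &ₑrI ;;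
      Prog.ite ((aHeight @ₑ aVert @ₑ &ₑrU <ₑ &ₑrAct) *ₑ
          ((aHeight @ₑ aVert @ₑ (&ₑrU +ₑ #ₑ1) <ₑ &ₑrAct) *ₑ
            (aHeight @ₑ aVert @ₑ (&ₑrU +ₑ #ₑ2) <ₑ &ₑrAct)))
        (rCount ≔ &ₑrCount +ₑ #ₑ1) Prog.skip)

/-- Write the list of the vertices that are alive. -/
def copyAlive : Prog :=
  rJ ≔ #ₑ0 ;;
  forLoop rI rAct
    (rV ≔ aAct @ₑ &ₑrI ;;
      Prog.ite (aHeight @ₑ &ₑrV <ₑ &ₑrAct)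
        (Prog.store aSrc (&ₑrJ) (&ₑrV) ;; rJ ≔ &ₑrJ +ₑ #ₑ1) Prog.skip)

/-- Record the set of the vertices that are alive if it is denser than the best known set. -/
def record : Prog :=
  Prog.ite (&ₑrBestT *ₑ &ₑrCur <ₑ &ₑrCount *ₑ &ₑrBestN)
    (rBestT ≔ &ₑrCount ;; rBestN ≔ &ₑrCur ;; rCap ≔ &ₑrMass *ₑ &ₑrBestT /ₑ &ₑrBestN ;;
      copyAlive)
    Prog.skip

/-- Set `rMore` if some vertex has height `rGap`. -/
def testLevel : Prog :=
  rMore ≔ #ₑ0 ;;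
  forLoop rI rAct
    (Prog.ite (aHeight @ₑ aAct @ₑ &ₑrI =ₑ &ₑrGap) (rMore ≔ #ₑ1) Prog.skip)

/-- Find the smallest empty level. -/
def findGap : Prog :=
  rGap ≔ #ₑ0 ;; rMore ≔ #ₑ1 ;;
  Prog.loop (&ₑrMore) (testLevel ;; rGap ≔ &ₑrGap +ₑ &ₑrMore)

/-- Remove the vertices above the level `rGap` and count the others. -/
def peelAbove : Prog :=
  rCur ≔ #ₑ0 ;;
  forLoop rI rAct
    (rV ≔ aAct @ₑ &ₑrI ;;
      Prog.ite (aHeight @ₑ &ₑrV <ₑ &ₑrGap) (rCur ≔ &ₑrCur +ₑ #ₑ1)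
        (Prog.store aHeight (&ₑrV) (&ₑrAct)))

/-- The vertices below height `N`. -/
def TriSys.alive (T : TriSys) (N : ℕ) (H : ℕ → ℕ) : Finset ℕ := {v ∈ T.act | H v < N}

theorem card_filter_range_succ (p : ℕ → Prop) [DecidablePred p] (j : ℕ) :
    #{i ∈ range (j + 1) | p i} = #{i ∈ range j | p i} + if p j then 1 else 0 := by
  rw [range_add_one, filter_insert]
  split_ifs <;> simp

theorem wp_recount {T : TriSys} {B N : ℕ} (hB : T.t ≤ B) (hB' : 9 * T.t ≤ B) {s₀ : State}
    (hs : Ready T N s₀) (ht : s₀.var rT = T.t) :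
    wp B recount (fun k s' =>
      s'.var rCount = T.count (T.alive N (s₀.arr aHeight)) ∧ k ≤ 60 * T.t + 8) s₀ := by
  refine ⟨Nat.zero_le _, ?_⟩
  refine wp_mono (wp_forLoop
    (J := fun j s => s.var rCount =
      #{i ∈ range j | s₀.arr aHeight (T.vert (3 * i)) < N ∧
        s₀.arr aHeight (T.vert (3 * i + 1)) < N ∧ s₀.arr aHeight (T.vert (3 * i + 2)) < N})
    (C := 50) (by decide) (by decide) (by decide) ?_ ?_ ?_) ?_
  · simp [ht, hB]
  · simp
  · intro j s hj hfr hsj hJ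
    have hfr₀ : Frame recount s₀ s := (Frame.of_setVar (by decide)).trans
      (hfr.mono (by decide) (by decide))
    have hr : Ready T N s := hs.of_frame hfr₀ (by decide)
    have hH : s.arr aHeight = s₀.arr aHeight := hfr₀.2 _ (by decide)
    simp only [State.setVar_var, ht] at hj
    simp only [Nat.reduceEqDiff, if_false] at hj
    have hle := card_filter_range_succ (fun i => s₀.arr aHeight (T.vert (3 * i)) < N ∧
        s₀.arr aHeight (T.vert (3 * i + 1)) < N ∧ s₀.arr aHeight (T.vert (3 * i + 2)) < N) j
    have hcard := (card_filter_le (range j) (fun i => s₀.arr aHeight (T.vert (3 * i)) < N ∧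
        s₀.arr aHeight (T.vert (3 * i + 1)) < N ∧ s₀.arr aHeight (T.vert (3 * i + 2)) < N))
    rw [card_range] at hcard
    rw [← hJ] at hle hcard
    simp [hsj, hr.vert, hr.len_act, hH]
    rw [hle]
    refine ⟨by omega, fun h₂ h₁ h₀ => ⟨by omega, by rw [if_pos ⟨h₀, h₁, h₂⟩]⟩, fun h => ?_⟩
    rw [if_neg, add_zero]
    rintro ⟨h₀, h₁, h₂⟩
    have := h h₂ h₁
    omega
  · simp only [State.setVar_var, ht, Expr.cost]
    simp only [Nat.reduceEqDiff, if_false]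
    rintro k s' ⟨h, hk⟩
    refine ⟨?_, by omega⟩
    rw [h, TriSys.count, TriSys.alive]
    refine congrArg card (filter_congr fun j hj => ?_)
    have hj := mem_range.1 hj
    have h₀ : T.vert (3 * j) ∈ T.act := TriSys.vert_mem_act (by omega)
    have h₁ : T.vert (3 * j + 1) ∈ T.act := TriSys.vert_mem_act (by omega)
    have h₂ : T.vert (3 * j + 2) ∈ T.act := TriSys.vert_mem_act (by omega)
    simp [h₀, h₁, h₂]

theorem Ready.injOn {T : TriSys} {N : ℕ} {s : State} (h : Ready T N s) :
    Set.InjOn (s.arr aAct) (range N) := by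
  refine card_image_iff.1 ?_
  rw [h.image_act, h.card_act, card_range]

theorem Ready.card_filter_succ {T : TriSys} {N : ℕ} {s : State} (h : Ready T N s) {j : ℕ}
    (hj : j < N) (p : ℕ → Prop) [DecidablePred p] :
    #{v ∈ (range (j + 1)).image (s.arr aAct) | p v} =
      #{v ∈ (range j).image (s.arr aAct) | p v} + if p (s.arr aAct j) then 1 else 0 := by
  rw [range_add_one, image_insert, filter_insert]
  split_ifs with hp
  · rw [card_insert_of_notMem]
    intro hmem
    obtain ⟨i, hi, hij⟩ := mem_image.1 (mem_filter.1 hmem).1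
    rw [mem_range] at hi
    have := h.injOn (by simpa using hi.trans hj) (by simpa using hj) hij
    omega
  · rfl

theorem wp_copyAlive {T : TriSys} {B N : ℕ} (hN : N ≤ B) (hB : ∀ v ∈ T.act, v ≤ B) {s₀ : State}
    (hs : Ready T N s₀) :
    wp B copyAlive (fun k s' =>
      (range #(T.alive N (s₀.arr aHeight))).image (s'.arr aSrc) =
        T.alive N (s₀.arr aHeight) ∧ k ≤ 60 * N + 8) s₀ := by
  refine ⟨Nat.zero_le _, ?_⟩
  refine wp_mono (wp_forLoop
    (J := fun j s => s.var rJ = #{v ∈ (range j).image (s₀.arr aAct) | s₀.arr aHeight v < N} ∧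
      (range (s.var rJ)).image (s.arr aSrc) =
        {v ∈ (range j).image (s₀.arr aAct) | s₀.arr aHeight v < N})
    (C := 50) (by decide) (by decide) (by decide) ?_ ?_ ?_) ?_
  · simp [hs.len_act, hN]
  · simp
  · rintro j s hj hfr hsj ⟨hJ, hJ'⟩
    have hfr₀ : Frame copyAlive s₀ s := (Frame.of_setVar (by decide)).trans
      (hfr.mono (by decide) (by decide))
    have hr : Ready T N s := hs.of_frame hfr₀ (by decide)
    have hH : s.arr aHeight = s₀.arr aHeight := hfr₀.2 _ (by decide)
    have hA : s.arr aAct = s₀.arr aAct := hfr₀.2 _ (by decide)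
    simp only [State.setVar_var, hs.len_act] at hj
    simp only [Nat.reduceEqDiff, if_false] at hj
    have hle := hs.card_filter_succ hj (fun v => s₀.arr aHeight v < N)
    have hmem := hs.mem_act hj
    have hcard : s.var rJ ≤ j := by
      rw [hJ]
      exact (card_filter_le _ _).trans (card_image_le.trans (card_range j).le)
    have hvB := hB _ hmem
    rw [← hJ] at hle
    simp only [range_add_one, image_insert, filter_insert] at hle ⊢
    simp [hsj, hA, hr.len_act, hH]
    refine ⟨hvB, fun hp => ⟨hvB, by omega, by rw [hle, if_pos hp], ?_⟩, fun hp => ?_⟩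
    · rw [if_pos hp, range_add_one, image_insert, Function.update_self, ← hJ']
      congr 1
      refine image_congr fun i hi => ?_
      rw [coe_range, Set.mem_Iio] at hi
      exact Function.update_of_ne hi.ne _ _
    · simp [not_lt.2 hp, hJ]
      rw [← hJ, hJ']
  · simp only [State.setVar_var, hs.len_act, Expr.cost]
    simp only [Nat.reduceEqDiff, if_false, hs.image_act]
    rintro k s' ⟨⟨h, h'⟩, hk⟩
    rw [h] at h'
    exact ⟨h', by omega⟩

theorem wp_testLevel {T : TriSys} {B N : ℕ} (hN : N ≤ B) (h1 : 1 ≤ B) {s₀ : State}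
    (hs : Ready T N s₀) :
    wp B testLevel (fun k s' => (s'.var rMore = 0 → ∀ v ∈ T.act, s₀.arr aHeight v ≠ s₀.var rGap) ∧
      (s'.var rMore ≠ 0 → s'.var rMore = 1 ∧ ∃ v ∈ T.act, s₀.arr aHeight v = s₀.var rGap) ∧
      k ≤ 60 * N + 8) s₀ := by
  refine ⟨Nat.zero_le _, ?_⟩
  refine wp_mono (wp_forLoop
    (J := fun j s => (s.var rMore = 0 → ∀ v ∈ (range j).image (s₀.arr aAct),
        s₀.arr aHeight v ≠ s₀.var rGap) ∧
      (s.var rMore ≠ 0 → s.var rMore = 1 ∧ ∃ v ∈ T.act, s₀.arr aHeight v = s₀.var rGap))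
    (C := 50) (by decide) (by decide) (by decide) ?_ ?_ ?_) ?_
  · simp [hs.len_act, hN]
  · simp
  · rintro j s hj hfr hsj ⟨hJ, hJ'⟩
    have hfr₀ : Frame testLevel s₀ s := (Frame.of_setVar (by decide)).trans
      (hfr.mono (by decide) (by decide))
    have hH : s.arr aHeight = s₀.arr aHeight := hfr₀.2 _ (by decide)
    have hA : s.arr aAct = s₀.arr aAct := hfr₀.2 _ (by decide)
    have hG : s.var rGap = s₀.var rGap := hfr₀.1 _ (by decide)
    simp only [State.setVar_var, hs.len_act] at hj
    simp only [Nat.reduceEqDiff, if_false] at hj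
    have hmem := hs.mem_act hj
    simp only [range_add_one, image_insert]
    simp [hsj, hA, hH, hG, h1]
    refine ⟨fun h => ⟨_, hmem, h⟩, fun h => ⟨fun h₀ => ⟨h, ?_⟩, fun h₀ => hJ' h₀⟩⟩
    simpa using hJ h₀
  · simp only [State.setVar_var, hs.len_act, Expr.cost]
    simp only [Nat.reduceEqDiff, if_false, hs.image_act]
    rintro k s' ⟨⟨h, h'⟩, hk⟩
    exact ⟨h, h', by omega⟩

theorem wp_findGap {T : TriSys} {B N : ℕ} (hN : N + 1 ≤ B) {s₀ : State}
    (hs : Ready T N s₀) :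
    wp B findGap (fun k s' => s'.var rGap ≤ N ∧
      (∀ v ∈ T.act, s₀.arr aHeight v ≠ s'.var rGap) ∧ k ≤ 100 * (N + 1) * (N + 1) + 10) s₀ := by
  refine ⟨Nat.zero_le _, by simp; omega, ?_⟩
  -- Pigeonhole: the `N` vertices cannot occupy all of the `N + 1` levels from 0 to `N`.
  have hle : ∀ g, (∀ l < g, ∃ v ∈ T.act, s₀.arr aHeight v = l) → g ≤ N := by
    intro g hg
    rw [← hs.card_act, ← card_range g]
    refine (card_le_card fun l hl => ?_).trans (card_image_le (s := T.act) (f := s₀.arr aHeight))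
    obtain ⟨v, hv, hvl⟩ := hg l (mem_range.1 hl)
    exact mem_image.2 ⟨v, hv, hvl⟩
  refine wp_mono (wp_loop
    (I := fun s φ => (∀ l < s.var rGap, ∃ v ∈ T.act, s₀.arr aHeight v = l) ∧
      (s.var rMore = 0 → ∀ v ∈ T.act, s₀.arr aHeight v ≠ s.var rGap) ∧
      φ = 100 * (N + 1) * (N - s.var rGap) + if s.var rMore = 0 then 0 else 100 * (N + 1))
    (φ₀ := 100 * (N + 1) * N + 100 * (N + 1)) ?_ ?_) ?_
  · simp
  · rintro s φ hfr ⟨h₁, h₂, rfl⟩ hmore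
    have hfr₀ : Frame findGap s₀ s := ((Frame.of_setVar (by decide)).trans
      (Frame.of_setVar (by decide))).trans (hfr.mono (by decide) (by decide))
    have hr : Ready T N s := hs.of_frame hfr₀ (by decide)
    have hH : s.arr aHeight = s₀.arr aHeight := hfr₀.2 _ (by decide)
    have hg := hle _ h₁
    simp only [Expr.eval] at hmore
    rw [if_neg hmore]
    refine wp_seq (wp_testLevel (by omega) (by omega) hr) fun k s' h hfr' => ?_
    have hG : s'.var rGap = s.var rGap := hfr'.1 _ (by decide)
    rw [hH] at h
    obtain ⟨g₁, g₂, hk⟩ := h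
    by_cases hm : s'.var rMore = 0
    · have := g₁ hm
      simp [hm, hG]
      exact ⟨by omega, ⟨h₁, this⟩, by omega⟩
    · obtain ⟨hm1, hlev⟩ := g₂ hm
      have hlev' : ∀ l < s.var rGap + 1, ∃ v ∈ T.act, s₀.arr aHeight v = l := by
        intro l hl
        rcases Nat.lt_succ_iff_lt_or_eq.1 hl with h | rfl
        · exact h₁ l h
        · exact hlev
      have hgN := hle _ hlev'
      simp only [wp, Expr.eval, Op.apply, hm1, hG, Expr.cost, State.setVar_var]
      simp only [Nat.reduceEqDiff, if_true, if_false]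
      refine ⟨by omega, _, ⟨hlev', by simp, rfl⟩, ?_⟩
      obtain ⟨d, hd⟩ : ∃ d, N - s.var rGap = d + 1 := ⟨N - s.var rGap - 1, by omega⟩
      rw [hd, show N - (s.var rGap + 1) = d by omega, mul_add_one (100 * (N + 1)) d]
      omega
  · rintro k s' ⟨φ', ⟨h₁, h₂, rfl⟩, hcond, hk⟩
    simp only [Expr.eval, Expr.cost] at hcond hk ⊢
    refine ⟨hle _ h₁, h₂ hcond, ?_⟩
    rw [mul_add_one (100 * (N + 1)) N]
    omega

theorem wp_peelAbove {T : TriSys} {B N : ℕ} (hN : N + 1 ≤ B) (hB : ∀ v ∈ T.act, v ≤ B)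
    {s₀ : State} (hs : Ready T N s₀) :
    wp B peelAbove (fun k s' =>
      (∀ v, s₀.arr aHeight v < s₀.var rGap → s'.arr aHeight v = s₀.arr aHeight v) ∧
      (∀ v ∈ T.act, s₀.var rGap ≤ s₀.arr aHeight v → s'.arr aHeight v = N) ∧
      (∀ v ∉ T.act, s'.arr aHeight v = s₀.arr aHeight v) ∧
      s'.var rCur = #(T.alive (s₀.var rGap) (s₀.arr aHeight)) ∧
      k ≤ 60 * N + 8) s₀ := by
  refine ⟨Nat.zero_le _, ?_⟩
  refine wp_mono (wp_forLoop
    (J := fun j s =>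
      (∀ v, s₀.arr aHeight v < s₀.var rGap → s.arr aHeight v = s₀.arr aHeight v) ∧
      (∀ v ∈ (range j).image (s₀.arr aAct), s₀.var rGap ≤ s₀.arr aHeight v →
        s.arr aHeight v = N) ∧
      (∀ v ∉ (range j).image (s₀.arr aAct), s.arr aHeight v = s₀.arr aHeight v) ∧
      s.var rCur = #{v ∈ (range j).image (s₀.arr aAct) | s₀.arr aHeight v < s₀.var rGap})
    (C := 50) (by decide) (by decide) (by decide) ?_ ?_ ?_) ?_
  · simp [hs.len_act]; omega
  · simp
  · rintro j s hj hfr hsj ⟨h₁, h₂, h₃, h₄⟩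
    have hfr₀ : Frame peelAbove s₀ s := (Frame.of_setVar (by decide)).trans
      (hfr.mono (by decide) (by decide))
    have hr : Ready T N s := hs.of_frame hfr₀ (by decide)
    have hA : s.arr aAct = s₀.arr aAct := hfr₀.2 _ (by decide)
    have hG : s.var rGap = s₀.var rGap := hfr₀.1 _ (by decide)
    simp only [State.setVar_var, hs.len_act] at hj
    simp only [Nat.reduceEqDiff, if_false] at hj
    have hle := hs.card_filter_succ hj (fun v => s₀.arr aHeight v < s₀.var rGap)
    have hmem := hs.mem_act hj
    have hcard : s.var rCur ≤ j := by
      rw [h₄]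
      exact (card_filter_le _ _).trans (card_image_le.trans (card_range j).le)
    have hvB := hB _ hmem
    -- Heights are overwritten during the loop; as the list has no repetitions, the height read here
    -- is still the original one.
    have hnot : s₀.arr aAct j ∉ (range j).image (s₀.arr aAct) := by
      intro hmem
      obtain ⟨i, hi, hij⟩ := mem_image.1 hmem
      rw [mem_range] at hi
      have := hs.injOn (by simpa using hi.trans hj) (by simpa using hj) hij
      omega
    have hv := h₃ _ hnot
    rw [← h₄, range_add_one, image_insert] at hle
    simp only [range_add_one, image_insert]
    obtain ⟨v, hvd⟩ : ∃ v, s₀.arr aAct j = v := ⟨_, rfl⟩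
    rw [hvd] at hle hmem hvB hnot hv ⊢
    generalize (range j).image (s₀.arr aAct) = D at *
    simp only [mem_insert, not_or]
    simp [hsj, hA, hr.len_act, hG, hv, hvd]
    refine ⟨hvB, fun hp => ⟨by omega, h₁, ⟨fun h => absurd hp (not_lt.2 h), h₂⟩,
      fun u _ hu => h₃ u hu, by rw [hle, if_pos hp]⟩, fun hp => ⟨by omega, fun u hu => ?_,
      fun u hu hg => ?_, fun u hu hD => ?_, by rw [hle, if_neg (not_lt.2 hp), add_zero]⟩⟩
    · rw [Function.update_of_ne (by rintro rfl; omega), h₁ u hu]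
    · simp only [Function.update_apply]
      split_ifs
      · rfl
      · exact h₂ u hu hg
    · rw [Function.update_of_ne hu, h₃ u hD]
  · simp only [State.setVar_var, hs.len_act, Expr.cost]
    simp only [Nat.reduceEqDiff, if_false, hs.image_act]
    rintro k s' ⟨⟨h₁, h₂, h₃, h₄⟩, hk⟩
    exact ⟨h₁, h₂, h₃, h₄, by omega⟩

/-! ### Densest sets -/

namespace TriSys

/-- `S` is a densest nonempty set of vertices smaller than `n`. -/
def Densest (T : TriSys) (n : ℕ) (S : Finset ℕ) : Prop :=
  S.Nonempty ∧ S ⊆ range n ∧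
    ∀ S' ⊆ range n, S'.Nonempty → T.count S' * #S ≤ T.count S * #S'

variable {T : TriSys} {n K c : ℕ} {S S₁ S₂ : Finset ℕ}

theorem count_empty (T : TriSys) : T.count ∅ = 0 := by
  simp [count]

theorem Densest.of_le (h : T.Densest n S) (h₁ : S₁.Nonempty) (h₁n : S₁ ⊆ range n)
    (hle : T.count S * #S₁ ≤ T.count S₁ * #S) : T.Densest n S₁ := by
  refine ⟨h₁, h₁n, fun S' hS' hne => ?_⟩
  have h' := h.2.2 S' hS' hne
  have hpos : 0 < #S := h.1.card_pos
  refine Nat.le_of_mul_le_mul_right ?_ hpos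
  calc T.count S' * #S₁ * #S = T.count S' * #S * #S₁ := by ring
    _ ≤ T.count S * #S' * #S₁ := Nat.mul_le_mul_right _ h'
    _ = T.count S * #S₁ * #S' := by ring
    _ ≤ T.count S₁ * #S * #S' := Nat.mul_le_mul_right _ hle
    _ = T.count S₁ * #S' * #S := by ring

theorem exists_densest (T : TriSys) (hn : 0 < n) : ∃ S, T.Densest n S := by
  obtain ⟨S, hS, hmax⟩ := exists_max_image ((range n).powerset.filter (·.Nonempty))
    (fun S => (T.count S : ℚ) / #S)
    ⟨range n, by simp [hn.ne']⟩
  simp only [mem_filter, mem_powerset, and_imp] at hS hmax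
  refine ⟨S, hS.2, hS.1, fun S' h₁ h₂ => ?_⟩
  have := hmax S' h₁ h₂
  rw [div_le_div_iff₀ (by exact_mod_cast h₂.card_pos) (by exact_mod_cast hS.2.card_pos)] at this
  exact_mod_cast this

/-- Either the set `S₁` of density at least `c / K` is densest, or a part of a densest set that
can be removed at the price of `c / K` triangles per vertex leaves a densest set. -/
theorem Densest.peel (h : T.Densest n S) (hK : 0 < K) (h₁ : S₁.Nonempty) (h₁n : S₁ ⊆ range n)
    (hc : c * #S₁ ≤ K * T.count S₁) (hsub : S₂ ⊆ S)
    (hle : K * T.count S ≤ K * T.count S₂ + c * (#S - #S₂)) :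
    T.Densest n S₁ ∨ T.Densest n S₂ := by
  rcases le_or_gt (T.count S * #S₁) (T.count S₁ * #S) with hlt | hlt
  · exact .inl (h.of_le h₁ h₁n hlt)
  right
  have hpos : 0 < #S₁ := h₁.card_pos
  -- If `S` beats `S₁`, its density exceeds `c / K`, the largest average loss per removed vertex. So
  -- removing the vertices neither lowers the density nor exhausts `S`.
  have hcS : c * #S < K * T.count S := by
    refine lt_of_mul_lt_mul_right (a := #S₁) ?_ (Nat.zero_le _)
    calc c * #S * #S₁ = c * #S₁ * #S := by ring
      _ ≤ K * T.count S₁ * #S := Nat.mul_le_mul_right _ hc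
      _ = K * (T.count S₁ * #S) := by ring
      _ < K * (T.count S * #S₁) := Nat.mul_lt_mul_of_pos_left hlt hK
      _ = K * T.count S * #S₁ := by ring
  have hcard := card_le_card hsub
  obtain ⟨d, hd⟩ : ∃ d, #S = #S₂ + d := ⟨#S - #S₂, by omega⟩
  have hne : S₂.Nonempty := by
    rw [nonempty_iff_ne_empty]
    rintro rfl
    rw [count_empty, card_empty] at hle
    simp at hle
    omega
  refine h.of_le hne (hsub.trans h.2.1) ?_
  refine Nat.le_of_mul_le_mul_left ?_ hK
  rw [hd, Nat.add_sub_cancel_left] at hle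
  rw [hd] at hcS ⊢
  nlinarith

/-- A set `S` strictly denser than `S₁` would gain at least `K` after clearing denominators and
scaling. The full loads of `V` bound this gain by the error from rounding `c` down, which is at most
`#S₁ * (#V - #S) ≤ n²`. -/
theorem Densest.of_full {V : Finset ℕ} (h : T.Densest n S) (h₁ : S₁.Nonempty)
    (h₁n : S₁ ⊆ range n) (hSV : S ⊆ V) (hV : V ⊆ range n)
    (hVS : T.count V * #S₁ ≤ T.count S₁ * #V) (hc : K * T.count S₁ < (c + 1) * #S₁)
    (hfull : c * (#V - #S) + K * T.count S ≤ K * T.count V) (hK : n * n < K) :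
    T.Densest n S₁ := by
  refine h.of_le h₁ h₁n ?_
  by_contra! hlt
  have hcard := card_le_card hSV
  have hVn : #V ≤ n := by simpa using card_le_card hV
  have h₁n' : #S₁ ≤ n := by simpa using card_le_card h₁n
  obtain ⟨d, hd⟩ : ∃ d, #V = #S + d := ⟨#V - #S, by omega⟩
  rw [hd, Nat.add_sub_cancel_left] at hfull
  rw [hd] at hVS
  generalize T.count S = ts at *
  generalize T.count V = tv at *
  generalize T.count S₁ = tb at *
  generalize #S = ns at *
  generalize #S₁ = nb at *
  have e₁ : (c * d + K * ts) * nb ≤ K * (tb * (ns + d)) :=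
    (Nat.mul_le_mul_right _ hfull).trans
      ((le_of_eq (by ring)).trans (Nat.mul_le_mul_left K hVS))
  have e₂ : K * (tb * ns + 1) ≤ K * (ts * nb) := Nat.mul_le_mul_left K hlt
  have e₃ : K * tb * d ≤ (c + 1) * nb * d := Nat.mul_le_mul_right _ hc.le
  have e₄ : nb * d ≤ n * n := Nat.mul_le_mul h₁n' (by omega)
  nlinarith

end TriSys

/-! ### One round, and the induction over the rounds -/

/-- One round of the algorithm. -/
def round : Prog :=
  rPrev ≔ &ₑrCur ;; recount ;; record ;; passes ;; findGap ;; peelAbove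

/-- The rounds of the algorithm. -/
def rounds : Prog := Prog.loop (&ₑrCur <ₑ &ₑrPrev) round

/-- `S` is recorded as the best known set. -/
structure BestIs (T : TriSys) (K n : ℕ) (s : State) (S : Finset ℕ) : Prop where
  nonempty : S.Nonempty
  subset : S ⊆ range n
  card : s.var rBestN = #S
  count : s.var rBestT = T.count S
  list : (range #S).image (s.arr aSrc) = S
  cap : s.var rCap = K * T.count S / #S

theorem BestIs.congr {T : TriSys} {K n : ℕ} {s s' : State} {S : Finset ℕ} (h : BestIs T K n s S)
    (h₁ : s'.var rBestN = s.var rBestN) (h₂ : s'.var rBestT = s.var rBestT)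
    (h₃ : s'.arr aSrc = s.arr aSrc) (h₄ : s'.var rCap = s.var rCap) : BestIs T K n s' S :=
  ⟨h.nonempty, h.subset, h₁.trans h.card, h₂.trans h.count, h₃ ▸ h.list, h₄.trans h.cap⟩

/-- The recorded density never decreases, hence neither does the capacity. This is why the preflow
of one round can be continued in the next one through `Inv.mono`. -/
theorem wp_record {T : TriSys} {B K N n : ℕ} (hB : WordBounds T B K N)
    (hn : T.act ⊆ range n) {s : State}
    (hs : Ready T N s) (hK : s.var rMass = K)
    (hcur : s.var rCur = #(T.alive N (s.arr aHeight)))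
    (hcount : s.var rCount = T.count (T.alive N (s.arr aHeight))) {S : Finset ℕ}
    (hS : BestIs T K n s S) :
    wp B record (fun k s' => ∃ S', BestIs T K n s' S' ∧
      T.count (T.alive N (s.arr aHeight)) * #S' ≤ T.count S' * #(T.alive N (s.arr aHeight)) ∧
      T.count S * #S' ≤ T.count S' * #S ∧ s.var rCap ≤ s'.var rCap ∧ k ≤ 60 * N + 50) s := by
  have hvB : ∀ v ∈ T.act, v ≤ B := by
    intro v hv
    obtain ⟨e, he, rfl⟩ := mem_image.1 hv
    exact hB.vert e (mem_range.1 he)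
  have hsub : T.alive N (s.arr aHeight) ⊆ T.act := filter_subset _ _
  have hcard : #(T.alive N (s.arr aHeight)) ≤ N := (card_le_card hsub).trans hs.card_act.le
  have hct := T.count_le (T.alive N (s.arr aHeight))
  have hbs := hB.slots
  have hbh := hB.height
  have hpos : 0 < #S := hS.nonempty.card_pos
  have hcapB : K * T.count (T.alive N (s.arr aHeight)) / #(T.alive N (s.arr aHeight)) ≤ B :=
    (Nat.div_le_self _ _).trans ((Nat.mul_le_mul_left K hct).trans hB.mass)
  set V := T.alive N (s.arr aHeight) with hV
  by_cases hlt : T.count S * #V < T.count V * #S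
  · simp [record, hcur, hcount, hS.card, hS.count, hK, hlt]
    refine ⟨by omega, by omega, hcapB, ?_⟩
    refine wp_mono (wp_frame (wp_copyAlive (T := T) (N := N) (by omega) hvB ?_)) ?_
    · exact ((hs.of_frame (p := record) (Frame.of_setVar (by decide)) (by decide)).of_frame
        (p := record) (Frame.of_setVar (by decide)) (by decide)).of_frame
        (p := record) (Frame.of_setVar (by decide)) (by decide)
    simp only [State.setVar_arr]
    rintro k s' ⟨⟨hl, hk⟩, hfr⟩
    have h₁ : s'.var rBestN = #V := (hfr.1 _ (by decide)).trans (by simp)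
    have h₂ : s'.var rBestT = T.count V := (hfr.1 _ (by decide)).trans (by simp)
    have h₃ : s'.var rCap = K * T.count V / #V := (hfr.1 _ (by decide)).trans (by simp)
    -- The empty set never passes the strict comparison, so the division by its size does not occur.
    have hne : V.Nonempty := by
      rw [nonempty_iff_ne_empty]
      intro h
      rw [h, T.count_empty] at hlt
      simp at hlt
    refine ⟨V, ⟨hne, hsub.trans hn, h₁, h₂, hl, h₃⟩, le_rfl, hlt.le, ?_, by omega⟩
    rw [h₃, hS.cap, Nat.le_div_iff_mul_le hne.card_pos]
    refine Nat.le_of_mul_le_mul_right ?_ hpos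
    calc K * T.count S / #S * #V * #S = K * T.count S / #S * #S * #V := by ring
      _ ≤ K * T.count S * #V := Nat.mul_le_mul_right _ (Nat.div_mul_le_self _ _)
      _ = K * (T.count S * #V) := by ring
      _ ≤ K * (T.count V * #S) := Nat.mul_le_mul_left K hlt.le
      _ = K * T.count V * #S := by ring
  · simp [record, hcur, hcount, hS.card, hS.count, hlt]
    refine ⟨S, hS, not_lt.1 hlt, le_rfl⟩

theorem TriSys.work_anti {T : TriSys} {N : ℕ} {H H' PTR : ℕ → ℕ} (h : ∀ u, H u ≤ H' u) :
    T.work N H' PTR ≤ T.work N H PTR :=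
  sum_le_sum fun u _ => Nat.sub_le_sub_right
    (Nat.mul_le_mul_right _ (Nat.sub_le_sub_left (h u) N)) _

/-- The time that is reserved for moving scan pointers and for relabelings. -/
def TriSys.credit (T : TriSys) (N : ℕ) (H PTR : ℕ → ℕ) : ℕ :=
  150 * T.work N H PTR + 500 * (N + 1) * (2 * T.slack N H)

theorem TriSys.credit_anti {T : TriSys} {N : ℕ} {H H' PTR : ℕ → ℕ} (h : ∀ u, H u ≤ H' u) :
    T.credit N H' PTR ≤ T.credit N H PTR :=
  Nat.add_le_add (Nat.mul_le_mul_left _ (work_anti h))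
    (Nat.mul_le_mul_left _ (Nat.mul_le_mul_left _ (slack_anti h)))

/-- The invariant of the rounds. -/
structure RoundInv (T : TriSys) (K N n : ℕ) (s : State) (S : Finset ℕ) : Prop where
  ready : Ready T N s
  tri : s.var rT = T.t
  mass : s.var rMass = K
  inv : T.Inv K N (s.var rCap) (s.arr aHeight) (s.arr aPtr) (s.arr aFlow) (s.arr aLoad)
  best : BestIs T K n s S
  cur : s.var rCur = #(T.alive N (s.arr aHeight))
  opt : T.Densest n S ∨ ∃ S', T.Densest n S' ∧ S' ⊆ T.alive N (s.arr aHeight)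

/-- The living set is recorded before any vertex is deleted. Thus, if its size does not change, it
is known to be at most as dense as the record and `Densest.of_full` applies; in every case
`Densest.peel` preserves the alternative `opt`. -/
theorem wp_round {T : TriSys} {B K N n : ℕ} (hT : T.WF) (hB : WordBounds T B K N)
    (hNB : N + 1 ≤ B) (hn : T.act ⊆ range n) (hK : n * n < K) {s₀ : State} {S : Finset ℕ}
    (hs : RoundInv T K N n s₀ S) :
    wp B round (fun k s' => ∃ S', RoundInv T K N n s' S' ∧ s'.var rPrev = s₀.var rCur ∧
      s'.var rCur ≤ s₀.var rCur ∧ (s'.var rCur = s₀.var rCur → T.Densest n S') ∧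
      k + T.credit N (s'.arr aHeight) (s'.arr aPtr) ≤
        T.credit N (s₀.arr aHeight) (s₀.arr aPtr) +
          (60 * T.t + 1400 * ((N + 1) * (N + 1)))) s₀ := by
  have hvB : ∀ v ∈ T.act, v ≤ B := by
    intro v hv
    obtain ⟨e, he, rfl⟩ := mem_image.1 hv
    exact hB.vert e (mem_range.1 he)
  have hbs := hB.slots
  have hsub : T.alive N (s₀.arr aHeight) ⊆ T.act := filter_subset _ _
  have hcard : #(T.alive N (s₀.arr aHeight)) ≤ N := (card_le_card hsub).trans hs.ready.card_act.le
  have hcur := hs.cur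
  obtain ⟨cur, hcurdef⟩ : ∃ c, s₀.var rCur = c := ⟨_, rfl⟩
  obtain ⟨H₀, hH₀⟩ : ∃ H, s₀.arr aHeight = H := ⟨_, rfl⟩
  obtain ⟨P₀, hP₀⟩ : ∃ H, s₀.arr aPtr = H := ⟨_, rfl⟩
  have hinv := hs.inv
  have hopt := hs.opt
  rw [hH₀] at hsub hcard hcur hinv hopt ⊢
  rw [hcurdef] at hcur ⊢
  rw [hP₀] at hinv ⊢
  have hcurB : cur ≤ B := by omega
  refine ⟨by simpa [hcurdef] using hcurB, ?_⟩
  have hr₁ : Ready T N (s₀.setVar rPrev cur) :=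
    hs.ready.of_frame (p := round) (Frame.of_setVar (by decide)) (by decide)
  have hev : Expr.eval s₀ (&ₑrCur) = cur := hcurdef
  rw [hev]
  refine wp_seq (wp_recount (by omega) (by omega) hr₁ (by simp [hs.tri])) ?_
  rintro k₁ s₁ ⟨hc₁, hk₁⟩ hfr₁
  have hr₂ : Ready T N s₁ := hr₁.of_frame hfr₁ (by decide)
  have hH₁ : s₁.arr aHeight = H₀ := (hfr₁.2 _ (by decide)).trans hH₀
  have hP₁ : s₁.arr aPtr = P₀ := (hfr₁.2 _ (by decide)).trans hP₀
  have hF₁ : s₁.arr aFlow = s₀.arr aFlow := hfr₁.2 _ (by decide)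
  have hL₁ : s₁.arr aLoad = s₀.arr aLoad := hfr₁.2 _ (by decide)
  have hcap₁ : s₁.var rCap = s₀.var rCap := (hfr₁.1 _ (by decide)).trans (by simp)
  have hcur₁ : s₁.var rCur = cur := (hfr₁.1 _ (by decide)).trans (by simp [hcurdef])
  have hprev₁ : s₁.var rPrev = cur := (hfr₁.1 _ (by decide)).trans (by simp)
  have hmass₁ : s₁.var rMass = K := (hfr₁.1 _ (by decide)).trans (by simp [hs.mass])
  have ht₁ : s₁.var rT = T.t := (hfr₁.1 _ (by decide)).trans (by simp [hs.tri])
  have hbest₁ : BestIs T K n s₁ S := hs.best.congr ((hfr₁.1 _ (by decide)).trans (by simp))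
    ((hfr₁.1 _ (by decide)).trans (by simp)) (hfr₁.2 _ (by decide)) hcap₁
  rw [State.setVar_arr, hH₀] at hc₁
  refine wp_seq (wp_record hB hn hr₂ hmass₁ (by rw [hH₁, hcur₁, hcur]) (by rw [hH₁, hc₁])
    hbest₁) ?_
  rw [hH₁]
  rintro k₂ s₂ ⟨S₁, hbest₂, hV, hSS, hcap₂, hk₂⟩ hfr₂
  have hr₃ : Ready T N s₂ := hr₂.of_frame hfr₂ (by decide)
  have hH₂ : s₂.arr aHeight = H₀ := (hfr₂.2 _ (by decide)).trans hH₁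
  have hP₂ : s₂.arr aPtr = P₀ := (hfr₂.2 _ (by decide)).trans hP₁
  have hF₂ : s₂.arr aFlow = s₀.arr aFlow := (hfr₂.2 _ (by decide)).trans hF₁
  have hL₂ : s₂.arr aLoad = s₀.arr aLoad := (hfr₂.2 _ (by decide)).trans hL₁
  have hprev₂ : s₂.var rPrev = cur := (hfr₂.1 _ (by decide)).trans hprev₁
  have hmass₂ : s₂.var rMass = K := (hfr₂.1 _ (by decide)).trans hmass₁
  have ht₂ : s₂.var rT = T.t := (hfr₂.1 _ (by decide)).trans ht₁
  have hinv₂ : T.Inv K N (s₂.var rCap) (s₂.arr aHeight) (s₂.arr aPtr) (s₂.arr aFlow)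
      (s₂.arr aLoad) := by
    rw [hH₂, hP₂, hF₂, hL₂]
    exact hinv.mono (hcap₁ ▸ hcap₂)
  have hcapB : s₂.var rCap ≤ B := by
    rw [hbest₂.cap]
    exact (Nat.div_le_self _ _).trans ((Nat.mul_le_mul_left K (T.count_le _)).trans hB.mass)
  have hopt₂ : T.Densest n S₁ ∨ ∃ S', T.Densest n S' ∧ S' ⊆ T.alive N H₀ :=
    hopt.imp_left fun h => h.of_le hbest₂.nonempty hbest₂.subset hSS
  refine wp_seq (wp_passes hT hB hr₃ hinv₂ hcapB) ?_
  rw [hH₂, hP₂]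
  rintro k₃ s₃ ⟨hinv₃, hmono₃, hfull₃, hk₃⟩ hfr₃
  have hr₄ : Ready T N s₃ := hr₃.of_frame hfr₃ (by decide)
  refine wp_seq (wp_findGap hNB hr₄) ?_
  rintro k₄ s₄ ⟨hgN, hgap₄, hk₄⟩ hfr₄
  have hr₅ : Ready T N s₄ := hr₄.of_frame hfr₄ (by decide)
  have hH₄ : s₄.arr aHeight = s₃.arr aHeight := hfr₄.2 _ (by decide)
  refine wp_mono (wp_frame (wp_peelAbove hNB hvB hr₅)) ?_
  rw [hH₄]
  rintro k₅ s₅ ⟨⟨hlt₅, hge₅, hoff₅, hcur₅, hk₅⟩, hfr₅⟩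
  obtain ⟨g, hg⟩ : ∃ g, s₄.var rGap = g := ⟨_, rfl⟩
  rw [hg] at hgN hgap₄ hlt₅ hge₅ hcur₅
  obtain ⟨H₃, hH₃⟩ : ∃ H, s₃.arr aHeight = H := ⟨_, rfl⟩
  rw [hH₃] at hinv₃ hmono₃ hfull₃ hk₃ hgap₄ hlt₅ hge₅ hoff₅ hcur₅
  have hinv₅ := hinv₃.peel hT hgap₄ hlt₅ hge₅ hoff₅
  have hmono₅ : ∀ v, H₃ v ≤ s₅.arr aHeight v := by
    intro v
    have := hinv₃.height_le v
    by_cases hv : v ∈ T.act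
    · rcases lt_or_ge (H₃ v) g with h' | h'
      · rw [hlt₅ v h']
      · rwa [hge₅ v hv h']
    · rw [hoff₅ v hv]
  have halive : T.alive N (s₅.arr aHeight) = T.alive g H₃ := by
    refine filter_congr fun v hv => ?_
    rcases lt_or_ge (H₃ v) g with h' | h'
    · rw [hlt₅ v h']
      exact ⟨fun _ => h', fun _ => by omega⟩
    · rw [hge₅ v hv h']
      exact ⟨fun h => absurd h (lt_irrefl N), fun h => by omega⟩
  have hsubV : T.alive g H₃ ⊆ T.alive N H₀ := by
    intro v hv
    simp only [TriSys.alive, mem_filter] at hv ⊢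
    have := hmono₃ v
    exact ⟨hv.1, by omega⟩
  have hcapbest : s₂.var rCap * #S₁ ≤ K * T.count S₁ := by
    rw [hbest₂.cap]; exact Nat.div_mul_le_self _ _
  have hcap₅ : s₅.var rCap = s₂.var rCap := (hfr₅.1 _ (by decide)).trans
    ((hfr₄.1 _ (by decide)).trans (hfr₃.1 _ (by decide)))
  have hP₅ : s₅.arr aPtr = s₃.arr aPtr := (hfr₅.2 _ (by decide)).trans (hfr₄.2 _ (by decide))
  have hF₅ : s₅.arr aFlow = s₃.arr aFlow := (hfr₅.2 _ (by decide)).trans (hfr₄.2 _ (by decide))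
  have hL₅ : s₅.arr aLoad = s₃.arr aLoad := (hfr₅.2 _ (by decide)).trans (hfr₄.2 _ (by decide))
  refine ⟨S₁, ⟨hr₅.of_frame hfr₅ (by decide), ?_, ?_, ?_, hbest₂.congr ?_ ?_ ?_ hcap₅, ?_, ?_⟩,
    ?_, ?_, fun heq => ?_, ?_⟩
  · exact ((hfr₅.1 _ (by decide)).trans ((hfr₄.1 _ (by decide)).trans
      (hfr₃.1 _ (by decide)))).trans ht₂
  · exact ((hfr₅.1 _ (by decide)).trans ((hfr₄.1 _ (by decide)).trans
      (hfr₃.1 _ (by decide)))).trans hmass₂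
  · rw [hcap₅, hP₅, hF₅, hL₅]; exact hinv₅
  · exact (hfr₅.1 _ (by decide)).trans ((hfr₄.1 _ (by decide)).trans (hfr₃.1 _ (by decide)))
  · exact (hfr₅.1 _ (by decide)).trans ((hfr₄.1 _ (by decide)).trans (hfr₃.1 _ (by decide)))
  · exact (hfr₅.2 _ (by decide)).trans ((hfr₄.2 _ (by decide)).trans (hfr₃.2 _ (by decide)))
  · rw [hcur₅, halive]
  · rw [halive]
    rcases hopt₂ with h | ⟨S', hS', hS'V⟩
    · exact .inl h
    · have hS'act : S' ⊆ T.act := hS'V.trans hsub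
      have := hinv₃.count_le_peel hgap₄ hS'act
      refine (hS'.peel (by omega) hbest₂.nonempty hbest₂.subset hcapbest (filter_subset _ _)
        this).imp_right fun h => ⟨_, h, ?_⟩
      exact filter_subset_filter _ hS'act
  · exact ((hfr₅.1 _ (by decide)).trans ((hfr₄.1 _ (by decide)).trans
      (hfr₃.1 _ (by decide)))).trans hprev₂
  · rw [hcur₅, hcur]; exact card_le_card hsubV
  · rcases hopt₂ with h | ⟨S', hS', hS'V⟩
    · exact h
    -- Nested sets of equal size coincide, so the comparison `hV` made at the start of the round
    -- speaks of the present living set.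
    · have hVeq : T.alive g H₃ = T.alive N H₀ :=
        eq_of_subset_of_card_le hsubV (by rw [← hcur, ← heq, hcur₅])
      have hfull : ∀ v ∈ T.act, H₃ v < g → s₂.var rCap ≤ s₃.arr aLoad v :=
        fun v hv hvg => hfull₃ v hv (by omega)
      rw [← hVeq] at hS'V hV
      refine hS'.of_full hbest₂.nonempty hbest₂.subset hS'V ((filter_subset _ _).trans hn) hV ?_
        (hinv₃.count_le_of_full hgap₄ hfull hS'V) hK
      rw [hbest₂.cap, mul_comm _ #S₁]
      exact Nat.lt_mul_div_succ _ hbest₂.nonempty.card_pos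
  · have := TriSys.credit_anti (T := T) (N := N) (PTR := s₃.arr aPtr) hmono₅
    rw [hP₅]
    simp only [TriSys.credit] at this ⊢
    have e : 500 * (N + 1) * (N + 2) = 500 * ((N + 1) * (N + 1)) + 500 * N + 500 := by ring
    have e' : 100 * (N + 1) * (N + 1) = 100 * ((N + 1) * (N + 1)) := by ring
    have e'' : N + 1 ≤ (N + 1) * (N + 1) := Nat.le_mul_self _
    simp only [Expr.cost]
    omega

/-- The loop continues only while the living set shrinks, so at most `N + 1` rounds each consume one
portion `P`; all amortized costs are in `credit`. -/
theorem wp_rounds {T : TriSys} {B K N n : ℕ} (hT : T.WF) (hB : WordBounds T B K N)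
    (hNB : N + 1 ≤ B) (hn : T.act ⊆ range n) (hK : n * n < K) {s₀ : State} {S : Finset ℕ}
    (hs : RoundInv T K N n s₀ S) (hlt : s₀.var rCur < s₀.var rPrev) :
    wp B rounds (fun k s' => ∃ S', BestIs T K n s' S' ∧ T.Densest n S' ∧
      k ≤ T.credit N (s₀.arr aHeight) (s₀.arr aPtr) +
        (60 * T.t + 1400 * ((N + 1) * (N + 1)) + 5) * (N + 1) + 5) s₀ := by
  set P := 60 * T.t + 1400 * ((N + 1) * (N + 1)) + 5 with hP
  refine wp_mono (wp_loop
    (I := fun s φ => ∃ S, RoundInv T K N n s S ∧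
      (s.var rCur < s.var rPrev ∨ T.Densest n S) ∧
      φ = T.credit N (s.arr aHeight) (s.arr aPtr) + P * s.var rCur +
        if s.var rCur < s.var rPrev then P else 0)
    ⟨S, hs, .inl hlt, rfl⟩ ?_) ?_
  · rintro s φ hfr ⟨S₁, hs₁, h₁, rfl⟩ hcond
    have hlt₁ : s.var rCur < s.var rPrev := 
      not_not.1 fun h => hcond (ite_one_zero_eq_zero.2 h)
    refine wp_mono (wp_round hT hB hNB hn hK hs₁) ?_
    rintro k s' ⟨S₂, hs₂, hprev, hle, heq, hk⟩
    refine ⟨_, ⟨S₂, hs₂, ?_, rfl⟩, ?_⟩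
    · rw [hprev]
      rcases hle.lt_or_eq with h | h
      · exact .inl h
      · exact .inr (heq h)
    · rw [if_pos hlt₁, hprev]
      simp only [Expr.cost]
      rcases hle.lt_or_eq with h | h
      · rw [if_pos h]
        have := Nat.mul_le_mul_left P (Nat.succ_le_of_lt h)
        rw [Nat.mul_succ] at this
        omega
      · rw [h, if_neg (lt_irrefl _)]
        omega
  · rintro k s' ⟨φ', ⟨S₁, hs₁, h₁, rfl⟩, hcond, hk⟩
    have hge : s'.var rPrev ≤ s'.var rCur := not_lt.1 (ite_one_zero_eq_zero.1 hcond)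
    refine ⟨S₁, hs₁.best, h₁.resolve_left (by omega), ?_⟩
    have hcur : s₀.var rCur ≤ N := by
      rw [hs.cur, ← hs.ready.card_act]
      exact card_le_card (filter_subset _ _)
    have := Nat.mul_le_mul_left P hcur
    rw [if_pos hlt] at hk
    rw [mul_add_one P N]
    simp only [Expr.cost] at hk
    omega

/-! ### Setting up the preflow -/

/-- Enter the slot `rI`. -/
def enterSlot : Prog :=
  rV ≔ aVert @ₑ &ₑrI ;;
  Prog.ite (aCnt @ₑ &ₑrV =ₑ #ₑ0)
    (Prog.store aAct (&ₑrAct) (&ₑrV) ;; rAct ≔ &ₑrAct +ₑ #ₑ1) Prog.skip ;;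
  Prog.store aInc (&ₑrV *ₑ &ₑrL +ₑ aCnt @ₑ &ₑrV) (&ₑrI) ;;
  Prog.store aCnt (&ₑrV) (aCnt @ₑ &ₑrV +ₑ #ₑ1) ;;
  Prog.store aLoad (&ₑrV) (aLoad @ₑ &ₑrV +ₑ &ₑrMass) ;;
  Prog.store aFlow (&ₑrI) (&ₑrMass)

/-- Enter all slots; each of them gets the mass `n ^ 2`. -/
def enterSlots : Prog :=
  rMass ≔ &ₑrN *ₑ &ₑrN ;; rL ≔ #ₑ3 *ₑ &ₑrT ;; rAct ≔ #ₑ0 ;; forLoop rI rL enterSlot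

/-! ### Sorting into buckets, and the initial preflow -/

theorem mul_add_inj {L v v' i i' : ℕ} (hi : i < L) (hi' : i' < L)
    (h : v * L + i = v' * L + i') : v = v' ∧ i = i' := by
  have hL : 0 < L := by omega
  have h₁ : v = v' := by
    have := congrArg (· / L) h
    simpa [Nat.add_div_of_dvd_right, Nat.div_eq_of_lt hi, Nat.div_eq_of_lt hi',
      Nat.mul_div_cancel _ hL] using this
  subst h₁
  exact ⟨rfl, by omega⟩

/-- The numbers `e < j` are sorted into buckets according to `key e`: the bucket `v` consists of
the cells `v * L + i`, `i < num v`, of `lst`. -/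
structure Bucketed (key : ℕ → ℕ) (L j : ℕ) (num lst : ℕ → ℕ) : Prop where
  cnt : ∀ v, num v = #{e ∈ range j | key e = v}
  inc : ∀ v i, i < num v → lst (v * L + i) < j ∧ key (lst (v * L + i)) = v
  surj : ∀ e < j, ∃ i < num (key e), lst (key e * L + i) = e

theorem Bucketed.cnt_le {key : ℕ → ℕ} {L j : ℕ} {cnt inc : ℕ → ℕ} (h : Bucketed key L j cnt inc)
    (v : ℕ) : cnt v ≤ j := by
  rw [h.cnt]
  exact (card_filter_le _ _).trans (card_range j).le

/-- A bucket contains at most `j < L` numbers, so the next cell still belongs to the block of width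
`L` of its own bucket and overwrites nothing. -/
theorem Bucketed.insert {key : ℕ → ℕ} {L j v : ℕ} {cnt inc : ℕ → ℕ}
    (h : Bucketed key L j cnt inc) (hj : j < L) (hv : key j = v) :
    Bucketed key L (j + 1) (Function.update cnt v (cnt v + 1))
      (Function.update inc (v * L + cnt v) j) := by
  have hcnt := h.cnt_le
  have hinc : ∀ u i, i < cnt u →
      Function.update inc (v * L + cnt v) j (u * L + i) = inc (u * L + i) := by
    intro u i hi
    have := hcnt u
    have := hcnt v
    rw [Function.update_of_ne]
    intro heq
    obtain ⟨rfl, rfl⟩ := mul_add_inj (by omega) (by omega) heq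
    omega
  refine ⟨fun u => ?_, fun u i hi => ?_, fun e he => ?_⟩
  · rw [card_filter_range_succ, ← h.cnt, hv, Function.update_apply]
    by_cases hu : u = v
    · rw [hu, if_pos rfl, if_pos rfl]
    · rw [if_neg hu, if_neg (Ne.symm hu)]; rfl
  · have hcase : i < cnt u ∨ u = v ∧ i = cnt v := by
      rw [Function.update_apply] at hi
      split_ifs at hi with hu
      · subst hu; omega
      · exact .inl hi
    rcases hcase with hi | ⟨rfl, rfl⟩
    · rw [hinc u i hi]
      have := h.inc u i hi
      exact ⟨by omega, this.2⟩
    · rw [Function.update_self]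
      exact ⟨by omega, hv⟩
  · rcases Nat.lt_succ_iff_lt_or_eq.1 he with he | rfl
    · obtain ⟨i, hi, hie⟩ := h.surj e he
      refine ⟨i, hi.trans_le ?_, by rw [hinc _ _ hi, hie]⟩
      rw [Function.update_apply]
      split_ifs with hu
      · rw [hu]; omega
      · exact le_rfl
    · rw [hv]
      exact ⟨cnt v, by rw [Function.update_self]; omega, Function.update_self _ _ _⟩

/-- The memory after entering the first `j` slots. -/
structure Entered (vert : ℕ → ℕ) (L κ j : ℕ) (s : State) : Prop
    extends Bucketed vert L j (s.arr aCnt) (s.arr aInc) where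
  numAct : s.var rAct = #((range j).image vert)
  act : (range (s.var rAct)).image (s.arr aAct) = (range j).image vert
  load : ∀ v, s.arr aLoad v = κ * s.arr aCnt v
  flow : ∀ e < j, s.arr aFlow e = κ

theorem wp_enterSlot {vert : ℕ → ℕ} {L κ j B : ℕ} {s : State} (h : Entered vert L κ j s)
    (hj : j < L) (hsj : s.var rI = j) (hvert : s.arr aVert = vert) (hL : s.var rL = L)
    (hκ : s.var rMass = κ) (hB : κ * L ≤ B) (hLB : L ≤ B) (hv : vert j ≤ B) :
    wp B enterSlot (fun k s' => Entered vert L κ (j + 1) s' ∧ k ≤ 80) s := by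
  obtain ⟨v, hvdef⟩ : ∃ v, vert j = v := ⟨_, rfl⟩
  rw [hvdef] at hv
  have hcnt := h.toBucketed.cnt_le
  have hκB : κ * 1 ≤ B := (Nat.mul_le_mul_left κ (by omega)).trans hB
  have hload : s.arr aLoad v + κ ≤ B := by
    rw [h.load, ← mul_add_one]
    exact (Nat.mul_le_mul_left κ (by have := hcnt v; omega)).trans hB
  have hact : s.var rAct ≤ j := by
    rw [h.numAct]
    exact card_image_le.trans (card_range j).le
  have hcv := hcnt v
  have key : ∀ s' : State, s'.arr aCnt = Function.update (s.arr aCnt) v (s.arr aCnt v + 1) →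
      s'.arr aInc = Function.update (s.arr aInc) (v * L + s.arr aCnt v) j →
      s'.arr aLoad = Function.update (s.arr aLoad) v (s.arr aLoad v + κ) →
      s'.arr aFlow = Function.update (s.arr aFlow) j κ →
      s'.var rAct = #((range (j + 1)).image vert) →
      (range (s'.var rAct)).image (s'.arr aAct) = (range (j + 1)).image vert →
      Entered vert L κ (j + 1) s' := by
    intro s' h₁ h₂ h₃ h₄ h₅ h₆
    refine ⟨by rw [h₁, h₂]; exact h.toBucketed.insert hj hvdef, h₅, h₆, fun u => ?_,
      fun e he => ?_⟩
    · rw [h₃, h₁, Function.update_apply, Function.update_apply]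
      split_ifs with hu
      · rw [h.load, mul_add_one]
      · exact h.load u
    · rw [h₄, Function.update_apply]
      split_ifs with he'
      · rfl
      · exact h.flow e (by omega)
  -- A zero counter detects the first occurrence of a vertex, which keeps the vertex list free of
  -- repetitions.
  have hmem : v ∈ (range j).image vert ↔ s.arr aCnt v ≠ 0 := by
    rw [h.cnt, ← Nat.pos_iff_ne_zero, card_pos]
    simp [Finset.Nonempty]
  by_cases hc : s.arr aCnt v = 0
  · have hv' : v ∉ (range j).image vert := by rw [hmem]; omega
    simp [enterSlot, hsj, hvert, hvdef, hL, hκ, hc]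
    refine ⟨hv, by omega, by omega, by omega, by omega, by omega, ?_⟩
    refine key _ (by simp [hc]) (by simp [hc]) (by simp) (by simp) ?_ ?_
    · simp [range_add_one, hvdef, card_insert_of_notMem hv', h.numAct]
    · rw [range_add_one (n := j), image_insert, hvdef, ← h.act]
      simp only [State.setArr_var, State.setVar_var, if_true, State.setArr_arr, State.setVar_arr]
      simp only [Nat.reduceEqDiff, if_false]
      rw [range_add_one, image_insert, Function.update_self]
      congr 1
      refine image_congr fun i hi => ?_
      rw [coe_range, Set.mem_Iio] at hi
      exact Function.update_of_ne hi.ne _ _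
  · have hv' : v ∈ (range j).image vert := hmem.2 hc
    simp [enterSlot, hsj, hvert, hvdef, hL, hκ, hc]
    refine ⟨hv, by omega, by omega, by omega, by omega, ?_⟩
    refine key _ (by simp) (by simp) (by simp) (by simp) ?_ ?_
    · simp [range_add_one, hvdef, insert_eq_of_mem hv', h.numAct]
    · rw [range_add_one, image_insert, hvdef, insert_eq_of_mem hv', ← h.act]
      simp

theorem wp_enterSlots {B n t : ℕ} {s₀ : State} (hn : s₀.var rN = n) (ht : s₀.var rT = t)
    (hB : n * n * (3 * t) ≤ B) (hnB : n * n ≤ B) (htB : 3 * t ≤ B)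
    (hv : ∀ e < 3 * t, s₀.arr aVert e ≤ B)
    (hcnt : ∀ v, s₀.arr aCnt v = 0) (hload : ∀ v, s₀.arr aLoad v = 0) :
    wp B enterSlots (fun k s' => Entered (s₀.arr aVert) (3 * t) (n * n) (3 * t) s' ∧
      s'.var rMass = n * n ∧ s'.var rL = 3 * t ∧ k ≤ 270 * t + 30) s₀ := by
  simp only [enterSlots, wp, Expr.eval, Op.apply, State.setVar_var, Expr.cost]
  simp only [Nat.reduceEqDiff, if_false, hn, ht]
  refine ⟨hnB, htB, Nat.zero_le _, ?_⟩
  refine wp_mono (wp_frame (wp_forLoop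
    (J := fun j s => Entered (s₀.arr aVert) (3 * t) (n * n) j s)
    (C := 80) (by decide) (by decide) (by decide) ?_ ?_ ?_)) ?_
  · simpa using htB
  · refine ⟨⟨?_, ?_, ?_⟩, ?_, ?_, ?_, ?_⟩ <;> simp [hcnt, hload]
  · rintro j s hj hfr hsj hJ
    simp only [State.setVar_var] at hj
    simp only [Nat.reduceEqDiff, if_true, if_false] at hj
    refine wp_mono (wp_enterSlot hJ hj hsj ((hfr.2 _ (by decide)).trans rfl)
      ((hfr.1 _ (by decide)).trans (by simp)) ((hfr.1 _ (by decide)).trans (by simp)) hB htB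
      (hv j hj)) ?_
    rintro k s' ⟨h, hk⟩
    refine ⟨?_, hk⟩
    refine ⟨by simpa using h.toBucketed, ?_, ?_, ?_, ?_⟩
    · simpa using h.numAct
    · simpa using h.act
    · simpa using h.load
    · simpa using h.flow
  · simp only [State.setVar_var]
    simp only [Nat.reduceEqDiff, if_true, if_false]
    rintro k s' ⟨⟨h, hk⟩, hfr⟩
    exact ⟨h, (hfr.1 _ (by decide)).trans (by simp), (hfr.1 _ (by decide)).trans (by simp),
      by omega⟩

/-- Find a densest set for the recorded list of triangles. -/
def solveTriangles : Prog :=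
  enterSlots ;; rMass ≔ #ₑ3 *ₑ &ₑrMass ;; Prog.store aSrc (#ₑ0) (#ₑ0) ;; rBestT ≔ #ₑ0 ;;
  rBestN ≔ #ₑ1 ;; rCap ≔ #ₑ0 ;; rPrev ≔ &ₑrAct +ₑ #ₑ1 ;; rCur ≔ &ₑrAct ;; rounds ;;
  rN ≔ &ₑrBestN

/-- For `t > 0` the bounds on `N` give `N + 1 ≤ 4 * min n t`, so cubic terms fall under `min n t ^
3`, while `N * t ≤ n * t`. For `t = 0` also `N = 0`. -/
theorem solve_time_le {n t N k W R : ℕ} (hn : 1 ≤ n) (hNn : N ≤ n) (hNt : N ≤ 3 * t)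
    (hW : W = N * (9 * t + N)) (hR : R = N * N)
    (hk : k ≤ 270 * t + 100 + (150 * W + 500 * (N + 1) * (2 * R)) +
      (60 * t + 1400 * ((N + 1) * (N + 1)) + 5) * (N + 1)) :
    k ≤ 200000 * (n * t + min n t ^ 3 + 1) := by
  subst hW hR
  set M := min n t with hM
  rcases Nat.eq_zero_or_pos t with rfl | ht
  · obtain rfl : N = 0 := by omega
    omega
  have hM1 : 1 ≤ M := by omega
  have hNM : N ≤ 3 * M := by omega
  have e₁ : N * t ≤ n * t := Nat.mul_le_mul_right _ hNn
  have e₂ : 1 * t ≤ n * t := Nat.mul_le_mul_right _ hn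
  have e₃ : (N + 1) ^ 3 ≤ (4 * M) ^ 3 := Nat.pow_le_pow_left (by omega) 3
  have e₄ : (4 * M) ^ 3 = 64 * M ^ 3 := by ring
  have e₅ : (N + 1) ^ 3 = N ^ 3 + 3 * N ^ 2 + 3 * N + 1 := by ring
  have e₆ : 270 * t + 100 + (150 * (N * (9 * t + N)) + 500 * (N + 1) * (2 * (N * N))) +
      (60 * t + 1400 * ((N + 1) * (N + 1)) + 5) * (N + 1) =
      330 * t + 105 + 1410 * (N * t) + 2400 * N ^ 3 + 5350 * N ^ 2 + 4205 * N + 1400 := by ring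
  rw [e₆] at hk
  rw [e₄, e₅] at e₃
  have p₁ := Nat.zero_le (N ^ 2)
  have p₂ := Nat.zero_le (M ^ 3)
  have p₃ := Nat.zero_le (n * t)
  omega

theorem wp_solveTriangles {B n t : ℕ} {s₀ : State} (hn1 : 1 ≤ n) (hn : s₀.var rN = n)
    (ht : s₀.var rT = t) (hB : 3 * (n * n) * t ≤ B) (hnB : 3 * (n * n) ≤ B) (htB : 9 * t ≤ B)
    (hn1B : n + 1 ≤ B) (hv : ∀ e < 3 * t, s₀.arr aVert e < n)
    (hne : ∀ j < t, s₀.arr aVert (3 * j) ≠ s₀.arr aVert (3 * j + 1))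
    (hcnt : ∀ v, s₀.arr aCnt v = 0) (hload : ∀ v, s₀.arr aLoad v = 0)
    (hheight : ∀ v, s₀.arr aHeight v = 0) (hptr : ∀ v, s₀.arr aPtr v = 0) :
    wp B solveTriangles (fun k s' => ∃ S,
      TriSys.Densest ⟨t, s₀.arr aVert, 0, 0⟩ n S ∧ s'.var rN = #S ∧
      (range #S).image (s'.arr aSrc) = S ∧ k ≤ 200000 * (n * t + min n t ^ 3 + 1)) s₀ := by
  have hB' : n * n * (3 * t) = 3 * (n * n) * t := by ring
  refine wp_seq (wp_enterSlots hn ht (by rw [hB']; exact hB) (by omega) (by omega)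
    (fun e he => by have := hv e he; omega) hcnt hload) ?_
  rintro k₁ s₁ ⟨hE, hmass, hL, hk₁⟩ hfr₁
  obtain ⟨vert, hvert⟩ : ∃ v, s₀.arr aVert = v := ⟨_, rfl⟩
  rw [hvert] at hE hv hne ⊢
  have hT₁ : s₁.var rT = t := (hfr₁.1 _ (by decide)).trans ht
  have hvert₁ : s₁.arr aVert = vert := (hfr₁.2 _ (by decide)).trans hvert
  have hH₁ : ∀ v, s₁.arr aHeight v = 0 := fun v => by
    rw [hfr₁.2 _ (by decide), hheight]
  have hP₁ : ∀ v, s₁.arr aPtr v = 0 := fun v => by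
    rw [hfr₁.2 _ (by decide), hptr]
  -- The bucket lists are final once all slots are entered. `Densest` depends only on `t` and
  -- `vert`, so it is the same notion for `T` and for the system with zero lists in the statement.
  let T : TriSys := ⟨t, vert, s₁.arr aInc, s₁.arr aCnt⟩
  have hact : T.act = (range (3 * t)).image vert := rfl
  obtain ⟨N, hN⟩ : ∃ N, s₁.var rAct = N := ⟨_, rfl⟩
  have hNact : N = #T.act := by rw [← hN, hE.numAct, hact]
  have hactn : T.act ⊆ range n := by
    intro v hv'
    obtain ⟨e, he, rfl⟩ := mem_image.1 hv'
    exact mem_range.2 (hv e (mem_range.1 he))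
  have hNn : N ≤ n := by rw [hNact]; simpa using card_le_card hactn
  have hNt : N ≤ 3 * t := by
    rw [hNact, hact]
    simpa using card_image_le (s := range (3 * t)) (f := vert)
  have hsum : ∑ v ∈ T.act, T.cnt v = 3 * t := by
    have := card_eq_sum_card_image vert (range (3 * t))
    rw [card_range] at this
    rw [this]
    exact sum_congr rfl fun v _ => hE.cnt v
  have hT : T.WF := by
    refine ⟨fun v i hi => (hE.inc v i hi).1, fun v i hi => (hE.inc v i hi).2, hE.surj, hsum⟩
  have hWB : WordBounds T B (3 * (n * n)) N :=
    ⟨by omega, hB, htB, fun e he => by have := hv e he; exact (show vert e ≤ B by omega), by omega⟩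
  simp [hmass, hN]
  refine ⟨hnB, by omega, by omega, by omega, ?_⟩
  -- `rPrev` starts above `rCur` so that the loop is entered.
  set s₂ := (((((((s₁.setVar rMass (3 * (n * n))).setArr aSrc 0 0).setVar rBestT 0).setVar
    rBestN 1).setVar rCap 0).setVar rPrev (N + 1)).setVar rCur N) with hs₂
  -- The first two vertices of each triple differ, so a single vertex contains none: `{0}` is a
  -- legitimate first record, with capacity 0.
  have hcount0 : T.count {0} = 0 := by
    rw [TriSys.count, card_eq_zero, filter_eq_empty_iff]
    rintro j hj ⟨h₀, h₁, -⟩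
    rw [mem_singleton] at h₀ h₁
    exact hne j (mem_range.1 hj) (h₀.trans h₁.symm)
  have hn0 : ({0} : Finset ℕ) ⊆ range n := by simpa using Nat.pos_of_ne_zero (by omega)
  have hinv : RoundInv T (3 * (n * n)) N n s₂ {0} := by
    refine ⟨⟨⟨?_, ?_, ?_, ?_⟩, ?_, hNact.symm, ?_⟩, ?_, ?_, ?_, ⟨by simp, hn0, ?_, ?_, ?_, ?_⟩,
      ?_, ?_⟩
    · simp [hs₂, hvert₁, T]
    · simp [hs₂, T]
    · simp [hs₂, T]
    · simp [hs₂, hL, T]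
    · simp [hs₂, hN]
    · rw [hact, ← hE.act, hN]; simp [hs₂]
    · simp [hs₂, hT₁, T]
    · simp [hs₂]
    · have h₂ : s₂.arr aHeight = fun _ => 0 := by funext v; simp [hs₂, hH₁]
      have h₃ : s₂.arr aPtr = fun _ => 0 := by funext v; simp [hs₂, hP₁]
      have h₄ : s₂.arr aFlow = s₁.arr aFlow := by simp [hs₂]
      have h₅ : s₂.arr aLoad = s₁.arr aLoad := by simp [hs₂]
      rw [h₂, h₃, h₄, h₅]
      refine ⟨fun _ => Nat.zero_le _, fun _ => Nat.zero_le _, fun j hj => ?_, fun v => ?_,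
        fun _ _ _ _ _ _ => Nat.zero_le _, fun _ _ hj => absurd hj (Nat.not_lt_zero _),
        fun _ h => absurd h (lt_irrefl _)⟩
      · have hj' : j < t := hj
        rw [hE.flow _ (by omega), hE.flow _ (by omega), hE.flow _ (by omega)]
        ring
      · rw [hE.load, hE.cnt, mul_comm, ← smul_eq_mul, ← sum_const, sum_filter]
        refine sum_congr rfl fun e he => ?_
        rw [hE.flow e (mem_range.1 he)]
    · simp [hs₂]
    · simp [hs₂, hcount0]
    · simp [hs₂]
    · simp [hs₂, hcount0]
    · have : T.alive N (s₂.arr aHeight) = if 0 < N then T.act else ∅ := by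
        rw [TriSys.alive]
        split_ifs with h
        · exact filter_true_of_mem fun v _ => by simpa [hs₂, hH₁] using h
        · exact filter_false_of_mem fun v _ => by omega
      rw [this]
      split_ifs with h
      · simp [hs₂, hNact]
      · simp [hs₂]; omega
    -- Without triangles every nonempty set is densest. Otherwise a densest set may be intersected
    -- with the vertices in triangles: this loses no triangle and leaves a nonempty set.
    · rcases Nat.eq_zero_or_pos t with h | h
      · left
        refine ⟨by simp, hn0, fun S' _ _ => ?_⟩
        have := T.count_le S'
        have h0 : T.t = 0 := h
        rw [show T.count S' = 0 by omega]
        simp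
      · right
        have hpos : 0 < N := by
          rw [hNact, card_pos, hact]
          exact ⟨vert 0, mem_image_of_mem _ (mem_range.2 (by omega))⟩
        obtain ⟨S, hS⟩ := T.exists_densest hn1
        have halive : T.alive N (s₂.arr aHeight) = T.act :=
          filter_true_of_mem fun v _ => by simpa [hs₂, hH₁] using hpos
        rw [halive]
        refine ⟨S ∩ T.act, hS.of_le ?_ (inter_subset_left.trans hS.2.1) ?_, inter_subset_right⟩
        · rw [nonempty_iff_ne_empty]
          intro hemp
          have h0 : T.count S = 0 := by rw [← T.count_inter_act, hemp, T.count_empty]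
          have hactne : T.act.Nonempty := by rw [← card_pos, ← hNact]; exact hpos
          have h1 := hS.2.2 T.act hactn hactne
          rw [h0, zero_mul, Nat.le_zero, mul_eq_zero] at h1
          have h2 : T.count T.act = t := by
            rw [TriSys.count, filter_true_of_mem, card_range]
            intro j hj
            have hj := mem_range.1 hj
            exact ⟨TriSys.vert_mem_act (by omega), TriSys.vert_mem_act (by omega),
              TriSys.vert_mem_act (by omega)⟩
          have h3 := hS.1.card_pos
          omega
        · rw [T.count_inter_act]
          exact Nat.mul_le_mul_left _ (card_le_card inter_subset_left)
  have hnn : 1 * 1 ≤ n * n := Nat.mul_le_mul hn1 hn1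
  refine wp_mono (wp_rounds hT hWB (by omega) hactn (by omega) hinv (by simp [hs₂])) ?_
  rintro k s' ⟨S, hbest, hdense, hk⟩
  have hSB : #S ≤ n := by simpa using card_le_card hbest.subset
  refine ⟨by rw [hbest.card]; omega, S, hdense, hbest.card, hbest.list, ?_⟩
  refine solve_time_le (W := T.work N (s₂.arr aHeight) (s₂.arr aPtr))
    (R := T.slack N (s₂.arr aHeight)) hn1 hNn hNt ?_ ?_ ?_
  · have : ∀ v ∈ T.act, (N - s₂.arr aHeight v) * (3 * T.cnt v + 1) - s₂.arr aPtr v =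
        N * (3 * T.cnt v + 1) := fun v _ => by simp [hs₂, hH₁, hP₁]
    rw [TriSys.work, sum_congr rfl this, ← mul_sum, sum_add_distrib, ← mul_sum, hsum]
    simp only [sum_const, smul_eq_mul, mul_one, ← hNact]
    ring
  · have : ∀ v ∈ T.act, N - s₂.arr aHeight v = N := fun v _ => by simp [hs₂, hH₁]
    rw [TriSys.slack, sum_congr rfl this, sum_const, ← hNact, smul_eq_mul]
  · simp only [TriSys.credit] at hk
    have hTt : T.t = t := rfl
    rw [hTt] at hk
    omega

/-! ### Listing the triangles -/

/-- Count the edge `rI` at its endpoints. -/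
def countEdge : Prog :=
  rU ≔ aSrc @ₑ &ₑrI ;; rV ≔ aTgt @ₑ &ₑrI ;;
  Prog.store aDeg (&ₑrU) (aDeg @ₑ &ₑrU +ₑ #ₑ1) ;; Prog.store aDeg (&ₑrV) (aDeg @ₑ &ₑrV +ₑ #ₑ1)

/-- Load the edge `rI` into `rU` and `rV`, the endpoint of smaller degree first; ties are broken
by the numbers of the vertices. -/
def loadEdge : Prog :=
  rU ≔ aSrc @ₑ &ₑrI ;; rV ≔ aTgt @ₑ &ₑrI ;;
  Prog.ite (aDeg @ₑ &ₑrV *ₑ &ₑrN +ₑ &ₑrV <ₑ aDeg @ₑ &ₑrU *ₑ &ₑrN +ₑ &ₑrU)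
    (rX ≔ &ₑrU ;; rU ≔ &ₑrV ;; rV ≔ &ₑrX) Prog.skip

/-- Enter the oriented edge `rI` into the adjacency matrix and the lists of outgoing edges. -/
def enterEdge : Prog :=
  Prog.store aSrc (&ₑrI) (&ₑrU) ;; Prog.store aTgt (&ₑrI) (&ₑrV) ;;
  Prog.store aAdj (&ₑrU *ₑ &ₑrN +ₑ &ₑrV) (#ₑ1) ;;
  Prog.store aOut (&ₑrU *ₑ &ₑrM +ₑ aOutDeg @ₑ &ₑrU) (&ₑrI) ;;
  Prog.store aOutDeg (&ₑrU) (aOutDeg @ₑ &ₑrU +ₑ #ₑ1)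

/-- Record the triangle consisting of the edge from `rU` to `rV` and the end of the `rJ`-th edge
that leaves `rU`, if it is one. -/
def testPath : Prog :=
  rW ≔ aTgt @ₑ (aOut @ₑ (&ₑrU *ₑ &ₑrM +ₑ &ₑrJ)) ;;
  Prog.ite (aAdj @ₑ (&ₑrV *ₑ &ₑrN +ₑ &ₑrW))
    (Prog.store aVert (#ₑ3 *ₑ &ₑrT) (&ₑrU) ;; Prog.store aVert (#ₑ3 *ₑ &ₑrT +ₑ #ₑ1) (&ₑrV) ;;
      Prog.store aVert (#ₑ3 *ₑ &ₑrT +ₑ #ₑ2) (&ₑrW) ;; rT ≔ &ₑrT +ₑ #ₑ1) Prog.skip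

/-- Record the triangles that contain the oriented edge `rI` and another edge with the same
tail. -/
def testEdge : Prog :=
  rU ≔ aSrc @ₑ &ₑrI ;; rV ≔ aTgt @ₑ &ₑrI ;; rX ≔ aOutDeg @ₑ &ₑrU ;; forLoop rJ rX testPath

/-- List all triangles. -/
def listTriangles : Prog :=
  forLoop rI rM countEdge ;; forLoop rI rM (loadEdge ;; enterEdge) ;; forLoop rI rM testEdge

/-- The degree of `x` in the graph with the edges `u i`, `v i` for `i < m`. -/
def degree (m : ℕ) (u v : ℕ → ℕ) (x : ℕ) : ℕ := #{i ∈ range m | u i = x} + #{i ∈ range m | v i = x}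

/-- The position of the vertices `x < n` in the degree order. -/
def rank (n m : ℕ) (u v : ℕ → ℕ) (x : ℕ) : ℕ := degree m u v x * n + x

/-- The endpoint of the `i`-th edge that is smaller in the degree order. -/
def tail (n m : ℕ) (u v : ℕ → ℕ) (i : ℕ) : ℕ :=
  if rank n m u v (v i) < rank n m u v (u i) then v i else u i

/-- The endpoint of the `i`-th edge that is larger in the degree order. -/
def head (n m : ℕ) (u v : ℕ → ℕ) (i : ℕ) : ℕ :=
  if rank n m u v (v i) < rank n m u v (u i) then u i else v i

/-! ### Correctness and running time of the triangle listing -/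

theorem degree_succ (j : ℕ) (u v : ℕ → ℕ) (x : ℕ) : degree (j + 1) u v x =
    degree j u v x + (if u j = x then 1 else 0) + (if v j = x then 1 else 0) := by
  simp only [degree, card_filter_range_succ]
  ring

theorem degree_le (j : ℕ) (u v : ℕ → ℕ) (x : ℕ) : degree j u v x ≤ 2 * j := by
  have h₁ : #{i ∈ range j | u i = x} ≤ j := (card_filter_le _ _).trans (card_range j).le
  have h₂ : #{i ∈ range j | v i = x} ≤ j := (card_filter_le _ _).trans (card_range j).le
  rw [degree]; omega

theorem wp_countEdges {B m : ℕ} {s₀ : State} (hm : s₀.var rM = m) (hB : 2 * m ≤ B)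
    (hu : ∀ i < m, s₀.arr aSrc i ≤ B) (hv : ∀ i < m, s₀.arr aTgt i ≤ B)
    (hdeg : ∀ x, s₀.arr aDeg x = 0) :
    wp B (forLoop rI rM countEdge) (fun k s =>
      (∀ x, s.arr aDeg x = degree m (s₀.arr aSrc) (s₀.arr aTgt) x) ∧ k ≤ 38 * m + 6) s₀ := by
  obtain ⟨u, hu'⟩ : ∃ u, s₀.arr aSrc = u := ⟨_, rfl⟩
  obtain ⟨v, hv'⟩ : ∃ v, s₀.arr aTgt = v := ⟨_, rfl⟩
  rw [hu'] at hu
  rw [hv'] at hv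
  rw [hu', hv']
  refine wp_mono (wp_forLoop (J := fun j s => ∀ x, s.arr aDeg x = degree j u v x) (C := 30)
    (by decide) (by decide) (by decide) (by omega) ?_ ?_) ?_
  · simp [degree, hdeg]
  · rintro j s hj hfr hsj hJ
    rw [hm] at hj
    have h₁ : s.arr aSrc = u := (hfr.2 _ (by decide)).trans hu'
    have h₂ : s.arr aTgt = v := (hfr.2 _ (by decide)).trans hv'
    have hd := fun x => degree_le (j + 1) u v x
    have hs : ∀ x, degree (j + 1) u v x =
        (if v j = x then (if u j = x then s.arr aDeg x + 1 else s.arr aDeg x) + 1 else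
          if u j = x then s.arr aDeg x + 1 else s.arr aDeg x) := by
      intro x
      rw [degree_succ, hJ]
      split_ifs <;> omega
    have hdu := hd (u j)
    have hdv := hd (v j)
    have hsu := hs (u j)
    have hsv := hs (v j)
    simp only [if_true] at hsu hsv
    simp [countEdge, hsj, h₁, h₂, Function.update_apply]
    refine ⟨hu j hj, hv j hj, ?_, ?_, ?_⟩
    · split_ifs at hsu <;> omega
    · split_ifs at hsv ⊢ with h h' <;> first | omega | (rw [← h] at *; omega)
    · intro x
      rw [hs]
      by_cases h1 : v j = x
      · subst h1
        by_cases h2 : u j = v j <;> simp [h2, Ne.symm]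
      · by_cases h2 : u j = x
        · subst h2; simp [Ne.symm h1, h1]
        · simp [h1, h2, Ne.symm h1, Ne.symm h2]
  · rintro k s ⟨h, hk⟩
    rw [hm] at h hk
    exact ⟨h, hk⟩

theorem wp_loadEdge {B n m i : ℕ} {u v : ℕ → ℕ} {s : State} (hi : s.var rI = i)
    (hn : s.var rN = n) (hu : s.arr aSrc i = u i) (hv : s.arr aTgt i = v i)
    (hdeg : ∀ x, s.arr aDeg x = degree m u v x) (huB : u i ≤ B) (hvB : v i ≤ B) :
    wp B loadEdge (fun k s' => s'.var rU = tail n m u v i ∧ s'.var rV = head n m u v i ∧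
      k ≤ 40) s := by
  obtain ⟨a, ha⟩ : ∃ a, degree m u v (u i) * n + u i = a := ⟨_, rfl⟩
  obtain ⟨b, hb⟩ : ∃ b, degree m u v (v i) * n + v i = b := ⟨_, rfl⟩
  rw [tail, head, rank, rank, ha, hb]
  simp [loadEdge, hi, hn, hu, hv, hdeg, ha, hb]
  refine ⟨huB, hvB, fun h => ⟨huB, hvB, huB, by simp [h], by simp [h]⟩,
    fun h => ⟨fun h' => absurd h' (not_lt.2 h), fun h' => absurd h' (not_lt.2 h)⟩⟩

/-- The memory after entering the first `i` edges, which lead from `a e` to `b e`. -/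
structure Oriented (u v a b : ℕ → ℕ) (n m i : ℕ) (s : State) : Prop
    extends Bucketed a m i (s.arr aOutDeg) (s.arr aOut) where
  src : ∀ e, s.arr aSrc e = if e < i then a e else u e
  tgt : ∀ e, s.arr aTgt e = if e < i then b e else v e
  adj : ∀ x < n, ∀ y < n, s.arr aAdj (x * n + y) ≠ 0 ↔ ∃ e < i, a e = x ∧ b e = y

theorem wp_enterEdge {B n m i : ℕ} {u v a b : ℕ → ℕ} {s : State} (h : Oriented u v a b n m i s)
    (him : i < m) (hi : s.var rI = i) (hn : s.var rN = n) (hm : s.var rM = m)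
    (ha : s.var rU = a i) (hb : s.var rV = b i) (han : a i < n) (hbn : b i < n)
    (hnB : n ≤ B) (hmB : m ≤ B) :
    wp B enterEdge (fun k s' => Oriented u v a b n m (i + 1) s' ∧ k ≤ 40) s := by
  have hc := h.toBucketed.cnt_le (a i)
  simp [enterEdge, hi, hn, hm, ha, hb]
  refine ⟨by omega, by omega, by omega, by omega, by omega, ⟨?_, ?_, ?_, ?_⟩⟩
  · simpa using h.toBucketed.insert him rfl
  · intro e
    simp [Function.update_apply, h.src]
    split_ifs <;> first | rfl | omega | (subst e; rfl)
  · intro e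
    simp [Function.update_apply, h.tgt]
    split_ifs <;> first | rfl | omega | (subst e; rfl)
  · intro x hx y hy
    simp only [State.setArr_arr]
    simp only [Nat.reduceEqDiff, if_true, if_false]
    rw [Function.update_apply]
    split_ifs with heq
    · obtain ⟨rfl, rfl⟩ := mul_add_inj hy hbn heq
      exact ⟨fun _ => ⟨i, by omega, rfl, rfl⟩, fun _ => one_ne_zero⟩
    · rw [h.adj x hx y hy]
      constructor
      · rintro ⟨e, he, h'⟩
        exact ⟨e, by omega, h'⟩
      · rintro ⟨e, he, rfl, rfl⟩
        rcases Nat.lt_succ_iff_lt_or_eq.1 he with he | rfl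
        · exact ⟨e, he, rfl, rfl⟩
        · exact absurd rfl heq

theorem tail_mem (n m : ℕ) (u v : ℕ → ℕ) (i : ℕ) :
    tail n m u v i = u i ∧ head n m u v i = v i ∧
      rank n m u v (u i) ≤ rank n m u v (v i) ∨
    tail n m u v i = v i ∧ head n m u v i = u i ∧
      rank n m u v (v i) < rank n m u v (u i) := by
  rw [tail, head]
  split_ifs with h
  · exact .inr ⟨rfl, rfl, h⟩
  · exact .inl ⟨rfl, rfl, not_lt.1 h⟩

/-- Edges are oriented in place: cell `j` is read before it is overwritten, and the cells from `j`
on still hold the input, as `Oriented` records. -/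
theorem wp_orientEdges {B n m : ℕ} {u v : ℕ → ℕ} {s₀ : State} (hm : s₀.var rM = m)
    (hn : s₀.var rN = n) (hsrc : s₀.arr aSrc = u) (htgt : s₀.arr aTgt = v)
    (hu : ∀ i < m, u i < n) (hv : ∀ i < m, v i < n)
    (hdeg : ∀ x, s₀.arr aDeg x = degree m u v x)
    (hadj : ∀ x, s₀.arr aAdj x = 0) (hod : ∀ x, s₀.arr aOutDeg x = 0)
    (hnB : n ≤ B) (hmB : m ≤ B) :
    wp B (forLoop rI rM (loadEdge ;; enterEdge)) (fun k s =>
      Oriented u v (tail n m u v) (head n m u v) n m m s ∧ k ≤ 88 * m + 6) s₀ := by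
  refine wp_mono (wp_forLoop
    (J := fun j s => Oriented u v (tail n m u v) (head n m u v) n m j s) (C := 80)
    (by decide) (by decide) (by decide) (by omega) ?_ ?_) ?_
  · refine ⟨⟨?_, ?_, ?_⟩, ?_, ?_, ?_⟩ <;> simp [hsrc, htgt, hadj, hod]
  · rintro j s hj hfr hsj hJ
    rw [hm] at hj
    have huj := hu j hj
    have hvj := hv j hj
    refine wp_seq (wp_loadEdge hsj ((hfr.1 _ (by decide)).trans hn) ?_ ?_
      (fun x => by rw [hfr.2 _ (by decide), hdeg]) (by omega) (by omega)) ?_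
    · rw [hJ.src, if_neg (lt_irrefl _)]
    · rw [hJ.tgt, if_neg (lt_irrefl _)]
    · rintro k s₁ ⟨ha, hb, hk⟩ hfr₁
      have hJ₁ : Oriented u v (tail n m u v) (head n m u v) n m j s₁ := by
        refine ⟨?_, ?_, ?_, ?_⟩
        · rw [hfr₁.2 _ (by decide), hfr₁.2 _ (by decide)]; exact hJ.toBucketed
        · rw [hfr₁.2 _ (by decide)]; exact hJ.src
        · rw [hfr₁.2 _ (by decide)]; exact hJ.tgt
        · rw [hfr₁.2 _ (by decide)]; exact hJ.adj
      have hmem := tail_mem n m u v j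
      refine wp_mono (wp_enterEdge hJ₁ hj ((hfr₁.1 _ (by decide)).trans hsj)
        ((hfr₁.1 _ (by decide)).trans ((hfr.1 _ (by decide)).trans hn))
        ((hfr₁.1 _ (by decide)).trans ((hfr.1 _ (by decide)).trans hm)) ha hb
        (by omega) (by omega) hnB hmB) ?_
      rintro k₂ s₂ ⟨hJ₂, hk₂⟩
      refine ⟨⟨by simpa using hJ₂.toBucketed, ?_, ?_, ?_⟩, by omega⟩
      · simpa using hJ₂.src
      · simpa using hJ₂.tgt
      · simpa using hJ₂.adj
  · rintro k s ⟨h, hk⟩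
    rw [hm] at h hk
    exact ⟨h, hk⟩

/-- The sum of `g` over a list of `t` triples. -/
def tripleSum (t : ℕ) (vert : ℕ → ℕ) (g : ℕ → ℕ → ℕ → ℕ) : ℕ :=
  ∑ k ∈ range t, g (vert (3 * k)) (vert (3 * k + 1)) (vert (3 * k + 2))

/-- The value of `g` at the triple made of the edges `e` and `f`, if there is an edge between
their heads. -/
def pathValue (a b : ℕ → ℕ) (m : ℕ) (g : ℕ → ℕ → ℕ → ℕ) (e f : ℕ) : ℕ :=
  open Classical in if ∃ h < m, a h = b e ∧ b h = b f then g (a e) (b e) (b f) else 0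

/-- The triangle list is described only through the sums of arbitrary functions `g` over it. No
order of the entries need be specified, and suitable `g` later yield both the triangle counts and
the validity of the entries. -/
theorem wp_testPath {B n m e j T₀ : ℕ} {a b : ℕ → ℕ} {F : (ℕ → ℕ → ℕ → ℕ) → ℕ} {s : State}
    (hn : s.var rN = n) (hm : s.var rM = m) (hj : s.var rJ = j) (hU : s.var rU = a e)
    (hV : s.var rV = b e) {f : ℕ} (hf : s.arr aOut (a e * m + j) = f) (hW : s.arr aTgt f = b f)
    (hadj : ∀ x < n, ∀ y < n, s.arr aAdj (x * n + y) ≠ 0 ↔ ∃ h < m, a h = x ∧ b h = y)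
    (hae : a e < n) (hbe : b e < n) (hbf : b f < n) (hnB : n ≤ B) (hB : T₀ + 1 ≤ B)
    (hT : s.var rT ≤ T₀) (hF : ∀ g, tripleSum (s.var rT) (s.arr aVert) g = F g) :
    wp B testPath (fun k s' => s'.var rT ≤ T₀ + 1 ∧
      (∀ g, tripleSum (s'.var rT) (s'.arr aVert) g = F g + pathValue a b m g e f) ∧ k ≤ 50) s := by
  have hadj' := hadj _ hbe _ hbf
  obtain ⟨t, ht⟩ : ∃ t, s.var rT = t := ⟨_, rfl⟩
  rw [ht] at hT hF
  by_cases hc : s.arr aAdj (b e * n + b f) = 0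
  · rw [hc] at hadj'
    simp [testPath, hn, hm, hj, hU, hV, hf, hW, hc, ht]
    refine ⟨by omega, by omega, fun g => ?_⟩
    rw [hF, pathValue, if_neg (by rw [← hadj']; simp), Nat.add_zero]
  · simp [testPath, hn, hm, hj, hU, hV, hf, hW, hc, ht]
    refine ⟨by omega, by omega, by omega, by omega, by omega, by omega, fun g => ?_⟩
    rw [pathValue, if_pos (hadj'.1 hc), ← hF, tripleSum, sum_range_succ, tripleSum]
    congr 1
    · refine sum_congr rfl fun k hk => ?_
      have := mem_range.1 hk
      simp (disch := omega) only [Function.update_of_ne]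
    · simp

/-- The cells of a bucket cover a fibre of `key` and are as many as its elements, so they enumerate
it without repetition. -/
theorem Bucketed.sum_eq {key : ℕ → ℕ} {L j : ℕ} {num lst : ℕ → ℕ} (h : Bucketed key L j num lst)
    (v : ℕ) (g : ℕ → ℕ) :
    ∑ i ∈ range (num v), g (lst (v * L + i)) = ∑ e ∈ range j with key e = v, g e := by
  have himage : (range (num v)).image (fun i => lst (v * L + i)) = {e ∈ range j | key e = v} := by
    ext e
    simp only [mem_image, mem_range, mem_filter]
    constructor
    · rintro ⟨i, hi, rfl⟩
      exact h.inc v i hi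
    · rintro ⟨he, rfl⟩
      exact h.surj e he
  have hinj : Set.InjOn (fun i => lst (v * L + i)) (range (num v) : Set ℕ) := by
    rw [← card_image_iff, himage, card_range, h.cnt]
  rw [← himage, sum_image hinj]

theorem wp_testEdge {B n m i T₀ D : ℕ} {u v a b : ℕ → ℕ} {F : (ℕ → ℕ → ℕ → ℕ) → ℕ} {s : State}
    (h : Oriented u v a b n m m s) (him : i < m) (hi : s.var rI = i) (hn : s.var rN = n)
    (hm : s.var rM = m) (ha : ∀ e < m, a e < n) (hb : ∀ e < m, b e < n) (hnB : n ≤ B)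
    (hB : T₀ + m ≤ B) (hD : #{e ∈ range m | a e = a i} ≤ D) (hT : s.var rT ≤ T₀)
    (hF : ∀ g, tripleSum (s.var rT) (s.arr aVert) g = F g) :
    wp B testEdge (fun k s' => s'.var rT ≤ T₀ + m ∧
      (∀ g, tripleSum (s'.var rT) (s'.arr aVert) g =
        F g + ∑ f ∈ range m with a f = a i, pathValue a b m g i f) ∧ k ≤ 58 * D + 30) s := by
  have hc := h.toBucketed.cnt_le (a i)
  have hsrc := h.src i
  have htgt := h.tgt i
  rw [if_pos him] at hsrc htgt
  have hai := ha i him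
  have hbi := hb i him
  rw [← h.cnt] at hD
  simp [testEdge, hi, hsrc, htgt]
  refine ⟨by omega, by omega, by omega, ?_⟩
  set s₁ := ((s.setVar rU (a i)).setVar rV (b i)).setVar rX (s.arr aOutDeg (a i)) with hs₁
  have hX : s₁.var rX = s.arr aOutDeg (a i) := by simp [hs₁]
  refine wp_mono (wp_forLoop (J := fun j s' => s'.var rT ≤ T₀ + j ∧
    ∀ g, tripleSum (s'.var rT) (s'.arr aVert) g =
      F g + ∑ j' ∈ range j, pathValue a b m g i (s.arr aOut (a i * m + j'))) (C := 50)
    (by decide) (by decide) (by decide) (by rw [hX]; omega) ?_ ?_) ?_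
  · simpa [hs₁, hF] using hT
  · rintro j s₂ hj hfr hsj ⟨hT₂, hF₂⟩
    rw [hX] at hj
    have hf := h.inc _ _ hj
    have hfb := hb _ hf.1
    have hf' := h.tgt (s.arr aOut (a i * m + j))
    rw [if_pos hf.1] at hf'
    refine wp_mono (wp_testPath (a := a) (b := b) (m := m) (e := i)
      (f := s.arr aOut (a i * m + j)) ((hfr.1 _ (by decide)).trans (by simp [hs₁, hn]))
      ((hfr.1 _ (by decide)).trans (by simp [hs₁, hm])) hsj
      ((hfr.1 _ (by decide)).trans (by simp [hs₁])) ((hfr.1 _ (by decide)).trans (by simp [hs₁]))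
      (by rw [hfr.2 _ (by decide)]; simp [hs₁]) (by rw [hfr.2 _ (by decide)]; simpa [hs₁] using hf')
      (by rw [hfr.2 _ (by decide)]; simpa [hs₁] using h.adj) hai hbi hfb hnB (by omega)
      hT₂ hF₂) ?_
    rintro k s₃ ⟨hT₃, hF₃, hk⟩
    refine ⟨⟨by simpa [add_assoc] using hT₃, fun g => ?_⟩, hk⟩
    rw [sum_range_succ, ← add_assoc, ← hF₃]
    simp
  · rintro k s₂ ⟨⟨hT₂, hF₂⟩, hk⟩
    rw [hX] at hT₂ hF₂ hk
    refine ⟨by omega, fun g => ?_, by omega⟩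
    rw [hF₂, h.toBucketed.sum_eq]

/-- The bound `m * m` on the number of triples is crude; it is needed for the word size only. The
running time comes from the out-degree bound `D`. -/
theorem wp_testEdges {B n m D : ℕ} {u v a b : ℕ → ℕ} {s₀ : State}
    (h : Oriented u v a b n m m s₀) (hn : s₀.var rN = n)
    (hm : s₀.var rM = m) (ha : ∀ e < m, a e < n) (hb : ∀ e < m, b e < n) (hnB : n ≤ B)
    (hmB : m ≤ B) (hB : m * m ≤ B) (hD : ∀ i < m, #{e ∈ range m | a e = a i} ≤ D)
    (hT : s₀.var rT = 0) :
    wp B (forLoop rI rM testEdge) (fun k s' => s'.var rT ≤ m * m ∧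
      (∀ g, tripleSum (s'.var rT) (s'.arr aVert) g =
        ∑ i ∈ range m, ∑ f ∈ range m with a f = a i, pathValue a b m g i f) ∧
      k ≤ (58 * D + 38) * m + 6) s₀ := by
  refine wp_mono (wp_forLoop (J := fun i s' => s'.var rT ≤ i * m ∧
    ∀ g, tripleSum (s'.var rT) (s'.arr aVert) g =
      ∑ i' ∈ range i, ∑ f ∈ range m with a f = a i', pathValue a b m g i' f) (C := 58 * D + 30)
    (by decide) (by decide) (by decide) (by omega) ?_ ?_) ?_
  · simp [hT, tripleSum]
  · rintro i s hi hfr hsi ⟨hT, hF⟩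
    rw [hm] at hi
    have hO : Oriented u v a b n m m s := by
      refine ⟨?_, ?_, ?_, ?_⟩
      · rw [hfr.2 _ (by decide), hfr.2 _ (by decide)]; exact h.toBucketed
      · rw [hfr.2 _ (by decide)]; exact h.src
      · rw [hfr.2 _ (by decide)]; exact h.tgt
      · rw [hfr.2 _ (by decide)]; exact h.adj
    have him : i * m + m ≤ B := by
      rw [← Nat.succ_mul]; exact (Nat.mul_le_mul_right _ hi).trans hB
    refine wp_mono (wp_testEdge hO hi hsi ((hfr.1 _ (by decide)).trans hn)
      ((hfr.1 _ (by decide)).trans hm) ha hb hnB him (hD i hi) hT hF) ?_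
    rintro k s' ⟨hT', hF', hk⟩
    refine ⟨⟨by simpa [Nat.succ_mul] using hT', fun g => ?_⟩, hk⟩
    rw [sum_range_succ, ← hF']
    simp
  · rintro k s' ⟨⟨hT', hF'⟩, hk⟩
    rw [hm] at hT' hF' hk
    exact ⟨hT', hF', hk⟩

theorem wp_listTriangles {B n m D : ℕ} {u v : ℕ → ℕ} {s₀ : State} (hn : s₀.var rN = n)
    (hm : s₀.var rM = m) (hsrc : s₀.arr aSrc = u) (htgt : s₀.arr aTgt = v)
    (hu : ∀ i < m, u i < n) (hv : ∀ i < m, v i < n) (hT : s₀.var rT = 0)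
    (hdeg : ∀ x, s₀.arr aDeg x = 0) (hadj : ∀ x, s₀.arr aAdj x = 0)
    (hod : ∀ x, s₀.arr aOutDeg x = 0) (hnB : n ≤ B) (hmB : 2 * m ≤ B) (hB : m * m ≤ B)
    (hD : ∀ i < m, #{e ∈ range m | tail n m u v e = tail n m u v i} ≤ D) :
    wp B listTriangles (fun k s' => s'.var rT ≤ m * m ∧
      (∀ g, tripleSum (s'.var rT) (s'.arr aVert) g =
        ∑ i ∈ range m, ∑ f ∈ range m with tail n m u v f = tail n m u v i,
          pathValue (tail n m u v) (head n m u v) m g i f) ∧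
      k ≤ 200 * (m * D + m + 1)) s₀ := by
  have hmem := tail_mem n m u v
  refine wp_seq (wp_countEdges hm hmB (fun i hi => ?_) (fun i hi => ?_) hdeg) ?_
  · rw [hsrc]; exact (hu i hi).le.trans hnB
  · rw [htgt]; exact (hv i hi).le.trans hnB
  rintro k₁ s₁ ⟨hd₁, hk₁⟩ hfr₁
  rw [hsrc, htgt] at hd₁
  refine wp_seq (wp_orientEdges ((hfr₁.1 _ (by decide)).trans hm)
    ((hfr₁.1 _ (by decide)).trans hn) ((hfr₁.2 _ (by decide)).trans hsrc)
    ((hfr₁.2 _ (by decide)).trans htgt) hu hv hd₁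
    (fun x => by rw [hfr₁.2 _ (by decide), hadj]) (fun x => by rw [hfr₁.2 _ (by decide), hod])
    hnB (by omega)) ?_
  rintro k₂ s₂ ⟨hO, hk₂⟩ hfr₂
  refine wp_mono (wp_testEdges hO ((hfr₂.1 _ (by decide)).trans ((hfr₁.1 _ (by decide)).trans hn))
    ((hfr₂.1 _ (by decide)).trans ((hfr₁.1 _ (by decide)).trans hm)) (fun e he => ?_)
    (fun e he => ?_) hnB (by omega) hB hD
    ((hfr₂.1 _ (by decide)).trans ((hfr₁.1 _ (by decide)).trans hT))) ?_
  · have := hmem e; have := hu e he; have := hv e he; omega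
  · have := hmem e; have := hu e he; have := hv e he; omega
  rintro k₃ s₃ ⟨hT₃, hF₃, hk₃⟩
  refine ⟨hT₃, hF₃, ?_⟩
  have : (58 * D + 38) * m = 58 * (m * D) + 38 * m := by ring
  omega

/-! ### Orienting a graph along a vertex order -/

/-- The edges of `G`, directed towards the larger value of `r`, lead from `a i` to `b i`,
`i < m`. -/
structure IsOrientation {n : ℕ} (G : SimpleGraph (Fin n)) (m : ℕ) (a b r : ℕ → ℕ) : Prop where
  adj : ∀ i < m, ∃ x y : Fin n, G.Adj x y ∧ a i = x ∧ b i = y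
  lt : ∀ i < m, r (a i) < r (b i)
  surj : ∀ x y : Fin n, G.Adj x y → r x < r y → ∃ i < m, a i = x ∧ b i = y
  inj : ∀ i < m, ∀ j < m, a i = a j → b i = b j → i = j
  rank_inj : ∀ x y : Fin n, r x = r y → x = y

/-- An increasing map between two chains of three elements is the identity on positions. -/
theorem eq_of_same_members {r : ℕ → ℕ} {x y z x' y' z' : ℕ} (h₁ : r x < r y) (h₂ : r y < r z)
    (h₁' : r x' < r y') (h₂' : r y' < r z')
    (hx : x = x' ∨ x = y' ∨ x = z') (hy : y = x' ∨ y = y' ∨ y = z')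
    (hz : z = x' ∨ z = y' ∨ z = z') : x = x' ∧ y = y' ∧ z = z' := by
  rcases hx with rfl | rfl | rfl <;> rcases hy with rfl | rfl | rfl <;>
    rcases hz with rfl | rfl | rfl <;> first | exact ⟨rfl, rfl, rfl⟩ | (exfalso; omega)

namespace IsOrientation

variable {n m : ℕ} {G : SimpleGraph (Fin n)} {a b r : ℕ → ℕ}

theorem exists_sorted (h : IsOrientation G m a b r) {T : Finset (Fin n)} (hT : G.IsNClique 3 T) :
    ∃ x y z : Fin n, r x < r y ∧ r y < r z ∧ G.Adj x y ∧ G.Adj x z ∧ G.Adj y z ∧ T = {x, y, z} := by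
  obtain ⟨x, y, z, hxy, hxz, hyz, rfl⟩ := SimpleGraph.is3Clique_iff.1 hT
  have h₁ : r x ≠ r y := fun h' => hxy.ne (h.rank_inj _ _ h')
  have h₂ : r x ≠ r z := fun h' => hxz.ne (h.rank_inj _ _ h')
  have h₃ : r y ≠ r z := fun h' => hyz.ne (h.rank_inj _ _ h')
  rcases lt_or_gt_of_ne h₁ with h₁ | h₁ <;> rcases lt_or_gt_of_ne h₂ with h₂ | h₂ <;>
    rcases lt_or_gt_of_ne h₃ with h₃ | h₃
  · exact ⟨x, y, z, h₁, h₃, hxy, hxz, hyz, rfl⟩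
  · exact ⟨x, z, y, h₂, h₃, hxz, hxy, hyz.symm, by ext; simp; tauto⟩
  · omega
  · exact ⟨z, x, y, h₂, h₁, hxz.symm, hyz.symm, hxy, by ext; simp; tauto⟩
  · exact ⟨y, x, z, h₁, h₂, hxy.symm, hyz, hxz, by ext; simp; tauto⟩
  · omega
  · exact ⟨y, z, x, h₃, h₂, hyz, hxy.symm, hxz.symm, by ext; simp; tauto⟩
  · exact ⟨z, y, x, h₃, h₁, hyz.symm, hxz.symm, hxy.symm, by ext; simp; tauto⟩

/-- The pairs of oriented edges with the same tail that span a triangle with vertices in `S`. -/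
noncomputable def forks (m : ℕ) (a b : ℕ → ℕ) (S : Finset ℕ) : Finset (ℕ × ℕ) :=
  open Classical in {p ∈ range m ×ˢ range m | a p.2 = a p.1 ∧
    (∃ h < m, a h = b p.1 ∧ b h = b p.2) ∧ a p.1 ∈ S ∧ b p.1 ∈ S ∧ b p.2 ∈ S}

theorem sum_pathValue (S : Finset ℕ) :
    ∑ i ∈ range m, ∑ f ∈ range m with a f = a i,
      pathValue a b m (fun x y z => if x ∈ S ∧ y ∈ S ∧ z ∈ S then 1 else 0) i f =
    #(forks m a b S) := by
  classical
  rw [forks, card_filter, sum_product]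
  refine sum_congr rfl fun i _ => ?_
  rw [sum_filter]
  refine sum_congr rfl fun f _ => ?_
  simp only [pathValue, ← ite_and]

/-- The vertices of a fork. -/
def triple (n : ℕ) (a b : ℕ → ℕ) (p : ℕ × ℕ) : Finset (Fin n) :=
  {x | (x : ℕ) = a p.1 ∨ (x : ℕ) = b p.1 ∨ (x : ℕ) = b p.2}

/-- The edge closing a fork runs from `b p.1` to `b p.2`, so a fork names its vertices in increasing
rank. The vertex set therefore determines the tail and both heads, and hence the two edges. -/
theorem triple_injOn (h : IsOrientation G m a b r) (S : Finset ℕ) :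
    Set.InjOn (triple n a b) (forks m a b S : Set (ℕ × ℕ)) := by
  rintro ⟨i, f⟩ hp ⟨i', f'⟩ hq heq
  simp only [forks, mem_coe, mem_filter, mem_product, mem_range] at hp hq
  obtain ⟨⟨hi, hf⟩, hfa, ⟨e, he, hea, heb⟩, -⟩ := hp
  obtain ⟨⟨hi', hf'⟩, hfa', ⟨e', he', hea', heb'⟩, -⟩ := hq
  have hmem : ∀ x : Fin n, ((x : ℕ) = a i ∨ (x : ℕ) = b i ∨ (x : ℕ) = b f) →
      ((x : ℕ) = a i' ∨ (x : ℕ) = b i' ∨ (x : ℕ) = b f') := fun x hx => by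
    have : x ∈ triple n a b (i', f') := heq ▸ (by simpa [triple] using hx)
    simpa [triple] using this
  have l₁ := h.lt i hi
  have l₂ := h.lt e he
  have l₁' := h.lt i' hi'
  have l₂' := h.lt e' he'
  rw [hea, heb] at l₂
  rw [hea', heb'] at l₂'
  obtain ⟨x, y, -, hx, hy⟩ := h.adj i hi
  obtain ⟨-, z, -, -, hz⟩ := h.adj f hf
  obtain ⟨h₁, h₂, h₃⟩ := eq_of_same_members l₁ l₂ l₁' l₂'
    (hx ▸ hmem x (.inl hx.symm)) (hy ▸ hmem y (.inr (.inl hy.symm)))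
    (hz ▸ hmem z (.inr (.inr hz.symm)))
  exact Prod.ext (h.inj i hi i' hi' h₁ h₂) (h.inj f hf f' hf' (hfa.trans (h₁.trans hfa'.symm)) h₃)

/-- Sorting a triangle as `x, y, z` by rank, the edges `x → y` and `x → z` form its fork, closed by
`y → z`. -/
theorem image_triple (h : IsOrientation G m a b r) (S : Finset (Fin n)) :
    triple n a b '' (forks m a b (S.image Fin.val) : Set (ℕ × ℕ)) =
      {T : Finset (Fin n) | G.IsNClique 3 T ∧ T ⊆ S} := by
  have hS : ∀ x : Fin n, (x : ℕ) ∈ S.image Fin.val ↔ x ∈ S := fun x => by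
    simp [Fin.val_inj]
  have ht : ∀ (x y z : Fin n) (i f : ℕ), a i = x → b i = y → b f = z →
      triple n a b (i, f) = {x, y, z} := fun x y z i f hx hy hz => by
    ext w; simp [triple, hx, hy, hz, Fin.val_inj]
  ext T
  simp only [Set.mem_image, Set.mem_ofPred_eq, forks, mem_coe, mem_filter, mem_product, mem_range]
  constructor
  · rintro ⟨⟨i, f⟩, ⟨⟨hi, hf⟩, hfa, ⟨e, he, hea, heb⟩, h₁, h₂, h₃⟩, rfl⟩
    dsimp only at *
    obtain ⟨x, y, hxy, hx, hy⟩ := h.adj i hi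
    obtain ⟨x', z, hxz, hx', hz⟩ := h.adj f hf
    obtain ⟨y', z', hyz, hy', hz'⟩ := h.adj e he
    obtain rfl : x' = x := Fin.ext (by omega)
    obtain rfl : y' = y := Fin.ext (by omega)
    obtain rfl : z' = z := Fin.ext (by omega)
    rw [hx, hS] at h₁
    rw [hy, hS] at h₂
    rw [hz, hS] at h₃
    rw [ht _ _ _ _ _ hx hy hz]
    refine ⟨SimpleGraph.is3Clique_iff.2 ⟨_, _, _, hxy, hxz, hyz, rfl⟩, ?_⟩
    simp [insert_subset_iff, h₁, h₂, h₃]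
  · rintro ⟨hT, hTS⟩
    obtain ⟨x, y, z, l₁, l₂, hxy, hxz, hyz, rfl⟩ := h.exists_sorted hT
    obtain ⟨i, hi, hx, hy⟩ := h.surj x y hxy l₁
    obtain ⟨f, hf, hx', hz⟩ := h.surj x z hxz (l₁.trans l₂)
    obtain ⟨e, he, hy', hz'⟩ := h.surj y z hyz l₂
    simp only [insert_subset_iff, singleton_subset_iff] at hTS
    refine ⟨(i, f), ⟨⟨hi, hf⟩, hx'.trans hx.symm, ⟨e, he, hy'.trans hy.symm, hz'.trans hz.symm⟩,
      ?_, ?_, ?_⟩, ht _ _ _ _ _ hx hy hz⟩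
    · rw [hx, hS]; exact hTS.1
    · rw [hy, hS]; exact hTS.2.1
    · rw [hz, hS]; exact hTS.2.2

theorem card_forks (h : IsOrientation G m a b r) (S : Finset (Fin n)) :
    #(forks m a b (S.image Fin.val)) = triangles G S := by
  rw [triangles, ← h.image_triple, (h.triple_injOn _).ncard_image,
    Set.ncard_coe_finset]

theorem le_sq (h : IsOrientation G m a b r) : m ≤ n * n := by
  have : #((range m).image fun i => (a i, b i)) ≤ #(range n ×ˢ range n) := by
    refine card_le_card fun p hp => ?_
    obtain ⟨i, hi, rfl⟩ := mem_image.1 hp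
    obtain ⟨x, y, -, hx, hy⟩ := h.adj i (mem_range.1 hi)
    simp [hx, hy]
  rwa [card_image_of_injOn, card_product, card_range, card_range] at this
  intro i hi j hj hij
  simp only [coe_range, Set.mem_Iio, Prod.mk.injEq] at hi hj hij
  exact h.inj i hi j hj hij.1 hij.2

end IsOrientation

/-! ### The degree order of an edge list -/

theorem rank_inj {n m : ℕ} {u v : ℕ → ℕ} {x y : ℕ} (hx : x < n) (hy : y < n)
    (h : rank n m u v x = rank n m u v y) : x = y :=
  (mul_add_inj hx hy h).2

theorem sum_degree {n m : ℕ} {u v : ℕ → ℕ} (hu : ∀ i < m, u i < n) (hv : ∀ i < m, v i < n) :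
    ∑ x ∈ range n, degree m u v x = 2 * m := by
  simp only [degree, sum_add_distrib]
  rw [← card_eq_sum_card_fiberwise, ← card_eq_sum_card_fiberwise, card_range]
  · ring
  · intro i hi; simpa using hv i (by simpa using hi)
  · intro i hi; simpa using hu i (by simpa using hi)

/-- The edges leaving `x` lead to distinct vertices whose degrees are at least that of `x`, hence at
least the out-degree. The square of the out-degree is thus at most the sum of all degrees, `2m`. -/
theorem out_degree_le {n m : ℕ} {u v : ℕ → ℕ} {G : SimpleGraph (Fin n)}
    (h : IsOrientation G m (tail n m u v) (head n m u v) (rank n m u v))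
    (hu : ∀ i < m, u i < n) (hv : ∀ i < m, v i < n) {i : ℕ} :
    #{e ∈ range m | tail n m u v e = tail n m u v i} ≤ Nat.sqrt (2 * m) := by
  set x := tail n m u v i
  set s := {e ∈ range m | tail n m u v e = x} with hs
  have hmem := tail_mem n m u v
  have hdeg : #s ≤ degree m u v x := by
    have : s ⊆ {e ∈ range m | u e = x} ∪ {e ∈ range m | v e = x} := by
      intro e he
      simp only [hs, mem_filter, mem_union] at he ⊢
      have := hmem e
      rcases this with ⟨h₁, -⟩ | ⟨h₁, -⟩
      · exact .inl ⟨he.1, h₁ ▸ he.2⟩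
      · exact .inr ⟨he.1, h₁ ▸ he.2⟩
    exact (card_le_card this).trans (card_union_le _ _)
  have hinj : Set.InjOn (head n m u v) (s : Set ℕ) := by
    intro e he f hf hef
    simp only [hs, mem_coe, mem_filter, mem_range] at he hf
    exact h.inj e he.1 f hf.1 (he.2.trans hf.2.symm) hef
  rw [Nat.le_sqrt]
  calc #s * #s ≤ ∑ e ∈ s, degree m u v (head n m u v e) := by
        rw [← smul_eq_mul]
        refine card_nsmul_le_sum _ _ _ fun e he => hdeg.trans ?_
        simp only [hs, mem_filter, mem_range] at he
        have hlt := h.lt e he.1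
        rw [he.2, rank, rank] at hlt
        obtain ⟨-, y, -, -, hy⟩ := h.adj e he.1
        have hyn := y.2
        -- A smaller degree at the head would lower the rank by at least `n`, more than vertex
        -- numbers below `n` can make up.
        by_contra! hcon
        have := Nat.mul_le_mul_right n (Nat.succ_le_of_lt hcon)
        rw [Nat.succ_mul] at this
        omega
    _ = ∑ y ∈ s.image (head n m u v), degree m u v y := (sum_image hinj).symm
    _ ≤ ∑ y ∈ range n, degree m u v y := by
        refine sum_le_sum_of_subset fun y hy => ?_
        obtain ⟨e, he, rfl⟩ := mem_image.1 hy
        simp only [hs, mem_filter, mem_range] at he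
        obtain ⟨-, y, -, -, hy⟩ := h.adj e he.1
        simp [hy]
    _ = 2 * m := sum_degree hu hv

/-- The sequence with the given first `m` terms. -/
def extend {n m : ℕ} (u : Fin m → Fin n) (i : ℕ) : ℕ := if h : i < m then u ⟨i, h⟩ else 0

theorem IsEdgeList.isOrientation {n m : ℕ} {G : SimpleGraph (Fin n)} {u v : Fin m → Fin n}
    (h : IsEdgeList G u v) : IsOrientation G m (tail n m (extend u) (extend v))
      (head n m (extend u) (extend v)) (rank n m (extend u) (extend v)) := by
  obtain ⟨hinj, hrange⟩ := h
  have hu : ∀ i (hi : i < m), extend u i = u ⟨i, hi⟩ := fun i hi => dif_pos hi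
  have hv : ∀ i (hi : i < m), extend v i = v ⟨i, hi⟩ := fun i hi => dif_pos hi
  have hadj : ∀ i, G.Adj (u i) (v i) := fun i => by
    rw [← SimpleGraph.mem_edgeSet, ← hrange]; exact ⟨i, rfl⟩
  have hmem := tail_mem n m (extend u) (extend v)
  have hr : ∀ x y : Fin n, rank n m (extend u) (extend v) x = rank n m (extend u) (extend v) y →
      x = y := fun x y h => Fin.ext (rank_inj x.2 y.2 h)
  refine ⟨fun i hi => ?_, fun i hi => ?_, fun x y hxy hlt => ?_, fun i hi j hj h₁ h₂ => ?_, hr⟩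
  · rcases hmem i with ⟨h₁, h₂, -⟩ | ⟨h₁, h₂, -⟩
    · exact ⟨_, _, hadj ⟨i, hi⟩, h₁.trans (hu i hi), h₂.trans (hv i hi)⟩
    · exact ⟨_, _, (hadj ⟨i, hi⟩).symm, h₁.trans (hv i hi), h₂.trans (hu i hi)⟩
  · rcases hmem i with ⟨h₁, h₂, h₃⟩ | ⟨h₁, h₂, h₃⟩
    · rw [h₁, h₂]
      refine lt_of_le_of_ne h₃ fun heq => (hadj ⟨i, hi⟩).ne (hr _ _ ?_)
      rwa [hu i hi, hv i hi] at heq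
    · rw [h₁, h₂]; exact h₃
  · have hedge : s(x, y) ∈ G.edgeSet := hxy
    rw [← hrange] at hedge
    obtain ⟨⟨i, hi⟩, he⟩ := hedge
    refine ⟨i, hi, ?_⟩
    simp only [Sym2.eq_iff] at he
    rw [tail, head, hu i hi, hv i hi]
    rcases he with ⟨h₁, h₂⟩ | ⟨h₁, h₂⟩
    · rw [h₁, h₂, if_neg hlt.not_gt, if_neg hlt.not_gt]; exact ⟨rfl, rfl⟩
    · rw [h₁, h₂, if_pos hlt, if_pos hlt]; exact ⟨rfl, rfl⟩
  · have : (⟨i, hi⟩ : Fin m) = ⟨j, hj⟩ := by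
      apply hinj
      simp only [Sym2.eq_iff]
      have e₁ := hu i hi
      have e₂ := hv i hi
      have e₃ := hu j hj
      have e₄ := hv j hj
      have m₁ := hmem i
      have m₂ := hmem j
      simp only [Fin.ext_iff]
      omega
    simpa using this

/-! ### The algorithm -/

/-- Find a densest set of vertices. -/
def densestSubgraph : Prog := listTriangles ;; solveTriangles

theorem densestSubgraph_small : densestSubgraph.small = true := by decide +kernel

/-- Taking for `g` the indicator of failure turns a statement about sums into one about every entry
of the list. -/
theorem tripleSum_eq_zero {t : ℕ} {vert : ℕ → ℕ} {p : ℕ → ℕ → ℕ → Prop}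
    [∀ x y z, Decidable (p x y z)]
    (h : tripleSum t vert (fun x y z => if p x y z then 0 else 1) = 0) {j : ℕ} (hj : j < t) :
    p (vert (3 * j)) (vert (3 * j + 1)) (vert (3 * j + 2)) := by
  rw [tripleSum, sum_eq_zero_iff] at h
  have := h j (mem_range.2 hj)
  by_contra hcon
  simp [hcon] at this

theorem tripleSum_mem (t : ℕ) (vert : ℕ → ℕ) (S : Finset ℕ) :
    tripleSum t vert (fun x y z => if x ∈ S ∧ y ∈ S ∧ z ∈ S then 1 else 0) =
      TriSys.count ⟨t, vert, 0, 0⟩ S := by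
  rw [tripleSum, TriSys.count, card_filter]

theorem image_val_univ (n : ℕ) : (univ : Finset (Fin n)).image Fin.val = range n := by
  ext x
  simp only [mem_image, mem_univ, true_and, mem_range]
  exact ⟨fun ⟨y, h⟩ => h ▸ y.2, fun h => ⟨⟨x, h⟩, rfl⟩⟩

theorem TriSys.Densest.isTriangleDensest {n : ℕ} {T : TriSys} {G : SimpleGraph (Fin n)}
    {S : Finset (Fin n)} (h : T.Densest n (S.image Fin.val))
    (hcount : ∀ S : Finset (Fin n), T.count (S.image Fin.val) = triangles G S) :
    IsTriangleDensest G S := by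
  have hcard : ∀ S : Finset (Fin n), #(S.image Fin.val) = #S := fun S =>
    card_image_of_injective _ Fin.val_injective
  have hS : S.Nonempty := image_nonempty.1 h.1
  refine ⟨hS, fun S' hS' => ?_⟩
  have := h.2.2 (S'.image Fin.val) (fun x hx => by
    obtain ⟨y, -, rfl⟩ := mem_image.1 hx
    simp) (hS'.image _)
  rw [hcount, hcount, hcard, hcard] at this
  have h₁ : (0 : ℚ) < #S := by exact_mod_cast hS.card_pos
  have h₂ : (0 : ℚ) < #S' := by exact_mod_cast hS'.card_pos
  rw [density, density, div_le_div_iff₀ h₂ h₁]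
  exact_mod_cast this

theorem wp_densestSubgraph {B n m : ℕ} (hn : 1 ≤ n) {G : SimpleGraph (Fin n)}
    {u v : Fin m → Fin n} (h : IsEdgeList G u v) (hB : (n + 2) ^ 8 ≤ B) :
    wp B densestSubgraph (fun k s => ∃ S : Finset (Fin n), Outputs s S ∧ IsTriangleDensest G S ∧
      k ≤ 200 * (m * Nat.sqrt (2 * m) + m + 1) + 200000 * (n * triangles G univ +
        min n (triangles G univ) ^ 3 + 1)) (inputState u v) := by
  have hO := h.isOrientation
  have hu : ∀ i < m, extend u i < n := fun i hi => by rw [extend, dif_pos hi]; exact Fin.is_lt _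
  have hv : ∀ i < m, extend v i < n := fun i hi => by rw [extend, dif_pos hi]; exact Fin.is_lt _
  have hmem := tail_mem n m (extend u) (extend v)
  have hmn := hO.le_sq
  have hmm : m * m ≤ (n * n) * (n * n) := Nat.mul_le_mul hmn hmn
  -- With `m ≤ n²` and at most `m² ≤ n⁴` triples, the largest number is the total mass `3n²t ≤ 3n⁶`;
  -- exponent 8 leaves room for the coefficients and for small `n`.
  have hB₆ : 3 * ((n * n) * ((n * n) * (n * n))) + 9 * ((n * n) * (n * n)) + 3 * (n * n) + n + 1
      ≤ (n + 2) ^ 8 := by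
    have e₁ : n ^ 4 ≤ n ^ 6 := Nat.pow_le_pow_right (by omega) (by norm_num)
    have e₂ : n ^ 2 ≤ n ^ 6 := Nat.pow_le_pow_right (by omega) (by norm_num)
    have e₃ : n ^ 1 ≤ n ^ 6 := Nat.pow_le_pow_right (by omega) (by norm_num)
    have e₄ : n ^ 0 ≤ n ^ 6 := Nat.pow_le_pow_right (by omega) (by norm_num)
    have e₅ : (n + 2) ^ 8 = n ^ 8 + 16 * n ^ 7 + 112 * n ^ 6 + 448 * n ^ 5 + 1120 * n ^ 4 +
      1792 * n ^ 3 + 1792 * n ^ 2 + 1024 * n + 256 := by ring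
    have e₆ : 3 * ((n * n) * ((n * n) * (n * n))) + 9 * ((n * n) * (n * n)) + 3 * (n * n) + n + 1
      = 3 * n ^ 6 + 9 * n ^ 4 + 3 * n ^ 2 + n ^ 1 + n ^ 0 := by ring
    rw [e₆, e₅]
    omega
  have hnn := Nat.zero_le ((n * n) * ((n * n) * (n * n)))
  have hnn' : n * n ≤ (n * n) * (n * n) := Nat.le_mul_self _
  refine wp_seq (wp_listTriangles (u := extend u) (v := extend v) (n := n) (m := m)
    (D := Nat.sqrt (2 * m)) rfl rfl ?_ ?_ hu hv rfl ?_ ?_ ?_ (by omega) (by omega) (by omega)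
    fun i _ => out_degree_le hO hu hv) ?_
  iterate 2 · funext i; simp [inputState, extend]
  iterate 3 · intro x; simp [inputState]
  rintro k₁ s₁ ⟨ht, hsum, hk₁⟩ hfr
  obtain ⟨t, htdef⟩ : ∃ t, s₁.var rT = t := ⟨_, rfl⟩
  obtain ⟨vert, hvert⟩ : ∃ f, s₁.arr aVert = f := ⟨_, rfl⟩
  rw [htdef] at ht hsum
  rw [hvert] at hsum
  have hcount : ∀ S : Finset (Fin n),
      TriSys.count ⟨t, vert, 0, 0⟩ (S.image Fin.val) = triangles G S := fun S => by
    rw [← tripleSum_mem, hsum, IsOrientation.sum_pathValue, hO.card_forks]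
  -- The indicator of bad triples sums to zero: endpoints are below `n`, and the first two vertices
  -- differ because an oriented edge increases the rank.
  have hgood : ∀ j < t, vert (3 * j) < n ∧ vert (3 * j + 1) < n ∧ vert (3 * j + 2) < n ∧
      vert (3 * j) ≠ vert (3 * j + 1) := fun j hj => by
    refine tripleSum_eq_zero (p := fun x y z => x < n ∧ y < n ∧ z < n ∧ x ≠ y) ?_ hj
    rw [hsum]
    refine sum_eq_zero fun i hi => sum_eq_zero fun f hf => ?_
    rw [pathValue]
    split_ifs with h₁ h₂
    · rfl
    · refine absurd ⟨?_, ?_, ?_, fun heq => ?_⟩ h₂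
      · have := hmem i; have := hu i (mem_range.1 hi); have := hv i (mem_range.1 hi); omega
      · have := hmem i; have := hu i (mem_range.1 hi); have := hv i (mem_range.1 hi); omega
      · have hf' := mem_range.1 (mem_filter.1 hf).1
        have := hmem f; have := hu f hf'; have := hv f hf'; omega
      · have := hO.lt i (mem_range.1 hi)
        rw [heq] at this
        exact lt_irrefl _ this
    · rfl
  have hlt : ∀ e < 3 * t, vert e < n := fun e he => by
    have h₁ := hgood (e / 3) (by omega)
    obtain h₂ | h₂ | h₂ : e = 3 * (e / 3) ∨ e = 3 * (e / 3) + 1 ∨ e = 3 * (e / 3) + 2 := by omega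
    · rw [h₂]; exact h₁.1
    · rw [h₂]; exact h₁.2.1
    · rw [h₂]; exact h₁.2.2.1
  have htri : triangles G univ = t := by
    rw [← hcount, image_val_univ, TriSys.count, filter_true_of_mem, card_range]
    intro j hj
    have := hgood j (mem_range.1 hj)
    simp only [mem_range]
    exact ⟨this.1, this.2.1, this.2.2.1⟩
  have ht' : t ≤ (n * n) * (n * n) := ht.trans hmm
  have ht₆ : (n * n) * t ≤ (n * n) * ((n * n) * (n * n)) := Nat.mul_le_mul_left _ ht'
  refine wp_mono (wp_solveTriangles (n := n) (t := t) hn ((hfr.1 _ (by decide)).trans rfl) htdef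
    (by rw [Nat.mul_assoc]; omega) (by omega) (by omega) (by omega) (by rw [hvert]; exact hlt)
    (by rw [hvert]; exact fun j hj => (hgood j hj).2.2.2) ?_ ?_ ?_ ?_) ?_
  iterate 4 · intro x; rw [hfr.2 _ (by decide)]; simp [inputState]
  rintro k₂ s₂ ⟨S, hS, hout, hlist, hk₂⟩
  rw [hvert] at hS
  have hSimage : ({x | (x : ℕ) ∈ S} : Finset (Fin n)).image Fin.val = S := by
    ext x
    simp only [mem_image, mem_filter, mem_univ, true_and]
    exact ⟨fun ⟨y, h, h'⟩ => h' ▸ h, fun hx => ⟨⟨x, mem_range.1 (hS.2.1 hx)⟩, hx, rfl⟩⟩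
  have hcard : #({x | (x : ℕ) ∈ S} : Finset (Fin n)) = #S := by
    rw [← card_image_of_injective _ Fin.val_injective, hSimage]
  refine ⟨({x | (x : ℕ) ∈ S} : Finset (Fin n)), ⟨?_, ?_⟩, ?_, ?_⟩
  · rw [hcard]; exact hout
  · rw [hcard, hSimage]; exact hlist
  · exact TriSys.Densest.isTriangleDensest (hSimage.symm ▸ hS) hcount
  · rw [htri]
    omega

/-! ### The time bound with real exponents -/

theorem mul_sqrt_le (m : ℕ) :
    (m : ℝ) * (Nat.sqrt (2 * m) : ℝ) + m ≤ 3 * (m : ℝ) ^ (3 / 2 : ℝ) := by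
  have hm : (0 : ℝ) ≤ m := Nat.cast_nonneg m
  have h₁ : (m : ℝ) ^ (3 / 2 : ℝ) = m * √m := by
    rcases hm.eq_or_lt with h | h
    · rw [← h, zero_mul, Real.zero_rpow (by norm_num)]
    · rw [show (3 / 2 : ℝ) = 1 + 1 / 2 by norm_num, Real.rpow_add h, Real.rpow_one,
        Real.sqrt_eq_rpow]
  have h₂ : (Nat.sqrt (2 * m) : ℝ) ≤ 2 * √m := by
    refine Real.nat_sqrt_le_real_sqrt.trans ?_
    rw [Real.sqrt_le_left (by positivity), mul_pow, Real.sq_sqrt hm]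
    push_cast
    linarith
  have h₃ : (m : ℝ) ≤ m * √m := by
    rcases Nat.eq_zero_or_pos m with rfl | h
    · simp
    · have : (1 : ℝ) ≤ m := by exact_mod_cast h
      exact le_mul_of_one_le_right hm (Real.one_le_sqrt.2 this)
  rw [h₁]
  nlinarith [mul_le_mul_of_nonneg_left h₂ hm]

theorem time_le {k n m t : ℕ} (hk : k ≤ 200 * (m * Nat.sqrt (2 * m) + m + 1) +
    200000 * (n * t + min n t ^ 3 + 1)) :
    (k : ℝ) ≤ (300000 : ℕ) * ((m : ℝ) ^ (3 / 2 : ℝ) + (n : ℝ) * (t : ℝ) +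
      (min (n : ℝ) (t : ℝ)) ^ 3 + 1) := by
  have h := (Nat.cast_le (α := ℝ)).2 hk
  push_cast at h ⊢
  have h₁ := mul_sqrt_le m
  have h₂ : (0 : ℝ) ≤ (m : ℝ) ^ (3 / 2 : ℝ) := Real.rpow_nonneg (Nat.cast_nonneg m) _
  have h₃ : (0 : ℝ) ≤ (n : ℝ) * (t : ℝ) := by positivity
  have h₄ : (0 : ℝ) ≤ (min (n : ℝ) (t : ℝ)) ^ 3 := by positivity
  linarith

theorem inputState_bddBy {B n m : ℕ} (u v : Fin m → Fin n) (hn : n ≤ B) (hm : m ≤ B) :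
    (inputState u v).BddBy B := by
  refine ⟨fun x => ?_, fun a i => ?_⟩
  · simp only [inputState]
    split_ifs <;> omega
  · simp only [inputState]
    split_ifs <;> omega

end TDS

theorem theorem1 :
    ∃ (P : TDS.Prog) (d C : ℕ),
      ∀ (n m : ℕ) (_ : 1 ≤ n) (G : SimpleGraph (Fin n)) (u v : Fin m → Fin n)
        (_ : TDS.IsEdgeList G u v),
        ∃ (k : ℕ) (s : TDS.State) (S : Finset (Fin n)),
          TDS.Runs ((n + 2) ^ d) P (TDS.inputState u v) k s ∧
          TDS.Outputs s S ∧
          TDS.IsTriangleDensest G S ∧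
          (k : ℝ) ≤ C * ((m : ℝ) ^ (3 / 2 : ℝ)
            + (n : ℝ) * (TDS.triangles G Finset.univ : ℝ)
            + (min (n : ℝ) (TDS.triangles G Finset.univ : ℝ)) ^ 3 + 1) := by
  -- Memory contents are at most `(n + 2) ^ 8` and expressions have at most 12 leaves; the exponent
  -- `97 = 8 * 12 + 1` makes the inequality strict.
  refine ⟨TDS.densestSubgraph, 97, 300000, fun n m hn G u v h => ?_⟩
  have hm : m ≤ n * n := h.isOrientation.le_sq
  have h₁ : (n + 2) ^ 1 ≤ (n + 2) ^ 8 := Nat.pow_le_pow_right (by omega) (by norm_num)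
  have h₂ : (n + 2) ^ 2 ≤ (n + 2) ^ 8 := Nat.pow_le_pow_right (by omega) (by norm_num)
  have h₃ : n * n ≤ (n + 2) ^ 2 := by nlinarith
  rw [pow_one] at h₁
  have hW : ((n + 2) ^ 8) ^ 12 < (n + 2) ^ 97 := by
    rw [← pow_mul]
    exact Nat.pow_lt_pow_right (by omega) (by norm_num)
  obtain ⟨k, s, hrun, -, S, hout, hS, hk⟩ := TDS.wp_sound (by omega) hW _
    TDS.densestSubgraph_small (TDS.inputState_bddBy u v (by omega) (by omega))
    (TDS.wp_densestSubgraph hn h le_rfl)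
  exact ⟨k, s, S, hrun, hout, hS, TDS.time_le hk⟩
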